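/- Let $b\in[0,1)$, $\tau>0$ and $c\in\mathbb R$. A \emph{monotone travelling front} of speed $c$ of the neutral KPP–Fisher equation $$\partial_t\bigl(u(t,x)-bu(t-\tau,x)\bigr)=\partial_{xx}\bigl(u(t,x)-bu(t-\tau,x)\bigr)+u(t,x)\bigl(1-u(t-\tau,x)\bigr)$$ is a solution $u(t,x)=\phi(x+ct)$ with $\phi:\mathbb R\to\mathbb R$ monotone, $\phi(-\infty)=0$, $\phi(+\infty)=1$, such that $v(t)=\phi(t)-b\phi(t-c\tau)$ is $C^2$ on $\mathbb R$ and $v''(t)-cv'(t)+\phi(t)(1-\phi(t-c\tau))=0$ for all $t\in\mathbb R$. Put $$\chi_0(z)=z^2-cz+\frac1{1-be^{-zc\tau}},\qquad \chi_1(z)=z^2-cz-\frac{e^{-zc\tau}}{1-be^{-zc\tau}},$$ and let $\mathfrak D$ be the set of all $(\tau,c)$ with $\tau,c\ge 0$ such that $\chi_0$ has a positive real zero and $\chi_1$ has a negative real zero. **Theorem.** The equation has a monotone travelling front of speed $c$ if and only if $(\tau,c)\in\mathfrak D$. Moreover, the profile can be obtained by monotone iteration, in the following sense. For bounded $w$ let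 $(Bw)(t)=\sum_{j\ge0}b^jw(t-jc\tau)$, $(Lw)(t)=(Bw)(t-c\tau)$, $F(w)=Bw\,\bigl(1-(1-b)Lw\bigr)$ and $\mathcal Dw=w''-cw'-Lw$. Let $C_b$ be the space of bounded continuous functions on $\mathbb R$, and $C_b^2$ the space of $C^2$ functions bounded together with their first two derivatives. A \emph{super-solution} is a continuous positive nondecreasing $w_+$ with $w_+(-\infty)=0$, $w_+(+\infty)=1$ which, for some $t_1$, is $C^2$ off $t_1$ with $w_+,w_+',w_+''$ bounded there, satisfies $w_+''-cw_+'+F(w_+)\le0$ off $t_1$, and $w_+'(t_1-)\ge w_+'(t_1+)$. A \emph{sub-solution} is a continuous non-negative non-constant $w_-$ with $w_-(-\infty)=0$ which, for some $t_2$, is $C^2$ off $t_2$ with $w_-,w_-',w_-''$ bounded there, satisfies $w_-''-cw_-'+F(w_-)\ge0$ off $t_2$, and $w_-'(t_2-)\le w_-'(t_2+)$. If $(\tau,c)\in\mathfrak D$, then: 1. $\mathcal D:C_b^2\to C_b$ has the inverse $(\mathcal If)(t)=\int_{\mathbb R}N(t-s)f(s)\,ds$ with some continuous integrable kernel $N\le0$.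 2. For every sub-solution $w_-$ and super-solution $w_+$ with $w_-\le w_+$, the iterates $w_0=w_+$, $w_{n+1}=-\mathcal I[F(w_n)+Lw_n]$ are nondecreasing functions, the sequence $(w_n)$ is decreasing in $n$, and for some monotone travelling front profile $\phi$ of speed $c$ one has, pointwise on $\mathbb R$, $w_n(t)\to(\phi(t)-b\phi(t-c\tau))/(1-b)$ and $(1-b)(Bw_n)(t)\to\phi(t)$. 3. Such pairs $w_-\le w_+$ exist, even with $w_1\ne w_0=w_+$, so that the iteration is not stationary. 4. For every monotone travelling front profile $\phi$ of speed $c$ there are a sub-solution $w_-$ and a super-solution $w_+$, $w_-\le w_+$, whose iterates $w_n$ have all the properties in 2 with this $\phi$. -/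

import Mathlib

open Filter Topology

namespace NeutralKPP

noncomputable section

/-- The neutral difference `v(t) = φ(t) - b φ(t - cτ)` of a profile `φ`. -/
def neutralDiff (b τ c : ℝ) (φ : ℝ → ℝ) (t : ℝ) : ℝ := φ t - b * φ (t - c * τ)

/-- `u(t,x)` satisfies, at every `(t,x)`, the neutral KPP-Fisher equation
`∂_t (u - b u(t-τ,x)) = ∂_xx (u - b u(t-τ,x)) + u (1 - u(t-τ,x))`. -/
def SolvesNeutralKPP (b τ : ℝ) (u : ℝ → ℝ → ℝ) : Prop :=
  ∀ t x, deriv (fun t' => u t' x - b * u (t' - τ) x) t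
    = deriv (deriv (fun x' => u t x' - b * u (t - τ) x')) x + u t x * (1 - u (t - τ) x)

/-- `u(t,x) = φ(x + ct)` is a monotone travelling front of the neutral KPP-Fisher equation:
`φ` is monotone from `0` at `-∞` to `1` at `+∞`, the difference `v(t) = φ(t) - b φ(t - cτ)` is
`C²` on `ℝ`, and `v'' - c v' + φ(t)(1 - φ(t - cτ)) = 0`. -/
structure IsMonotoneFront (b τ c : ℝ) (φ : ℝ → ℝ) : Prop where
  mono : Monotone φ
  bot : Tendsto φ atBot (𝓝 0)
  top : Tendsto φ atTop (𝓝 1)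
  smooth : ContDiff ℝ 2 (neutralDiff b τ c φ)
  eq : ∀ t, deriv (deriv (neutralDiff b τ c φ)) t - c * deriv (neutralDiff b τ c φ) t
    + φ t * (1 - φ (t - c * τ)) = 0

/-- The profile equation is exactly the equation for `u(t,x) = φ(x + ct)`. -/
theorem profile_eq_iff_solves (b τ c : ℝ) (φ : ℝ → ℝ)
    (h : ContDiff ℝ 2 (neutralDiff b τ c φ)) :
    (∀ t, deriv (deriv (neutralDiff b τ c φ)) t - c * deriv (neutralDiff b τ c φ) t
      + φ t * (1 - φ (t - c * τ)) = 0) ↔ SolvesNeutralKPP b τ (fun t x => φ (x + c * t)) := by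
  have hd : Differentiable ℝ (neutralDiff b τ c φ) := h.differentiable (by norm_num)
  have e1 : ∀ t x, deriv (fun t' => φ (x + c * t') - b * φ (x + c * (t' - τ))) t
      = c * deriv (neutralDiff b τ c φ) (x + c * t) := by
    intro t x
    have hf : (fun t' => φ (x + c * t') - b * φ (x + c * (t' - τ)))
        = fun t' => neutralDiff b τ c φ (x + c * t') := by
      funext t'
      simp only [neutralDiff]
      ring_nf
    have hl : HasDerivAt (fun t' : ℝ => x + c * t') c t := by
      simpa using ((hasDerivAt_id t).const_mul c).const_add x
    rw [hf, mul_comm]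
    exact ((hd (x + c * t)).hasDerivAt.comp t hl).deriv
  have e2 : ∀ t x, deriv (deriv (fun x' => φ (x' + c * t) - b * φ (x' + c * (t - τ)))) x
      = deriv (deriv (neutralDiff b τ c φ)) (x + c * t) := by
    intro t x
    have hf : (fun x' => φ (x' + c * t) - b * φ (x' + c * (t - τ)))
        = fun x' => neutralDiff b τ c φ (x' + c * t) := by
      funext x'
      simp only [neutralDiff]
      ring_nf
    have hg : deriv (fun x' => neutralDiff b τ c φ (x' + c * t))
        = fun x' => deriv (neutralDiff b τ c φ) (x' + c * t) := by
      funext x'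
      exact deriv_comp_add_const _ _ _
    rw [hf, hg]
    exact deriv_comp_add_const _ _ _
  have e3 : ∀ t x, x + c * (t - τ) = x + c * t - c * τ := by intro t x; ring
  constructor
  · intro H t x
    have := H (x + c * t)
    simp only [e1, e2]
    rw [e3]
    linarith
  · intro H s
    have := H 0 s
    simp only [e1, e2] at this
    rw [e3] at this
    simp only [mul_zero, add_zero] at this
    linarith

/-- `χ₀(z) = z² - cz + 1 / (1 - b e^{-zcτ})`, for real `z`. -/
def chi0 (b τ c z : ℝ) : ℝ := z ^ 2 - c * z + 1 / (1 - b * Real.exp (-(z * c * τ)))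

/-- `χ₁(z) = z² - cz - e^{-zcτ} / (1 - b e^{-zcτ})`, for real `z`. -/
def chi1 (b τ c z : ℝ) : ℝ :=
  z ^ 2 - c * z - Real.exp (-(z * c * τ)) / (1 - b * Real.exp (-(z * c * τ)))

/-- The set of `(τ, c)` in the closed quadrant `ℝ₊²` for which `χ₀` has a positive zero and `χ₁`
has a negative zero; a zero is a point where the denominator does not vanish. -/
def frakD (b : ℝ) : Set (ℝ × ℝ) :=
  {p | 0 ≤ p.1 ∧ 0 ≤ p.2 ∧
    (∃ z, 0 < z ∧ 1 - b * Real.exp (-(z * p.2 * p.1)) ≠ 0 ∧ chi0 b p.1 p.2 z = 0) ∧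
    (∃ z, z < 0 ∧ 1 - b * Real.exp (-(z * p.2 * p.1)) ≠ 0 ∧ chi1 b p.1 p.2 z = 0)}

/-- `(B w)(t) = ∑_{j ≥ 0} b^j w(t - j cτ)`, the inverse of `I - bS`, where `S` is the shift
`(S w)(t) = w(t - cτ)`. -/
def opB (b τ c : ℝ) (w : ℝ → ℝ) (t : ℝ) : ℝ := ∑' j : ℕ, b ^ j * w (t - j * (c * τ))

/-- `L = SB`, that is `(L w)(t) = (B w)(t - cτ)`. -/
def opL (b τ c : ℝ) (w : ℝ → ℝ) (t : ℝ) : ℝ := opB b τ c w (t - c * τ)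

/-- `F(w) = Bw · (1 - (1 - b) SBw)`. With `(1 - b) w(t) = φ(t) - b φ(t - cτ)` the profile equation
becomes `w'' - c w' + F(w) = 0`. -/
def opF (b τ c : ℝ) (w : ℝ → ℝ) (t : ℝ) : ℝ :=
  opB b τ c w t * (1 - (1 - b) * opL b τ c w t)

/-- Bounded continuous functions on `ℝ`. -/
def IsCb (f : ℝ → ℝ) : Prop := Continuous f ∧ ∃ C, ∀ t, |f t| ≤ C

/-- Twice continuously differentiable functions, bounded with their derivatives up to order 2. -/
def IsCb2 (f : ℝ → ℝ) : Prop :=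
  ContDiff ℝ 2 f ∧ ∃ C, ∀ t, |f t| ≤ C ∧ |deriv f t| ≤ C ∧ |deriv (deriv f) t| ≤ C

/-- The same on `ℝ ∖ {t₁}`. -/
def IsCb2Off (t₁ : ℝ) (f : ℝ → ℝ) : Prop :=
  ContDiffOn ℝ 2 f {t₁}ᶜ ∧
    ∃ C, ∀ t, t ≠ t₁ → |f t| ≤ C ∧ |deriv f t| ≤ C ∧ |deriv (deriv f) t| ≤ C

/-- `(𝒟 w)(t) = w''(t) - c w'(t) - (L w)(t)`. -/
def opD (b τ c : ℝ) (w : ℝ → ℝ) (t : ℝ) : ℝ :=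
  deriv (deriv w) t - c * deriv w t - opL b τ c w t

/-- `(ℐ f)(t) = ∫ N(t - s) f(s) ds`. -/
def opI (N f : ℝ → ℝ) (t : ℝ) : ℝ := ∫ s, N (t - s) * f s

/-- `N` is a continuous, non-positive, integrable kernel, and the integral operator `ℐ` is the
two-sided inverse of `𝒟 : C_b² → C_b`. -/
structure IsInverseKernel (b τ c : ℝ) (N : ℝ → ℝ) : Prop where
  cont : Continuous N
  nonpos : ∀ t, N t ≤ 0
  integrable : MeasureTheory.Integrable N
  left_inv : ∀ w, IsCb2 w → opI N (opD b τ c w) = w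
  right_inv : ∀ f, IsCb f → IsCb2 (opI N f) ∧ opD b τ c (opI N f) = f

/-- Super-solutions of `w'' - c w' + F(w) = 0`, `w(-∞) = 0`, `w(+∞) = 1`. -/
def IsSuperSolution (b τ c : ℝ) (w : ℝ → ℝ) : Prop :=
  Continuous w ∧ (∀ t, 0 < w t) ∧ Monotone w ∧
  Tendsto w atBot (𝓝 0) ∧ Tendsto w atTop (𝓝 1) ∧
  ∃ t₁, IsCb2Off t₁ w ∧
    (∀ t, t ≠ t₁ → deriv (deriv w) t - c * deriv w t + opF b τ c w t ≤ 0) ∧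
    ∃ l r, Tendsto (deriv w) (𝓝[<] t₁) (𝓝 l) ∧ Tendsto (deriv w) (𝓝[>] t₁) (𝓝 r) ∧ r ≤ l

/-- Sub-solutions of `w'' - c w' + F(w) = 0`, `w(-∞) = 0`, `w(+∞) = 1`. -/
def IsSubSolution (b τ c : ℝ) (w : ℝ → ℝ) : Prop :=
  Continuous w ∧ (∀ t, 0 ≤ w t) ∧ (∃ s t, w s ≠ w t) ∧
  Tendsto w atBot (𝓝 0) ∧
  ∃ t₂, IsCb2Off t₂ w ∧
    (∀ t, t ≠ t₂ → 0 ≤ deriv (deriv w) t - c * deriv w t + opF b τ c w t) ∧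
    ∃ l r, Tendsto (deriv w) (𝓝[<] t₂) (𝓝 l) ∧ Tendsto (deriv w) (𝓝[>] t₂) (𝓝 r) ∧ l ≤ r

/-- The iteration `w₀ = w₊`, `w_{n+1} = -ℐ[F(w_n) + L w_n]`. -/
def iter (b τ c : ℝ) (N wp : ℝ → ℝ) : ℕ → ℝ → ℝ
  | 0 => wp
  | n + 1 => fun t =>
      -opI N (fun s => opF b τ c (iter b τ c N wp n) s + opL b τ c (iter b τ c N wp n) s) t

/-- The iterates started at `w₊` are non-decreasing functions, form a decreasing sequence, and
converge pointwise to `w(t) = (φ(t) - b φ(t - cτ)) / (1 - b)`, so that `(1 - b) B w_n` converges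
pointwise to the profile `φ`. -/
structure IterationYields (b τ c : ℝ) (N wp φ : ℝ → ℝ) : Prop where
  mono : ∀ n, Monotone (iter b τ c N wp n)
  decreasing : ∀ t, Antitone (fun n => iter b τ c N wp n t)
  tendsto : ∀ t, Tendsto (fun n => iter b τ c N wp n t) atTop
    (𝓝 (neutralDiff b τ c φ t / (1 - b)))
  tendsto_profile : ∀ t, Tendsto (fun n => (1 - b) * opB b τ c (iter b τ c N wp n) t) atTop
    (𝓝 (φ t))

end

end NeutralKPP

/-! ### The operator B: bounds, monotonicity, inversion of I - bS, action on exponentials -/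

namespace NeutralKPP

variable {b τ c : ℝ}

/-! Write h = cτ and v(t) = φ(t) - bφ(t - h). Since B inverts I - bS on bounded functions, φ = Bv,
and w = v/(1 - b) turns the profile equation into w'' - cw' + F(w) = 0, or 𝒟w = -(F(w) + Lw). With P
= (1 - b)Bw(t) and Q = (1 - b)Bw(t - h), the right-hand nonlinearity is (1 - (1 - P)(1 - Q))/(1 -
b), which is increasing in w on [0,1]. So everything rests on -𝒟 being inverse positive.

Inverse positivity. Let m < 0 be the given zero of χ₁ and l > 0 a second zero, supplied by the
intermediate value theorem. With G₀ the Green kernel of (d/dt - l)(d/dt - m), one finds 𝒟G₀ = δ - g,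
that is, 𝒟 = (d/dt - l)(d/dt - m)(1 - g *). Because l and m are zeros of χ₁, g is non-negative
(`CharRoots.gKernel_nonneg`), and evaluating on constants gives ∫g = 1 + 1/((1 - b)lm) < 1. The
Neumann series N = ∑ gⁿ * G₀ therefore converges to a negative integrable kernel
(`exists_resolvent_kernel`). The same factorization yields a comparison principle that tolerates
corners (`CharRoots.nonneg_of_opD_nonpos`), so the iterates decrease from w₊ and stay above w₋.
Their limit is a fixed point; its value k at +∞ satisfies k = 1 - (1 - k)², and w₋ excludes k = 0.

Sufficiency. Near -∞ the super-solution is an exponential solution of the linearization at 0, with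
exponent a zero k of χ₀; to the right of 0 it is 1 - const·e^{mt}, and the two pieces are glued with
equal slopes. The sub-solution adds a term n e^{νt} with k < ν < 2k, which dominates the quadratic
error of size e^{2kt}. A double zero of χ₀ requires a factor linear in t. The super-solution is not
C², whereas the first iterate is, so the iteration moves.

Necessity. For a front, first c > 0, 0 ≤ v' ≤ cv and v < 1 - b. For χ₀, let k be the least constant
with v' ≤ kv near -∞: feeding this bound into the equation produces another admissible constant, and
minimality of k makes a slightly lowered χ₀ non-positive at k (`IsMonotoneFront.exists_exponent`).
For χ₁, let M be the supremum of the rates k with v' ≥ k(1 - b - v) near +∞. It is finite, and the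
analogous improvement step (`IsMonotoneFront.exists_rate_step`) bounds the partial sums of ∑
bʲe^{M(j+1)h} by M² + cM. Hence the series converges, χ₁(-M) ≥ 0 > χ₁(0), and a zero lies between.

Finally, the rescaled neutral difference of any front is both a sub- and a super-solution and is
fixed by the iteration; this gives item 4. -/

theorem summable_opB (hb0 : 0 ≤ b) (hb1 : b < 1) {w : ℝ → ℝ} {C : ℝ} (hw : ∀ t, |w t| ≤ C) (t : ℝ) :
    Summable (fun j : ℕ => b ^ j * w (t - j * (c * τ))) := by
  refine Summable.of_norm_bounded (g := fun j => b ^ j * C)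
    ((summable_geometric_of_lt_one hb0 hb1).mul_right C) fun j => ?_
  rw [Real.norm_eq_abs, abs_mul, abs_of_nonneg (pow_nonneg hb0 j)]
  exact mul_le_mul_of_nonneg_left (hw _) (pow_nonneg hb0 j)

theorem opB_const (hb0 : 0 ≤ b) (hb1 : b < 1) (k t : ℝ) :
    opB b τ c (fun _ => k) t = k / (1 - b) := by
  rw [opB, tsum_mul_right, tsum_geometric_of_lt_one hb0 hb1]
  field_simp

theorem opB_le_of_le_Iic (hb0 : 0 ≤ b) (hh : 0 ≤ c * τ) {w w' : ℝ → ℝ} {t : ℝ}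
    (hs : Summable (fun j : ℕ => b ^ j * w (t - j * (c * τ))))
    (hs' : Summable (fun j : ℕ => b ^ j * w' (t - j * (c * τ))))
    (hle : ∀ s ≤ t, w s ≤ w' s) : opB b τ c w t ≤ opB b τ c w' t := by
  refine hs.tsum_le_tsum (fun j => ?_) hs'
  refine mul_le_mul_of_nonneg_left (hle _ ?_) (pow_nonneg hb0 j)
  have : 0 ≤ (j : ℝ) * (c * τ) := by positivity
  linarith

theorem opB_mono (hb0 : 0 ≤ b) (hb1 : b < 1) {w w' : ℝ → ℝ} {C C' : ℝ} (hw : ∀ t, |w t| ≤ C)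
    (hw' : ∀ t, |w' t| ≤ C') (hle : ∀ t, w t ≤ w' t) (t : ℝ) :
    opB b τ c w t ≤ opB b τ c w' t :=
  (summable_opB hb0 hb1 hw t).tsum_le_tsum
    (fun j => mul_le_mul_of_nonneg_left (hle _) (pow_nonneg hb0 j)) (summable_opB hb0 hb1 hw' t)

theorem opB_nonneg (hb0 : 0 ≤ b) {w : ℝ → ℝ} (hw : ∀ t, 0 ≤ w t) (t : ℝ) : 0 ≤ opB b τ c w t :=
  tsum_nonneg fun j => mul_nonneg (pow_nonneg hb0 j) (hw _)

theorem abs_opB_le (hb0 : 0 ≤ b) (hb1 : b < 1) {w : ℝ → ℝ} {C : ℝ} (hw : ∀ t, |w t| ≤ C) (t : ℝ) :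
    |opB b τ c w t| ≤ C / (1 - b) := by
  have hC : 0 ≤ C := (abs_nonneg _).trans (hw 0)
  rw [abs_le]
  constructor
  · rw [← neg_div, ← opB_const (τ := τ) (c := c) hb0 hb1 (-C) t]
    exact opB_mono hb0 hb1 (C := C) (by simp [abs_of_nonneg hC]) hw (fun s => (abs_le.1 (hw s)).1) t
  · rw [← opB_const (τ := τ) (c := c) hb0 hb1 C t]
    exact opB_mono hb0 hb1 (C' := C) hw (by simp [abs_of_nonneg hC]) (fun s => (abs_le.1 (hw s)).2) t

theorem self_le_opB (hb0 : 0 ≤ b) (hb1 : b < 1) {w : ℝ → ℝ} {C : ℝ} (hC : ∀ t, |w t| ≤ C)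
    (hw : ∀ t, 0 ≤ w t) (t : ℝ) : w t ≤ opB b τ c w t := by
  have := (summable_opB (τ := τ) (c := c) hb0 hb1 hC t).le_tsum 0
    fun _ _ => mul_nonneg (pow_nonneg hb0 _) (hw _)
  simpa [opB] using this

theorem monotone_opB (hb0 : 0 ≤ b) (hb1 : b < 1) {w : ℝ → ℝ} {C : ℝ} (hw : ∀ t, |w t| ≤ C)
    (hm : Monotone w) : Monotone (opB b τ c w) := fun s t hst =>
  (summable_opB hb0 hb1 hw s).tsum_le_tsum
    (fun j => mul_le_mul_of_nonneg_left (hm (by linarith)) (pow_nonneg hb0 j))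
    (summable_opB hb0 hb1 hw t)

theorem opB_add (hb0 : 0 ≤ b) (hb1 : b < 1) {w w' : ℝ → ℝ} {C C' : ℝ} (hw : ∀ t, |w t| ≤ C)
    (hw' : ∀ t, |w' t| ≤ C') (t : ℝ) :
    opB b τ c (fun s => w s + w' s) t = opB b τ c w t + opB b τ c w' t := by
  simp only [opB, mul_add]
  exact (summable_opB hb0 hb1 hw t).tsum_add (summable_opB hb0 hb1 hw' t)

theorem opB_sub (hb0 : 0 ≤ b) (hb1 : b < 1) {w w' : ℝ → ℝ} {C C' : ℝ} (hw : ∀ t, |w t| ≤ C)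
    (hw' : ∀ t, |w' t| ≤ C') (t : ℝ) :
    opB b τ c (fun s => w s - w' s) t = opB b τ c w t - opB b τ c w' t := by
  simp only [opB, mul_sub]
  exact (summable_opB hb0 hb1 hw t).tsum_sub (summable_opB hb0 hb1 hw' t)

theorem opB_const_mul (k : ℝ) (w : ℝ → ℝ) (t : ℝ) :
    opB b τ c (fun s => k * w s) t = k * opB b τ c w t := by
  simp only [opB, mul_left_comm _ k, tsum_mul_left]

theorem continuous_opB (hb0 : 0 ≤ b) (hb1 : b < 1) {w : ℝ → ℝ} {C : ℝ} (hw : ∀ t, |w t| ≤ C)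
    (hc : Continuous w) : Continuous (opB b τ c w) := by
  refine continuous_tsum (u := fun j => b ^ j * C) (fun j => by fun_prop)
    ((summable_geometric_of_lt_one hb0 hb1).mul_right C) fun j t => ?_
  rw [Real.norm_eq_abs, abs_mul, abs_of_nonneg (pow_nonneg hb0 j)]
  exact mul_le_mul_of_nonneg_left (hw _) (pow_nonneg hb0 j)

theorem measurable_opB {w : ℝ → ℝ} (hw : Measurable w) : Measurable (opB b τ c w) :=
  Measurable.tsum fun _ => (hw.comp (measurable_id.sub_const _)).const_mul _

theorem hasDerivAt_opB (hb0 : 0 ≤ b) (hb1 : b < 1) {w w' : ℝ → ℝ} {C C' : ℝ} (hw : ∀ t, |w t| ≤ C)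
    (hw' : ∀ t, |w' t| ≤ C') (hd : ∀ t, HasDerivAt w (w' t) t) (t : ℝ) :
    HasDerivAt (opB b τ c w) (opB b τ c w' t) t := by
  refine hasDerivAt_tsum (u := fun j => b ^ j * C')
    ((summable_geometric_of_lt_one hb0 hb1).mul_right C')
    (g := fun (j : ℕ) t => b ^ j * w (t - j * (c * τ)))
    (g' := fun (j : ℕ) t => b ^ j * w' (t - j * (c * τ))) (fun j s => ?_) (fun j s => ?_)
    (summable_opB hb0 hb1 hw t) t
  · have := ((hd (s - j * (c * τ))).comp s ((hasDerivAt_id s).sub_const _)).const_mul (b ^ j)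
    simpa using this
  · rw [Real.norm_eq_abs, abs_mul, abs_of_nonneg (pow_nonneg hb0 j)]
    exact mul_le_mul_of_nonneg_left (hw' _) (pow_nonneg hb0 j)

theorem opB_eq_self_add (hb0 : 0 ≤ b) (hb1 : b < 1) {w : ℝ → ℝ} {C : ℝ} (hw : ∀ t, |w t| ≤ C)
    (t : ℝ) : opB b τ c w t = w t + b * opB b τ c w (t - c * τ) := by
  rw [opB, (summable_opB hb0 hb1 hw t).tsum_eq_zero_add, opB, ← tsum_mul_left]
  congr 1
  · simp
  · refine tsum_congr fun j => ?_
    rw [pow_succ', mul_assoc]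
    congr 3
    push_cast
    ring

/-- The series telescopes, so a bounded profile is recovered from its neutral difference. Estimates
on v thereby become estimates on φ. -/
theorem opB_neutralDiff (hb0 : 0 ≤ b) (hb1 : b < 1) {φ : ℝ → ℝ} {C : ℝ} (hφ : ∀ t, |φ t| ≤ C)
    (t : ℝ) : opB b τ c (neutralDiff b τ c φ) t = φ t := by
  have h1 : opB b τ c (neutralDiff b τ c φ) t
      = opB b τ c φ t - opB b τ c (fun s => b * φ (s - c * τ)) t :=
    opB_sub hb0 hb1 hφ (C' := b * C) (fun s => by
      rw [abs_mul, abs_of_nonneg hb0]; exact mul_le_mul_of_nonneg_left (hφ _) hb0) t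
  rw [h1, opB_const_mul, opB_eq_self_add hb0 hb1 hφ]
  have : opB b τ c (fun s => φ (s - c * τ)) t = opB b τ c φ (t - c * τ) :=
    tsum_congr fun j => by ring_nf
  rw [this]
  ring

theorem neutralDiff_opB (hb0 : 0 ≤ b) (hb1 : b < 1) {w : ℝ → ℝ} {C : ℝ} (hw : ∀ t, |w t| ≤ C)
    (k : ℝ) : neutralDiff b τ c (fun t => k * opB b τ c w t) = fun t => k * w t := by
  funext t
  rw [neutralDiff, opB_eq_self_add hb0 hb1 hw t]
  ring

/-- Dominated convergence for `B`, along any filter. -/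
theorem tendsto_opB {α : Type*} {l : Filter α} (hb0 : 0 ≤ b) (hb1 : b < 1) {W : α → ℝ → ℝ}
    {w : ℝ → ℝ} {C : ℝ} (hW : ∀ i t, |W i t| ≤ C) {s : α → ℝ} {t : ℝ}
    (hl : ∀ j : ℕ, Tendsto (fun i => W i (s i - j * (c * τ))) l (𝓝 (w (t - j * (c * τ))))) :
    Tendsto (fun i => opB b τ c (W i) (s i)) l (𝓝 (opB b τ c w t)) := by
  refine tendsto_tsum_of_dominated_convergence (bound := fun j => b ^ j * C)
    ((summable_geometric_of_lt_one hb0 hb1).mul_right C) (fun j => (hl j).const_mul _)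
    (Eventually.of_forall fun i j => ?_)
  rw [Real.norm_eq_abs, abs_mul, abs_of_nonneg (pow_nonneg hb0 j)]
  exact mul_le_mul_of_nonneg_left (hW _ _) (pow_nonneg hb0 j)

theorem tendsto_opB_atTop (hb0 : 0 ≤ b) (hb1 : b < 1) {w : ℝ → ℝ} {C ℓ : ℝ} (hw : ∀ t, |w t| ≤ C)
    (hl : Tendsto w atTop (𝓝 ℓ)) : Tendsto (opB b τ c w) atTop (𝓝 (ℓ / (1 - b))) := by
  have := tendsto_opB (c := c) (τ := τ) hb0 hb1 (W := fun _ => w) (w := fun _ => ℓ) (l := atTop)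
    (s := id) (t := 0) (fun _ => hw)
    (fun j => hl.comp (tendsto_atTop_add_const_right atTop (-(j * (c * τ))) tendsto_id))
  rwa [opB_const hb0 hb1] at this

theorem tendsto_opB_atBot (hb0 : 0 ≤ b) (hb1 : b < 1) {w : ℝ → ℝ} {C ℓ : ℝ} (hw : ∀ t, |w t| ≤ C)
    (hl : Tendsto w atBot (𝓝 ℓ)) : Tendsto (opB b τ c w) atBot (𝓝 (ℓ / (1 - b))) := by
  have := tendsto_opB (c := c) (τ := τ) hb0 hb1 (W := fun _ => w) (w := fun _ => ℓ) (l := atBot)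
    (s := id) (t := 0) (fun _ => hw)
    (fun j => hl.comp (tendsto_atBot_add_const_right atBot (-(j * (c * τ))) tendsto_id))
  rwa [opB_const hb0 hb1] at this

theorem exp_mul_sub_nat_mul (z t h : ℝ) (j : ℕ) :
    Real.exp (z * (t - j * h)) = Real.exp (z * t) * Real.exp (-(z * h)) ^ j := by
  rw [← Real.exp_nat_mul, ← Real.exp_add]
  ring_nf

theorem hasSum_opB_exp (hb0 : 0 ≤ b) {z : ℝ} (hz : b * Real.exp (-(z * c * τ)) < 1) (t : ℝ) :
    HasSum (fun j : ℕ => b ^ j * Real.exp (z * (t - j * (c * τ))))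
      (Real.exp (z * t) / (1 - b * Real.exp (-(z * c * τ)))) := by
  have h := (hasSum_geometric_of_lt_one (by positivity) hz).mul_left (Real.exp (z * t))
  rw [← div_eq_mul_inv] at h
  refine h.congr_fun fun j => ?_
  rw [exp_mul_sub_nat_mul, ← mul_assoc z, mul_pow]
  ring

/-- The formal z-derivative of the geometric sum above, obtained from ∑ j rʲ. It is needed for
te^{zt} at a double zero of χ₀. -/
theorem hasSum_opB_mul_exp (hb0 : 0 ≤ b) {z : ℝ} (hz : b * Real.exp (-(z * c * τ)) < 1) (t : ℝ) :
    HasSum (fun j : ℕ => b ^ j * ((t - j * (c * τ)) * Real.exp (z * (t - j * (c * τ)))))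
      (Real.exp (z * t) * (t / (1 - b * Real.exp (-(z * c * τ)))
        - c * τ * (b * Real.exp (-(z * c * τ))) / (1 - b * Real.exp (-(z * c * τ))) ^ 2)) := by
  set r := b * Real.exp (-(z * c * τ)) with hr
  have hr0 : 0 ≤ r := by positivity
  have h1 := (hasSum_geometric_of_lt_one hr0 hz).mul_left t
  have h2 := (hasSum_coe_mul_geometric_of_norm_lt_one (r := r)
    (by rwa [Real.norm_eq_abs, abs_of_nonneg hr0])).mul_left (c * τ)
  have h := (h1.sub h2).mul_left (Real.exp (z * t))
  rw [← div_eq_mul_inv, ← mul_div_assoc] at h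
  refine h.congr_fun fun j => ?_
  rw [exp_mul_sub_nat_mul, ← mul_assoc z, hr, mul_pow]
  ring

end NeutralKPP

/-! ### Convolution with integrable kernels, resolvents and contraction arguments -/

namespace NeutralKPP

open MeasureTheory

variable {b τ c : ℝ}

theorem opI_eq_convolution (N f : ℝ → ℝ) :
    opI N f = convolution N f (ContinuousLinearMap.mul ℝ ℝ) volume := by
  funext t
  exact (convolution_mul_swap (μ := volume) (f := N) (g := f) (x := t)).symm

theorem opI_eq_integral (N f : ℝ → ℝ) (t : ℝ) : opI N f t = ∫ s, N s * f (t - s) := by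
  rw [opI_eq_convolution]
  exact convolution_mul

theorem integrable_mul_comp_sub {N f : ℝ → ℝ} {C : ℝ} (hN : Integrable N) (hf : Measurable f)
    (hC : ∀ t, |f t| ≤ C) (t : ℝ) : Integrable (fun s => N s * f (t - s)) :=
  hN.mul_bdd (c := C) (hf.comp (measurable_const.sub measurable_id)).aestronglyMeasurable
    (Eventually.of_forall fun s => hC (t - s))

theorem abs_opI_le {N f : ℝ → ℝ} {C : ℝ} (hN : Integrable N) (hC : ∀ t, |f t| ≤ C) (t : ℝ) :
    |opI N f t| ≤ (∫ s, |N s|) * C := by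
  rw [opI_eq_integral, ← integral_mul_const]
  refine norm_integral_le_of_norm_le (f := fun s => N s * f (t - s)) (hN.abs.mul_const C)
    (Eventually.of_forall fun s => ?_)
  rw [Real.norm_eq_abs, abs_mul]
  exact mul_le_mul_of_nonneg_left (hC _) (abs_nonneg _)

theorem opI_const (N : ℝ → ℝ) (k t : ℝ) : opI N (fun _ => k) t = (∫ s, N s) * k := by
  rw [opI_eq_integral, integral_mul_const]

theorem opI_mono {N f f' : ℝ → ℝ} {C C' : ℝ} (hN : Integrable N) (h0 : ∀ t, 0 ≤ N t)
    (hf : Measurable f) (hC : ∀ t, |f t| ≤ C) (hf' : Measurable f') (hC' : ∀ t, |f' t| ≤ C')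
    {t : ℝ} (hle : ∀ s, f s ≤ f' s) : opI N f t ≤ opI N f' t := by
  rw [opI_eq_integral, opI_eq_integral]
  exact integral_mono (integrable_mul_comp_sub hN hf hC t) (integrable_mul_comp_sub hN hf' hC' t)
    fun s => mul_le_mul_of_nonneg_left (hle _) (h0 s)

theorem opI_add_kernel {N N' f : ℝ → ℝ} {C : ℝ} (hN : Integrable N) (hN' : Integrable N')
    (hf : Measurable f) (hC : ∀ t, |f t| ≤ C) (t : ℝ) :
    opI (fun s => N s + N' s) f t = opI N f t + opI N' f t := by
  simp only [opI_eq_integral, add_mul]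
  exact integral_add (integrable_mul_comp_sub hN hf hC t) (integrable_mul_comp_sub hN' hf hC t)

theorem continuous_opI {N f : ℝ → ℝ} {C : ℝ} (hN : Integrable N) (hf : Continuous f)
    (hC : ∀ t, |f t| ≤ C) : Continuous (opI N f) := by
  rw [opI_eq_convolution]
  exact BddAbove.continuous_convolution_right_of_integrable _
    ⟨C, by rintro _ ⟨t, rfl⟩; exact hC t⟩ hN hf

theorem integrable_opI {N f : ℝ → ℝ} (hN : Integrable N) (hf : Integrable f) :
    Integrable (opI N f) := by
  rw [opI_eq_convolution]
  exact hN.integrable_convolution _ hf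

theorem integral_opI {N f : ℝ → ℝ} (hN : Integrable N) (hf : Integrable f) :
    ∫ t, opI N f t = (∫ t, N t) * ∫ t, f t := by
  rw [opI_eq_convolution]
  exact integral_convolution _ hN hf

/-- Fubini. Boundedness of `N` and `f` ensures the absolute convergence needed pointwise, although
`f` need not be integrable. -/
theorem opI_assoc {g N f : ℝ → ℝ} {K C : ℝ} (hg : Integrable g) (hN : Integrable N)
    (hNm : Measurable N) (hK : ∀ t, |N t| ≤ K) (hf : Measurable f) (hC : ∀ t, |f t| ≤ C) (t : ℝ) :
    opI (opI g N) f t = opI g (opI N f) t := by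
  simp only [opI_eq_convolution]
  have hC' : ∀ t, |(|f t|)| ≤ C := by simpa using hC
  refine convolution_assoc _ _ _ _ (fun x y z => mul_assoc x y z) hg.aestronglyMeasurable
    hN.aestronglyMeasurable hf.aestronglyMeasurable
    (Eventually.of_forall fun y => integrable_mul_comp_sub hg hNm hK y)
    (Eventually.of_forall fun y => integrable_mul_comp_sub hN.norm hf.norm hC' y) ?_
  have e : (convolution (fun x => ‖N x‖) (fun x => ‖f x‖) (ContinuousLinearMap.mul ℝ ℝ) volume)
      = opI (fun x => ‖N x‖) (fun x => ‖f x‖) := (opI_eq_convolution _ _).symm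
  rw [e]
  refine hg.norm.mul_bdd (c := (∫ s, |‖N s‖|) * C) ?_
    (Eventually.of_forall fun s => abs_opI_le hN.norm hC' (t - s))
  have hm : StronglyMeasurable (fun p : ℝ × ℝ => ‖N (p.1 - p.2)‖ * ‖f p.2‖) :=
    (((hNm.comp (measurable_fst.sub measurable_snd)).norm).mul
      ((hf.comp measurable_snd).norm)).stronglyMeasurable
  have := (hm.integral_prod_right' (ν := volume)).measurable
  exact (this.comp (measurable_const.sub measurable_id)).aestronglyMeasurable

theorem integrable_tsum {F : ℕ → ℝ → ℝ} (hF : ∀ n, Integrable (F n))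
    (hsum : Summable fun n => ∫ t, ‖F n t‖) (hm : Measurable fun t => ∑' n, F n t) :
    Integrable fun t => ∑' n, F n t := by
  refine ⟨hm.aestronglyMeasurable, ?_⟩
  calc ∫⁻ t, ‖∑' n, F n t‖ₑ ≤ ∫⁻ t, ∑' n, ‖F n t‖ₑ := lintegral_mono fun t => enorm_tsum_le_tsum_enorm
    _ = ∑' n, ∫⁻ t, ‖F n t‖ₑ := lintegral_tsum fun n => (hF n).1.enorm
    _ = ∑' n, ENNReal.ofReal (∫ t, ‖F n t‖) := by
      congr 1
      funext n
      exact (ofReal_integral_norm_eq_lintegral_enorm (hF n)).symm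
    _ < ⊤ := by
      rw [← ENNReal.ofReal_tsum_of_nonneg (fun n => integral_nonneg fun t => norm_nonneg _) hsum]
      exact ENNReal.ofReal_lt_top

/-- The resolvent kernel `∑ gⁿ * N₀` of a sub-probability density `g`, applied to `N₀`. -/
theorem exists_resolvent_kernel {g N₀ : ℝ → ℝ} (hg : Integrable g) (hg0 : ∀ t, 0 ≤ g t)
    (hq : ∫ t, g t < 1) (hN0 : Integrable N₀) (hNc : Continuous N₀) {K : ℝ} (hK : ∀ t, |N₀ t| ≤ K)
    (hneg : ∀ t, N₀ t ≤ 0) :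
    ∃ N : ℝ → ℝ, Continuous N ∧ Integrable N ∧ (∃ K', ∀ t, |N t| ≤ K') ∧ (∀ t, N t ≤ N₀ t) ∧
      ∀ t, N t = N₀ t + opI g N t := by
  set q := ∫ t, g t with hqd
  have hq0 : 0 ≤ q := integral_nonneg hg0
  have hgabs : ∫ t, |g t| = q := by simp only [abs_of_nonneg (hg0 _), hqd]
  -- Terms of the Neumann series. Sup norms and integrals both scale by q = ∫g < 1 at each step, and
  -- the sign is preserved because g ≥ 0.
  let P : ℕ → ℝ → ℝ := fun n => (opI g)^[n] N₀
  have Psucc : ∀ n, P (n + 1) = opI g (P n) := fun n => Function.iterate_succ_apply' _ _ _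
  have hP : ∀ n, Continuous (P n) ∧ Integrable (P n) ∧ (∀ t, |P n t| ≤ q ^ n * K) ∧
      (∀ t, P n t ≤ 0) ∧ ∫ t, P n t = q ^ n * ∫ t, N₀ t := by
    intro n
    induction n with
    | zero => simpa [P] using ⟨hNc, hN0, hK, hneg⟩
    | succ n ih =>
      obtain ⟨h1, h2, h3, h4, h5⟩ := ih
      rw [Psucc]
      refine ⟨continuous_opI hg h1 h3, integrable_opI hg h2, fun t => ?_, fun t => ?_, ?_⟩
      · have := abs_opI_le hg h3 t
        rw [hgabs] at this
        rw [pow_succ']; linarith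
      · rw [opI_eq_integral]
        exact integral_nonpos fun s => mul_nonpos_of_nonneg_of_nonpos (hg0 s) (h4 _)
      · rw [integral_opI hg h2, h5, pow_succ', mul_assoc]
  have hgeo : Summable fun n : ℕ => q ^ n := summable_geometric_of_lt_one hq0 hq
  have hsum : ∀ t, Summable fun n => P n t := fun t =>
    Summable.of_norm_bounded (hgeo.mul_right K) fun n => (hP n).2.2.1 t
  have hint : ∀ n, ∫ t, ‖P n t‖ = q ^ n * -∫ t, N₀ t := by
    intro n
    simp only [Real.norm_eq_abs, abs_of_nonpos ((hP n).2.2.2.1 _)]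
    rw [integral_neg, (hP n).2.2.2.2, mul_neg]
  have hbd : ∀ t, |∑' n, P n t| ≤ ∑' n : ℕ, q ^ n * K := fun t =>
    tsum_of_norm_bounded (f := fun n => P n t) (hgeo.mul_right K).hasSum fun n => (hP n).2.2.1 t
  have hle : ∀ t, ∑' n, P n t ≤ N₀ t := by
    intro t
    rw [(hsum t).tsum_eq_zero_add]
    have : ∑' n, P (n + 1) t ≤ 0 := tsum_nonpos fun n => (hP _).2.2.2.1 t
    have h0 : P 0 t = N₀ t := rfl
    linarith
  have hcont : Continuous fun t => ∑' n, P n t := continuous_tsum (fun n => (hP n).1)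
    (hgeo.mul_right K) fun n t => (hP n).2.2.1 t
  refine ⟨fun t => ∑' n, P n t, hcont, ?_, ⟨_, hbd⟩, hle, fun t => ?_⟩
  · exact integrable_tsum (fun n => (hP n).2.1) (by simp only [hint]; exact hgeo.mul_right _)
      hcont.measurable
  · change ∑' n, P n t = _
    rw [(hsum t).tsum_eq_zero_add, opI_eq_integral]
    congr 1
    have h1 : ∀ n, Integrable (fun s => g s * P n (t - s)) := fun n =>
      integrable_mul_comp_sub hg (hP n).1.measurable (hP n).2.2.1 t
    simp only [Psucc, opI_eq_integral, ← tsum_mul_left]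
    refine integral_tsum_of_summable_integral_norm h1 ?_
    refine Summable.of_nonneg_of_le (fun n => integral_nonneg fun _ => norm_nonneg _) (fun n => ?_)
      ((hgeo.mul_right K).mul_left q)
    have : ∫ s, ‖g s * P n (t - s)‖ ≤ ∫ s, g s * (q ^ n * K) := by
      refine integral_mono (h1 n).norm (hg.mul_const _) fun s => ?_
      rw [norm_mul, Real.norm_of_nonneg (hg0 s)]
      exact mul_le_mul_of_nonneg_left ((hP n).2.2.1 _) (hg0 s)
    rwa [integral_mul_const] at this

/-- A bounded `y` with `y = g * y + u`, `u ≥ 0`, is non-negative when `g` is a sub-probability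
density. -/
theorem nonneg_of_opI_le {g y : ℝ → ℝ} (hg : Integrable g) (hg0 : ∀ t, 0 ≤ g t)
    (hq : ∫ t, g t < 1) (hy : Measurable y) {C : ℝ} (hC : ∀ t, |y t| ≤ C)
    (hle : ∀ t, opI g y t ≤ y t) (t : ℝ) : 0 ≤ y t := by
  set q := ∫ t, g t with hqd
  have hq0 : 0 ≤ q := integral_nonneg hg0
  -- Convolution with `g` multiplies a constant lower bound by q, so iterating y ≥ g * y improves -C
  -- to -qⁿC.
  have key : ∀ n : ℕ, ∀ t, -(q ^ n * C) ≤ y t := by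
    intro n
    induction n with
    | zero => intro t; simpa using (abs_le.1 (hC t)).1
    | succ n ih =>
      intro t
      refine le_trans ?_ (hle t)
      have := opI_mono (N := g) (f := fun _ => -(q ^ n * C)) (C := |-(q ^ n * C)|) hg hg0
        measurable_const (fun _ => le_rfl) hy hC (t := t) ih
      rw [opI_const] at this
      rw [pow_succ']
      linarith
  have : Tendsto (fun n : ℕ => -(q ^ n * C)) atTop (𝓝 (-(0 * C))) :=
    ((tendsto_pow_atTop_nhds_zero_of_lt_one hq0 hq).mul_const C).neg
  rw [zero_mul, neg_zero] at this
  exact le_of_tendsto' this fun n => key n t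

end NeutralKPP

/-! ### One-sided exponential kernels and convolution with B and L -/

namespace NeutralKPP

open MeasureTheory

variable {b τ c : ℝ}

noncomputable section

/-- Fundamental solution of `d/dt - m` supported on `[0, ∞)`. -/
def expPos (m s : ℝ) : ℝ := if 0 ≤ s then Real.exp (m * s) else 0

/-- Fundamental solution of `d/dt - l` supported on `(-∞, 0)`. -/
def expNeg (l s : ℝ) : ℝ := if s < 0 then -Real.exp (l * s) else 0

theorem measurable_expPos (m : ℝ) : Measurable (expPos m) :=
  Measurable.ite measurableSet_Ici (by fun_prop) measurable_const

theorem measurable_expNeg (l : ℝ) : Measurable (expNeg l) :=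
  Measurable.ite measurableSet_Iio (by fun_prop) measurable_const

theorem abs_expPos_le {m : ℝ} (hm : m < 0) (s : ℝ) : |expPos m s| ≤ 1 := by
  rw [expPos]
  split_ifs with h
  · rw [Real.abs_exp, Real.exp_le_one_iff]
    exact mul_nonpos_of_nonpos_of_nonneg hm.le h
  · simp

theorem abs_expNeg_le {l : ℝ} (hl : 0 < l) (s : ℝ) : |expNeg l s| ≤ 1 := by
  rw [expNeg]
  split_ifs with h
  · rw [abs_neg, Real.abs_exp, Real.exp_le_one_iff]
    exact mul_nonpos_of_nonneg_of_nonpos hl.le h.le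
  · simp

theorem expPos_eq_indicator (m : ℝ) :
    expPos m = (Set.Ici 0).indicator (fun s => Real.exp (m * s)) := by
  funext s; simp [expPos, Set.indicator_apply]

theorem expNeg_eq_indicator (l : ℝ) :
    expNeg l = (Set.Iio 0).indicator (fun s => -Real.exp (l * s)) := by
  funext s; simp [expNeg, Set.indicator_apply]

theorem integrable_expPos {m : ℝ} (hm : m < 0) : Integrable (expPos m) := by
  rw [expPos_eq_indicator, integrable_indicator_iff measurableSet_Ici,
    integrableOn_Ici_iff_integrableOn_Ioi]
  exact integrableOn_exp_mul_Ioi hm 0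

theorem integrable_expNeg {l : ℝ} (hl : 0 < l) : Integrable (expNeg l) := by
  rw [expNeg_eq_indicator, integrable_indicator_iff measurableSet_Iio]
  exact ((integrableOn_exp_mul_Iic hl 0).mono_set Set.Iio_subset_Iic_self).neg

theorem integral_expPos {m : ℝ} (hm : m < 0) : ∫ s, expPos m s = -1 / m := by
  rw [expPos_eq_indicator, integral_indicator measurableSet_Ici, integral_Ici_eq_integral_Ioi,
    integral_exp_mul_Ioi hm]
  simp

theorem integral_expNeg {l : ℝ} (hl : 0 < l) : ∫ s, expNeg l s = -1 / l := by
  rw [expNeg_eq_indicator, integral_indicator measurableSet_Iio, integral_neg,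
    ← integral_Iic_eq_integral_Iio, integral_exp_mul_Iic hl]
  simp [neg_div]

theorem opI_expPos_eq (m : ℝ) (w : ℝ → ℝ) (t : ℝ) :
    opI (expPos m) w t = Real.exp (m * t) * ∫ s in Set.Iic t, Real.exp (-m * s) * w s := by
  rw [opI, ← integral_const_mul, ← integral_indicator measurableSet_Iic]
  congr 1
  funext s
  by_cases h : s ≤ t
  · rw [Set.indicator_of_mem (by exact h), expPos, if_pos (by linarith), ← mul_assoc, ← Real.exp_add]
    ring_nf
  · rw [Set.indicator_of_notMem (by exact h), expPos, if_neg (by linarith), zero_mul]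

theorem opI_expNeg_eq (l : ℝ) (w : ℝ → ℝ) (t : ℝ) :
    opI (expNeg l) w t = -(Real.exp (l * t) * ∫ s in Set.Ioi t, Real.exp (-l * s) * w s) := by
  rw [opI, ← integral_const_mul, ← integral_neg, ← integral_indicator measurableSet_Ioi]
  congr 1
  funext s
  by_cases h : t < s
  · rw [Set.indicator_of_mem (by exact h), expNeg, if_pos (by linarith), ← mul_assoc, ← Real.exp_add]
    ring_nf
  · rw [Set.indicator_of_notMem (by exact h), expNeg, if_neg (by linarith), zero_mul]

theorem integrableOn_Iic_exp_mul {m : ℝ} (hm : m < 0) {w : ℝ → ℝ} {C : ℝ} (hw : Measurable w)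
    (hC : ∀ t, |w t| ≤ C) (t : ℝ) :
    IntegrableOn (fun s => Real.exp (-m * s) * w s) (Set.Iic t) :=
  (integrableOn_exp_mul_Iic (by linarith : 0 < -m) t).mul_bdd (c := C) hw.aestronglyMeasurable
    (Eventually.of_forall hC)

theorem integrableOn_Ioi_exp_mul {l : ℝ} (hl : 0 < l) {w : ℝ → ℝ} {C : ℝ} (hw : Measurable w)
    (hC : ∀ t, |w t| ≤ C) (t : ℝ) :
    IntegrableOn (fun s => Real.exp (-l * s) * w s) (Set.Ioi t) :=
  (integrableOn_exp_mul_Ioi (by linarith : -l < 0) t).mul_bdd (c := C) hw.aestronglyMeasurable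
    (Eventually.of_forall hC)

theorem intervalIntegrable_exp_mul (a : ℝ) {w : ℝ → ℝ} {C : ℝ} (hw : Measurable w)
    (hC : ∀ t, |w t| ≤ C) (x y : ℝ) :
    IntervalIntegrable (fun s => Real.exp (a * s) * w s) volume x y := by
  have h : IntervalIntegrable (fun s => Real.exp (a * s)) volume x y :=
    Continuous.intervalIntegrable (by fun_prop) _ _
  exact ⟨h.1.mul_bdd (c := C) hw.aestronglyMeasurable (Eventually.of_forall hC),
    h.2.mul_bdd (c := C) hw.aestronglyMeasurable (Eventually.of_forall hC)⟩

/-- Writing the convolution with a primitive based at 0 makes continuity and the first-order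
equation immediate. -/
theorem opI_expPos_eq_primitive {m : ℝ} (hm : m < 0) {w : ℝ → ℝ} {C : ℝ} (hw : Measurable w)
    (hC : ∀ t, |w t| ≤ C) :
    opI (expPos m) w = fun t => Real.exp (m * t) * ((∫ s in Set.Iic 0, Real.exp (-m * s) * w s)
      + ∫ s in (0 : ℝ)..t, Real.exp (-m * s) * w s) := by
  funext t
  rw [opI_expPos_eq, ← intervalIntegral.integral_Iic_sub_Iic (integrableOn_Iic_exp_mul hm hw hC 0)
    (integrableOn_Iic_exp_mul hm hw hC t)]
  ring

theorem opI_expNeg_eq_primitive {l : ℝ} (hl : 0 < l) {w : ℝ → ℝ} {C : ℝ} (hw : Measurable w)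
    (hC : ∀ t, |w t| ≤ C) :
    opI (expNeg l) w = fun t => Real.exp (l * t) * (-(∫ s in Set.Ioi 0, Real.exp (-l * s) * w s)
      + ∫ s in (0 : ℝ)..t, Real.exp (-l * s) * w s) := by
  funext t
  rw [opI_expNeg_eq, ← intervalIntegral.integral_Ioi_sub_Ioi' (integrableOn_Ioi_exp_mul hl hw hC 0)
    (integrableOn_Ioi_exp_mul hl hw hC t)]
  ring

theorem continuous_opI_expPos {m : ℝ} (hm : m < 0) {w : ℝ → ℝ} {C : ℝ} (hw : Measurable w)
    (hC : ∀ t, |w t| ≤ C) : Continuous (opI (expPos m) w) := by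
  rw [opI_expPos_eq_primitive hm hw hC]
  have := intervalIntegral.continuous_primitive (intervalIntegrable_exp_mul (-m) hw hC) 0
  fun_prop

theorem continuous_opI_expNeg {l : ℝ} (hl : 0 < l) {w : ℝ → ℝ} {C : ℝ} (hw : Measurable w)
    (hC : ∀ t, |w t| ≤ C) : Continuous (opI (expNeg l) w) := by
  rw [opI_expNeg_eq_primitive hl hw hC]
  have := intervalIntegral.continuous_primitive (intervalIntegrable_exp_mul (-l) hw hC) 0
  fun_prop

theorem hasDerivAt_exp_mul_primitive (a k : ℝ) {w : ℝ → ℝ} (hw : Continuous w) (t : ℝ) :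
    HasDerivAt (fun t => Real.exp (a * t) * (k + ∫ s in (0 : ℝ)..t, Real.exp (-a * s) * w s))
      (a * (Real.exp (a * t) * (k + ∫ s in (0 : ℝ)..t, Real.exp (-a * s) * w s)) + w t) t := by
  have h1 : HasDerivAt (fun t => ∫ s in (0 : ℝ)..t, Real.exp (-a * s) * w s)
      (Real.exp (-a * t) * w t) t :=
    intervalIntegral.integral_hasDerivAt_right (Continuous.intervalIntegrable (by fun_prop) _ _)
      (Continuous.stronglyMeasurableAtFilter (by fun_prop) _ _)
      (Continuous.continuousAt (by fun_prop))
  have h2 : HasDerivAt (fun t => Real.exp (a * t)) (Real.exp (a * t) * (a * 1)) t :=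
    ((hasDerivAt_id t).const_mul a).exp
  refine (h2.mul (h1.const_add k)).congr_deriv ?_
  have h3 : Real.exp (a * t) * Real.exp (-a * t) = 1 := by
    rw [← Real.exp_add]; simp
  linear_combination (w t) * h3

theorem hasDerivAt_opI_expPos {m : ℝ} (hm : m < 0) {w : ℝ → ℝ} {C : ℝ} (hw : Continuous w)
    (hC : ∀ t, |w t| ≤ C) (t : ℝ) :
    HasDerivAt (opI (expPos m) w) (m * opI (expPos m) w t + w t) t := by
  rw [opI_expPos_eq_primitive hm hw.measurable hC]
  exact hasDerivAt_exp_mul_primitive m _ hw t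

theorem hasDerivAt_opI_expNeg {l : ℝ} (hl : 0 < l) {w : ℝ → ℝ} {C : ℝ} (hw : Continuous w)
    (hC : ∀ t, |w t| ≤ C) (t : ℝ) :
    HasDerivAt (opI (expNeg l) w) (l * opI (expNeg l) w t + w t) t := by
  rw [opI_expNeg_eq_primitive hl hw.measurable hC]
  exact hasDerivAt_exp_mul_primitive l _ hw t

theorem integral_norm_opB_term (hb0 : 0 ≤ b) (w : ℝ → ℝ) (j : ℕ) :
    ∫ t, ‖b ^ j * w (t - j * (c * τ))‖ = b ^ j * ∫ t, ‖w t‖ := by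
  simp only [norm_mul, Real.norm_of_nonneg (pow_nonneg hb0 j)]
  rw [integral_const_mul, integral_sub_right_eq_self (fun t => ‖w t‖)]

theorem integrable_opB (hb0 : 0 ≤ b) (hb1 : b < 1) {w : ℝ → ℝ} (hw : Measurable w)
    (hi : Integrable w) : Integrable (opB b τ c w) := by
  refine integrable_tsum (fun j => (hi.comp_sub_right _).const_mul _) ?_ (measurable_opB hw)
  simp only [integral_norm_opB_term hb0]
  exact (summable_geometric_of_lt_one hb0 hb1).mul_right _

/-- B is itself convolution with the discrete measure ∑ bʲδ_{jcτ}, hence commutes with convolution;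
summability justifies the exchange. -/
theorem opI_opB (hb0 : 0 ≤ b) (hb1 : b < 1) {w f : ℝ → ℝ} (hi : Integrable w) (hf : Measurable f)
    {C : ℝ} (hC : ∀ t, |f t| ≤ C) (t : ℝ) :
    opI (opB b τ c w) f t = opB b τ c (opI w f) t := by
  have hi' : ∀ j : ℕ, Integrable fun s => b ^ j * w (s - j * (c * τ)) := fun j =>
    (hi.comp_sub_right _).const_mul _
  have h1 : ∀ j : ℕ, Integrable fun s => b ^ j * w (s - j * (c * τ)) * f (t - s) := fun j =>
    integrable_mul_comp_sub (hi' j) hf hC t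
  rw [opI_eq_integral]
  simp only [opB, ← tsum_mul_right]
  rw [← integral_tsum_of_summable_integral_norm h1]
  · refine tsum_congr fun j => ?_
    rw [opI_eq_integral, ← integral_const_mul,
      ← integral_sub_right_eq_self (fun s => b ^ j * (w s * f (t - j * (c * τ) - s))) (j * (c * τ))]
    congr 1
    funext s
    ring_nf
  · refine Summable.of_nonneg_of_le (fun n => integral_nonneg fun _ => norm_nonneg _) (fun j => ?_)
      (((summable_geometric_of_lt_one hb0 hb1).mul_right (∫ t, ‖w t‖)).mul_right C)
    rw [← integral_norm_opB_term hb0 (c := c) (τ := τ), ← integral_mul_const]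
    refine integral_mono (h1 j).norm ((hi' j).norm.mul_const _) fun s => ?_
    rw [norm_mul]
    exact mul_le_mul_of_nonneg_left (hC _) (norm_nonneg _)

theorem integrable_opL (hb0 : 0 ≤ b) (hb1 : b < 1) {w : ℝ → ℝ} (hw : Measurable w)
    (hi : Integrable w) : Integrable (opL b τ c w) :=
  (integrable_opB hb0 hb1 hw hi).comp_sub_right _

theorem opI_opL (hb0 : 0 ≤ b) (hb1 : b < 1) {w f : ℝ → ℝ} (hi : Integrable w) (hf : Measurable f)
    {C : ℝ} (hC : ∀ t, |f t| ≤ C) (t : ℝ) :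
    opI (opL b τ c w) f t = opL b τ c (opI w f) t := by
  rw [opL, ← opI_opB hb0 hb1 hi hf hC, opI, opI]
  congr 1
  funext s
  rw [opL, sub_right_comm]

end

end NeutralKPP

/-! ### Factorization of 𝒟 and positivity of the kernel g -/

namespace NeutralKPP

open MeasureTheory

variable {b τ c : ℝ}

/-- A positive zero `l` and a negative zero `m` of `χ₁`, the latter in the half-plane where the
series defining `χ₁` converges. -/
structure CharRoots (b τ c l m : ℝ) : Prop where
  b_nonneg : 0 ≤ b
  b_lt_one : b < 1
  delay_pos : 0 < c * τ
  l_pos : 0 < l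
  m_neg : m < 0
  l_conv : b * Real.exp (-(l * c * τ)) < 1
  m_conv : b * Real.exp (-(m * c * τ)) < 1
  l_root : l ^ 2 - c * l = Real.exp (-(l * c * τ)) / (1 - b * Real.exp (-(l * c * τ)))
  m_root : m ^ 2 - c * m = Real.exp (-(m * c * τ)) / (1 - b * Real.exp (-(m * c * τ)))

noncomputable section

/-- The kernel `g` for which `𝒟 = (d/dt - l)(d/dt - m)(1 - g *)`. -/
def gKernel (b τ c l m s : ℝ) : ℝ :=
  ((m ^ 2 - c * m) * expPos m s - opL b τ c (expPos m) s - (l ^ 2 - c * l) * expNeg l s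
    + opL b τ c (expNeg l) s) / (l - m)

/-- The Green kernel of `(d/dt - l)(d/dt - m)`. -/
def greenKernel (l m s : ℝ) : ℝ := (expNeg l s - expPos m s) / (l - m)

variable {l m : ℝ}

/-- The jumps of the two one-sided kernels at 0 cancel. The formula with `min` gives continuity and
strict negativity at once. -/
theorem greenKernel_eq_min (hl : 0 < l) (hm : m < 0) (s : ℝ) :
    greenKernel l m s = -min (Real.exp (l * s)) (Real.exp (m * s)) / (l - m) := by
  rw [greenKernel, expNeg, expPos]
  congr 1
  rcases lt_or_ge s 0 with h | h
  · rw [if_pos h, if_neg (by linarith), min_eq_left (Real.exp_le_exp.2 (by nlinarith))]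
    ring
  · rw [if_neg (by linarith), if_pos h, min_eq_right (Real.exp_le_exp.2 (by nlinarith))]
    ring

theorem continuous_greenKernel (hl : 0 < l) (hm : m < 0) : Continuous (greenKernel l m) := by
  have : greenKernel l m = fun s => -min (Real.exp (l * s)) (Real.exp (m * s)) / (l - m) :=
    funext (greenKernel_eq_min hl hm)
  rw [this]
  fun_prop

theorem greenKernel_neg (hl : 0 < l) (hm : m < 0) (s : ℝ) : greenKernel l m s < 0 := by
  rw [greenKernel_eq_min hl hm]
  exact div_neg_of_neg_of_pos (neg_neg_of_pos (lt_min (Real.exp_pos _) (Real.exp_pos _)))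
    (by linarith)

theorem integrable_greenKernel (hl : 0 < l) (hm : m < 0) : Integrable (greenKernel l m) :=
  ((integrable_expNeg hl).sub (integrable_expPos hm)).div_const _

theorem abs_greenKernel_le (hl : 0 < l) (hm : m < 0) (s : ℝ) :
    |greenKernel l m s| ≤ 2 / (l - m) := by
  rw [greenKernel, abs_div, abs_of_pos (by linarith : 0 < l - m)]
  refine div_le_div_of_nonneg_right ?_ (by linarith)
  have h1 := abs_expNeg_le hl s
  have h2 := abs_expPos_le hm s
  rw [abs_le] at *
  constructor <;> linarith

theorem opI_const_mul_kernel (k : ℝ) (N f : ℝ → ℝ) (t : ℝ) :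
    opI (fun s => k * N s) f t = k * opI N f t := by
  simp only [opI, mul_assoc, integral_const_mul]

theorem opI_greenKernel (hl : 0 < l) (hm : m < 0) {f : ℝ → ℝ} {C : ℝ} (hf : Measurable f)
    (hC : ∀ t, |f t| ≤ C) (t : ℝ) :
    opI (greenKernel l m) f t = (opI (expNeg l) f t - opI (expPos m) f t) / (l - m) := by
  have e : greenKernel l m = fun s => (1 / (l - m)) * (expNeg l s + (-1) * expPos m s) := by
    funext s; rw [greenKernel]; ring
  rw [e, opI_const_mul_kernel (N := fun s => expNeg l s + (-1) * expPos m s),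
    opI_add_kernel (integrable_expNeg hl) ((integrable_expPos hm).const_mul _) hf hC,
    opI_const_mul_kernel]
  ring

namespace CharRoots

variable (R : CharRoots b τ c l m)
include R

theorem integrable_gKernel : Integrable (gKernel b τ c l m) :=
  (((((integrable_expPos R.m_neg).const_mul _).sub (integrable_opL R.b_nonneg R.b_lt_one
    (measurable_expPos m) (integrable_expPos R.m_neg))).sub
    ((integrable_expNeg R.l_pos).const_mul _)).add (integrable_opL R.b_nonneg R.b_lt_one
    (measurable_expNeg l) (integrable_expNeg R.l_pos))).div_const _

theorem opI_gKernel {f : ℝ → ℝ} {C : ℝ} (hf : Measurable f) (hC : ∀ t, |f t| ≤ C) (t : ℝ) :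
    opI (gKernel b τ c l m) f t
      = ((m ^ 2 - c * m) * opI (expPos m) f t - opL b τ c (opI (expPos m) f) t
        - (l ^ 2 - c * l) * opI (expNeg l) f t + opL b τ c (opI (expNeg l) f) t) / (l - m) := by
  have e : gKernel b τ c l m = fun s => (1 / (l - m)) * (((m ^ 2 - c * m) * expPos m s
      + (-1) * opL b τ c (expPos m) s) + (-(l ^ 2 - c * l) * expNeg l s
      + opL b τ c (expNeg l) s)) := by
    funext s; rw [gKernel]; ring
  have i1 := (integrable_expPos R.m_neg).const_mul (m ^ 2 - c * m)
  have i2 := (integrable_opL (c := c) (τ := τ) R.b_nonneg R.b_lt_one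
    (measurable_expPos m) (integrable_expPos R.m_neg)).const_mul (-1)
  have i3 := (integrable_expNeg R.l_pos).const_mul (-(l ^ 2 - c * l))
  have i4 := integrable_opL (c := c) (τ := τ) R.b_nonneg R.b_lt_one
    (measurable_expNeg l) (integrable_expNeg R.l_pos)
  have i12 : Integrable (fun s => (m ^ 2 - c * m) * expPos m s
      + (-1) * opL b τ c (expPos m) s) := i1.add i2
  have i34 : Integrable (fun s => -(l ^ 2 - c * l) * expNeg l s
      + opL b τ c (expNeg l) s) := i3.add i4
  rw [e, opI_const_mul_kernel (N := fun s => ((m ^ 2 - c * m) * expPos m s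
      + (-1) * opL b τ c (expPos m) s) + (-(l ^ 2 - c * l) * expNeg l s
      + opL b τ c (expNeg l) s)), opI_add_kernel i12 i34 hf hC,
    opI_add_kernel i1 i2 hf hC, opI_add_kernel i3 i4 hf hC, opI_const_mul_kernel,
    opI_const_mul_kernel, opI_const_mul_kernel,
    opI_opL R.b_nonneg R.b_lt_one (integrable_expPos R.m_neg) hf hC,
    opI_opL R.b_nonneg R.b_lt_one (integrable_expNeg R.l_pos) hf hC]
  ring

/-- At a zero z of χ₁ the function e^{zs} satisfies L e^{zs} = (z² - cz)e^{zs}. The form as a sum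
allows termwise comparison below. -/
theorem hasSum_exp_shift {z : ℝ} (hz : b * Real.exp (-(z * c * τ)) < 1)
    (hr : z ^ 2 - c * z = Real.exp (-(z * c * τ)) / (1 - b * Real.exp (-(z * c * τ)))) (s : ℝ) :
    HasSum (fun j : ℕ => b ^ j * Real.exp (z * (s - c * τ - j * (c * τ))))
      ((z ^ 2 - c * z) * Real.exp (z * s)) := by
  convert! hasSum_opB_exp R.b_nonneg hz (s - c * τ) using 1
  have e : Real.exp (z * (s - c * τ)) = Real.exp (-(z * c * τ)) * Real.exp (z * s) := by
    rw [← Real.exp_add]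
    ring_nf
  rw [hr, e]
  ring

/-- For s < 0 every shift of s is negative, so the root equation for l makes g vanish. For s ≥ 0 the
root equation for m expands (m² - cm)e^{ms} as ∑ bʲe^{mx_j} with x_j = s - (j+1)cτ. The terms with
x_j ≥ 0 cancel, and those with x_j < 0 leave e^{mx_j} - e^{lx_j} ≥ 0. -/
theorem gKernel_nonneg (s : ℝ) : 0 ≤ gKernel b τ c l m s := by
  have hlm : 0 < l - m := by linarith [R.l_pos, R.m_neg]
  refine div_nonneg ?_ hlm.le
  rw [opL, opL]
  have hP := summable_opB (τ := τ) (c := c) R.b_nonneg R.b_lt_one (abs_expPos_le R.m_neg) (s - c * τ)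
  have hN := summable_opB (τ := τ) (c := c) R.b_nonneg R.b_lt_one (abs_expNeg_le R.l_pos) (s - c * τ)
  rcases lt_or_ge s 0 with h | h
  · have h1 := R.hasSum_exp_shift R.l_conv R.l_root s
    have hneg : ∀ j : ℕ, s - c * τ - j * (c * τ) < 0 := fun j => by
      have : 0 ≤ (j : ℝ) * (c * τ) := mul_nonneg j.cast_nonneg R.delay_pos.le
      linarith [R.delay_pos]
    have e1 : opB b τ c (expPos m) (s - c * τ) = 0 := by
      rw [opB]
      convert! tsum_zero with j
      rw [expPos, if_neg (not_le.2 (hneg j)), mul_zero]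
    have e2 : opB b τ c (expNeg l) (s - c * τ) = -((l ^ 2 - c * l) * Real.exp (l * s)) := by
      rw [← h1.tsum_eq, opB, ← tsum_neg]
      refine tsum_congr fun j => ?_
      rw [expNeg, if_pos (hneg j), mul_neg]
    rw [e1, e2, expPos, if_neg (not_le.2 h), expNeg, if_pos h]
    linarith
  · have h1 := R.hasSum_exp_shift R.m_conv R.m_root s
    rw [expPos, if_pos h, expNeg, if_neg (not_lt.2 h)]
    have h2 := (h1.sub hP.hasSum).add hN.hasSum
    have h3 := h2.nonneg fun j => ?_
    · change 0 ≤ (m ^ 2 - c * m) * Real.exp (m * s) - opB b τ c (expPos m) (s - c * τ)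
        + opB b τ c (expNeg l) (s - c * τ) at h3
      linarith
    · set x := s - c * τ - j * (c * τ)
      rw [← mul_sub, ← mul_add]
      refine mul_nonneg (pow_nonneg R.b_nonneg j) ?_
      rw [expPos, expNeg]
      rcases lt_or_ge x 0 with hx | hx
      · rw [if_neg (not_le.2 hx), if_pos hx]
        have : Real.exp (l * x) ≤ Real.exp (m * x) :=
          Real.exp_le_exp.2 (by nlinarith [R.l_pos, R.m_neg])
        linarith
      · rw [if_pos hx, if_neg (not_lt.2 hx)]
        linarith

/-- Apply the factorization to the constant 1: the symbol of 𝒟 at 0 is -1/(1 - b), and that of (d/dt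
- l)(d/dt - m) is lm. -/
theorem integral_gKernel : ∫ s, gKernel b τ c l m s = 1 + 1 / ((1 - b) * (l * m)) := by
  have h := R.opI_gKernel (f := fun _ => 1) (C := 1) measurable_const (by simp) 0
  have hl := R.l_pos.ne'
  have hm := R.m_neg.ne
  have hlm : l - m ≠ 0 := by linarith [R.l_pos, R.m_neg]
  have hb : 1 - b ≠ 0 := by linarith [R.b_lt_one]
  have e1 : opI (expPos m) (fun _ => 1) = fun _ => -1 / m := by
    funext t; rw [opI_const, integral_expPos R.m_neg, mul_one]
  have e2 : opI (expNeg l) (fun _ => 1) = fun _ => -1 / l := by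
    funext t; rw [opI_const, integral_expNeg R.l_pos, mul_one]
  rw [opI_const, mul_one, e1, e2, opL, opL, opB_const R.b_nonneg R.b_lt_one,
    opB_const R.b_nonneg R.b_lt_one] at h
  rw [h]
  field_simp
  ring

theorem integral_gKernel_lt_one : ∫ s, gKernel b τ c l m s < 1 := by
  rw [R.integral_gKernel]
  have : 1 / ((1 - b) * (l * m)) < 0 := one_div_neg.2
    (mul_neg_of_pos_of_neg (by linarith [R.b_lt_one]) (mul_neg_of_pos_of_neg R.l_pos R.m_neg))
  linarith

theorem abs_opL_le {w : ℝ → ℝ} {C : ℝ} (hC : ∀ t, |w t| ≤ C) (t : ℝ) :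
    |opL b τ c w t| ≤ C / (1 - b) := abs_opB_le R.b_nonneg R.b_lt_one hC _

theorem abs_opI_expPos_le {w : ℝ → ℝ} {C : ℝ} (hC : ∀ t, |w t| ≤ C) (t : ℝ) :
    |opI (expPos m) w t| ≤ (∫ s, |expPos m s|) * C := abs_opI_le (integrable_expPos R.m_neg) hC t

theorem abs_opI_expNeg_le {w : ℝ → ℝ} {C : ℝ} (hC : ∀ t, |w t| ≤ C) (t : ℝ) :
    |opI (expNeg l) w t| ≤ (∫ s, |expNeg l s|) * C := abs_opI_le (integrable_expNeg R.l_pos) hC t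

/-- `L E` has derivative `a L E + L y` when `E` has derivative `a E + y`. -/
theorem hasDerivAt_opL {E y : ℝ → ℝ} {a C C' : ℝ} (hE : ∀ t, |E t| ≤ C) (hy : ∀ t, |y t| ≤ C')
    (hd : ∀ t, HasDerivAt E (a * E t + y t) t) (t : ℝ) :
    HasDerivAt (opL b τ c E) (a * opL b τ c E t + opL b τ c y t) t := by
  have haE : ∀ t, |a * E t| ≤ |a| * C := fun t => by
    rw [abs_mul]; exact mul_le_mul_of_nonneg_left (hE t) (abs_nonneg a)
  have h1 := hasDerivAt_opB (τ := τ) (c := c) R.b_nonneg R.b_lt_one hE (C' := |a| * C + C')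
    (fun t => (abs_add_le _ _).trans (add_le_add (haE t) (hy t))) hd (t - c * τ)
  rw [opB_add R.b_nonneg R.b_lt_one haE hy, opB_const_mul] at h1
  exact h1.comp_sub_const t (c * τ)

/-- The first-order term in the derivative of `g * y`. -/
theorem hasDerivAt_opI_gKernel {y : ℝ → ℝ} {C : ℝ} (hy : Continuous y) (hC : ∀ t, |y t| ≤ C)
    (t : ℝ) :
    HasDerivAt (opI (gKernel b τ c l m) y)
      (m * opI (gKernel b τ c l m) y t - (l + m - c) * y t
        - (l ^ 2 - c * l) * opI (expNeg l) y t + opL b τ c (opI (expNeg l) y) t) t := by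
  have hlm : l - m ≠ 0 := by linarith [R.l_pos, R.m_neg]
  have d1 := hasDerivAt_opI_expPos R.m_neg hy hC
  have d2 := hasDerivAt_opI_expNeg R.l_pos hy hC
  have d3 := R.hasDerivAt_opL (R.abs_opI_expPos_le hC) hC d1 t
  have d4 := R.hasDerivAt_opL (R.abs_opI_expNeg_le hC) hC d2 t
  have e : opI (gKernel b τ c l m) y = _ := funext (R.opI_gKernel hy.measurable hC)
  rw [e]
  refine ((((((d1 t).const_mul (m ^ 2 - c * m)).sub d3).sub
    ((d2 t).const_mul (l ^ 2 - c * l))).add d4).div_const (l - m)).congr_deriv ?_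
  field_simp
  ring

end CharRoots

end

end NeutralKPP

/-! ### Comparison principle and the inverse kernel of 𝒟 -/

namespace NeutralKPP

open MeasureTheory

variable {b τ c l m : ℝ}

theorem monotoneOn_of_hasDerivAt_nonneg {f f' : ℝ → ℝ} {D : Set ℝ} (hD : Convex ℝ D)
    (hc : ContinuousOn f D) (hd : ∀ t ∈ interior D, HasDerivAt f (f' t) t)
    (h0 : ∀ t ∈ interior D, 0 ≤ f' t) : MonotoneOn f D :=
  monotoneOn_of_deriv_nonneg hD hc
    (fun t ht => (hd t ht).differentiableAt.differentiableWithinAt)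
    fun t ht => by rw [(hd t ht).deriv]; exact h0 t ht

theorem antitoneOn_of_hasDerivAt_nonpos {f f' : ℝ → ℝ} {D : Set ℝ} (hD : Convex ℝ D)
    (hc : ContinuousOn f D) (hd : ∀ t ∈ interior D, HasDerivAt f (f' t) t)
    (h0 : ∀ t ∈ interior D, f' t ≤ 0) : AntitoneOn f D :=
  antitoneOn_of_deriv_nonpos hD hc
    (fun t ht => (hd t ht).differentiableAt.differentiableWithinAt)
    fun t ht => by rw [(hd t ht).deriv]; exact h0 t ht

theorem monotone_of_hasDerivAt_nonneg_off {f f' : ℝ → ℝ} {t₁ : ℝ} (hc : Continuous f)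
    (hd : ∀ t, t ≠ t₁ → HasDerivAt f (f' t) t) (h0 : ∀ t, t ≠ t₁ → 0 ≤ f' t) : Monotone f := by
  refine MonotoneOn.Iic_union_Ici (a := t₁)
    (monotoneOn_of_hasDerivAt_nonneg (f' := f') (convex_Iic t₁) hc.continuousOn ?_ ?_)
    (monotoneOn_of_hasDerivAt_nonneg (f' := f') (convex_Ici t₁) hc.continuousOn ?_ ?_)
  · intro t ht; rw [interior_Iic] at ht; exact hd t (ne_of_lt ht)
  · intro t ht; rw [interior_Iic] at ht; exact h0 t (ne_of_lt ht)
  · intro t ht; rw [interior_Ici] at ht; exact hd t (ne_of_gt ht)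
  · intro t ht; rw [interior_Ici] at ht; exact h0 t (ne_of_gt ht)

theorem tendsto_exp_mul_atTop {a : ℝ} (ha : a < 0) :
    Tendsto (fun t => Real.exp (a * t)) atTop (𝓝 0) :=
  Real.tendsto_exp_atBot.comp (tendsto_id.const_mul_atTop_of_neg ha)

theorem tendsto_exp_mul_atBot {a : ℝ} (ha : 0 < a) :
    Tendsto (fun t => Real.exp (a * t)) atBot (𝓝 0) :=
  Real.tendsto_exp_atBot.comp (tendsto_id.const_mul_atBot ha)

theorem hasDerivAt_exp_mul_mul {f : ℝ → ℝ} {a r t : ℝ} (hf : HasDerivAt f (a * f t + r) t) :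
    HasDerivAt (fun s => Real.exp (-a * s) * f s) (Real.exp (-a * t) * r) t := by
  have h2 : HasDerivAt (fun t => Real.exp (-a * t)) (Real.exp (-a * t) * (-a * 1)) t :=
    ((hasDerivAt_id t).const_mul (-a)).exp
  refine (h2.mul hf).congr_deriv ?_
  ring

theorem tendsto_exp_mul_mul_zero {f e : ℝ → ℝ} {F : Filter ℝ} {C : ℝ} (he : Tendsto e F (𝓝 0))
    (hf : ∀ᶠ t in F, |f t| ≤ C) : Tendsto (fun t => e t * f t) F (𝓝 0) := by
  have h1 : Tendsto (fun t => |e t| * C) F (𝓝 0) := by simpa using he.abs.mul_const C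
  refine squeeze_zero_norm' (hf.mono fun t ht => ?_) h1
  rw [norm_mul]
  exact mul_le_mul_of_nonneg_left ht (abs_nonneg _)

/-- A bounded function with `z' = l z + r`, `l > 0`, `r ≤ 0` off a downward jump is non-negative. -/
theorem nonneg_of_deriv_le_of_jump {z r : ℝ → ℝ} {t₁ zl zr C l : ℝ} (hl : 0 < l)
    (hd : ∀ t, t ≠ t₁ → HasDerivAt z (l * z t + r t) t) (hr : ∀ t, t ≠ t₁ → r t ≤ 0)
    (hC : ∀ t, t ≠ t₁ → |z t| ≤ C) (hzl : Tendsto z (𝓝[<] t₁) (𝓝 zl))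
    (hzr : Tendsto z (𝓝[>] t₁) (𝓝 zr)) (hle : zr ≤ zl) (t : ℝ) (ht : t ≠ t₁) : 0 ≤ z t := by
  have hZ : ∀ t, t ≠ t₁ → HasDerivAt (fun s => Real.exp (-l * s) * z s) (Real.exp (-l * t) * r t) t :=
    fun t ht => hasDerivAt_exp_mul_mul (hd t ht)
  have hZ0 : ∀ t, t ≠ t₁ → Real.exp (-l * t) * r t ≤ 0 := fun t ht =>
    mul_nonpos_of_nonneg_of_nonpos (Real.exp_pos _).le (hr t ht)
  have hright : AntitoneOn (fun s => Real.exp (-l * s) * z s) (Set.Ioi t₁) := by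
    refine antitoneOn_of_hasDerivAt_nonpos (convex_Ioi t₁)
      (fun s hs => (hZ s (ne_of_gt hs)).continuousAt.continuousWithinAt)
      (fun s hs => hZ s ?_) fun s hs => hZ0 s ?_
    all_goals rw [interior_Ioi] at hs; exact ne_of_gt hs
  have hleft : AntitoneOn (fun s => Real.exp (-l * s) * z s) (Set.Iio t₁) := by
    refine antitoneOn_of_hasDerivAt_nonpos (convex_Iio t₁)
      (fun s hs => (hZ s (ne_of_lt hs)).continuousAt.continuousWithinAt)
      (fun s hs => hZ s ?_) fun s hs => hZ0 s ?_
    all_goals rw [interior_Iio] at hs; exact ne_of_lt hs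
  have hlim : Tendsto (fun s => Real.exp (-l * s) * z s) atTop (𝓝 0) :=
    tendsto_exp_mul_mul_zero (tendsto_exp_mul_atTop (by linarith))
      ((eventually_gt_atTop t₁).mono fun s hs => hC s hs.ne')
  have hpos : ∀ s, t₁ < s → 0 ≤ z s := fun s hs => by
    have : 0 ≤ Real.exp (-l * s) * z s := by
      refine le_of_tendsto hlim ((eventually_ge_atTop s).mono fun x hx => ?_)
      exact hright hs (lt_of_lt_of_le hs hx) hx
    exact nonneg_of_mul_nonneg_right this (Real.exp_pos _)
  -- To the right of the jump, e^{-lt}z decreases to 0, so z ≥ 0. A downward jump passes this sign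
  -- to the left limit, and monotonicity carries it further left.
  rcases lt_or_gt_of_ne ht with h | h
  · have hzr0 : 0 ≤ zr := ge_of_tendsto hzr (eventually_nhdsWithin_of_forall hpos)
    have hlim' : Tendsto (fun s => Real.exp (-l * s) * z s) (𝓝[<] t₁)
        (𝓝 (Real.exp (-l * t₁) * zl)) := by
      refine Tendsto.mul ?_ hzl
      exact (Continuous.tendsto (by fun_prop) t₁).mono_left nhdsWithin_le_nhds
    have h1 : Real.exp (-l * t₁) * zl ≤ Real.exp (-l * t) * z t := by
      refine le_of_tendsto hlim' ?_
      filter_upwards [Ioo_mem_nhdsLT h] with s hs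
      exact hleft h hs.2 hs.1.le
    have h2 : 0 ≤ Real.exp (-l * t₁) * zl := mul_nonneg (Real.exp_pos _).le (hzr0.trans hle)
    exact nonneg_of_mul_nonneg_right (h2.trans h1) (Real.exp_pos _)
  · exact hpos t h

namespace CharRoots

variable (R : CharRoots b τ c l m)
include R

/-- Comparison principle: `-𝒟` is inverse positive, corners with a downward jump of the slope
being allowed. -/
theorem nonneg_of_opD_nonpos {y y' y'' : ℝ → ℝ} {C C' t₁ jl jr : ℝ} (hy : Continuous y)
    (hC : ∀ t, |y t| ≤ C) (hd : ∀ t, t ≠ t₁ → HasDerivAt y (y' t) t)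
    (hd2 : ∀ t, t ≠ t₁ → HasDerivAt y' (y'' t) t) (hC' : ∀ t, t ≠ t₁ → |y' t| ≤ C')
    (hjl : Tendsto y' (𝓝[<] t₁) (𝓝 jl)) (hjr : Tendsto y' (𝓝[>] t₁) (𝓝 jr)) (hle : jr ≤ jl)
    (hD : ∀ t, t ≠ t₁ → y'' t - c * y' t - opL b τ c y t ≤ 0) (t : ℝ) : 0 ≤ y t := by
  set E := opI (expNeg l) y with hE
  have dE := hasDerivAt_opI_expNeg R.l_pos hy hC
  have dLE := R.hasDerivAt_opL (R.abs_opI_expNeg_le hC) hC dE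
  have hEC := R.abs_opI_expNeg_le hC
  have hLEC := R.abs_opL_le hEC
  rw [← hE] at dE dLE hEC hLEC
  have cE : Continuous E := continuous_iff_continuousAt.2 fun t => (dE t).continuousAt
  have cLE : Continuous (opL b τ c E) := continuous_iff_continuousAt.2 fun t => (dLE t).continuousAt
  -- Chosen so that z = y' + A equals (d/dt - m)(1 - g *)y. Then z' = lz + 𝒟y, and `A` is
  -- continuous, so z inherits exactly the jump of y'.
  let A : ℝ → ℝ := fun t => (l - c) * y t + (l ^ 2 - c * l) * E t - opL b τ c E t
  have cA : Continuous A := by fun_prop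
  let z : ℝ → ℝ := fun t => y' t + A t
  set CE := (∫ s, |expNeg l s|) * C
  have hA : ∀ t, |A t| ≤ |l - c| * C + |l ^ 2 - c * l| * CE + CE / (1 - b) := by
    intro t
    have h1 : |(l - c) * y t| ≤ |l - c| * C := by
      rw [abs_mul]; exact mul_le_mul_of_nonneg_left (hC t) (abs_nonneg _)
    have h2 : |(l ^ 2 - c * l) * E t| ≤ |l ^ 2 - c * l| * CE := by
      rw [abs_mul]; exact mul_le_mul_of_nonneg_left (hEC t) (abs_nonneg _)
    exact (abs_sub _ _).trans (add_le_add ((abs_add_le _ _).trans (add_le_add h1 h2)) (hLEC t))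
  have hz : ∀ t, t ≠ t₁ → 0 ≤ z t := by
    refine nonneg_of_deriv_le_of_jump (r := fun t => y'' t - c * y' t - opL b τ c y t) R.l_pos
      (fun t ht => ?_) hD (C := C' + (|l - c| * C + |l ^ 2 - c * l| * CE + CE / (1 - b)))
      (fun t ht => (abs_add_le _ _).trans (add_le_add (hC' t ht) (hA t)))
      (hjl.add ((cA.tendsto t₁).mono_left nhdsWithin_le_nhds))
      (hjr.add ((cA.tendsto t₁).mono_left nhdsWithin_le_nhds)) (by linarith)
    refine ((hd2 t ht).add ((((hd t ht).const_mul (l - c)).add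
      ((dE t).const_mul (l ^ 2 - c * l))).sub (dLE t))).congr_deriv ?_
    simp only [z, A]
    ring
  set G := opI (gKernel b τ c l m) y with hG
  have dG := R.hasDerivAt_opI_gKernel hy hC
  rw [← hG, ← hE] at dG
  have cG : Continuous G := continuous_opI R.integrable_gKernel hy hC
  -- Second factor: u = y - g * y solves u' = mu + z with z ≥ 0, so e^{-mt}u increases from its
  -- limit 0 at -∞. What remains is y ≥ g * y, and the contraction argument applies.
  have hu : ∀ t, t ≠ t₁ → HasDerivAt (fun s => y s - G s) (m * (y t - G t) + z t) t := by
    intro t ht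
    refine ((hd t ht).sub (dG t)).congr_deriv ?_
    simp only [z, A]
    ring
  have hU : Monotone fun s => Real.exp (-m * s) * (y s - G s) :=
    monotone_of_hasDerivAt_nonneg_off (t₁ := t₁) (by fun_prop)
      (fun t ht => hasDerivAt_exp_mul_mul (hu t ht))
      fun t ht => mul_nonneg (Real.exp_pos _).le (hz t ht)
  have hlim : Tendsto (fun s => Real.exp (-m * s) * (y s - G s)) atBot (𝓝 0) :=
    tendsto_exp_mul_mul_zero (tendsto_exp_mul_atBot (by linarith [R.m_neg]))
      (Eventually.of_forall fun s => (abs_sub _ _).trans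
        (add_le_add (hC s) (abs_opI_le R.integrable_gKernel hC s)))
  have hu0 : ∀ t, G t ≤ y t := fun t => by
    have : 0 ≤ Real.exp (-m * t) * (y t - G t) :=
      le_of_tendsto hlim ((eventually_le_atBot t).mono fun s hs => hU hs)
    linarith [nonneg_of_mul_nonneg_right this (Real.exp_pos _)]
  exact nonneg_of_opI_le R.integrable_gKernel R.gKernel_nonneg R.integral_gKernel_lt_one
    hy.measurable hC hu0 t

end CharRoots

theorem isCb2_of_hasDerivAt {y y' y'' : ℝ → ℝ} {C C' C'' : ℝ} (hC : ∀ t, |y t| ≤ C)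
    (hC' : ∀ t, |y' t| ≤ C') (hC'' : ∀ t, |y'' t| ≤ C'') (hd : ∀ t, HasDerivAt y (y' t) t)
    (hd2 : ∀ t, HasDerivAt y' (y'' t) t) (hc : Continuous y'') : IsCb2 y := by
  have e1 : deriv y = y' := funext fun t => (hd t).deriv
  have e2 : deriv y' = y'' := funext fun t => (hd2 t).deriv
  refine ⟨?_, max C (max C' C''), fun t => ?_⟩
  · rw [show (2 : WithTop ℕ∞) = 1 + 1 from rfl, contDiff_succ_iff_deriv, e1]
    refine ⟨fun t => (hd t).differentiableAt, by simp, ?_⟩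
    rw [contDiff_one_iff_deriv, e2]
    exact ⟨fun t => (hd2 t).differentiableAt, hc⟩
  · rw [e1, e2]
    exact ⟨(hC t).trans (le_max_left _ _), (hC' t).trans ((le_max_left _ _).trans (le_max_right _ _)),
      (hC'' t).trans ((le_max_right _ _).trans (le_max_right _ _))⟩

theorem hasDerivAt_deriv_of_contDiff_two {w : ℝ → ℝ} (h : ContDiff ℝ 2 w) (t : ℝ) :
    HasDerivAt w (deriv w t) t ∧ HasDerivAt (deriv w) (deriv (deriv w) t) t :=
  ⟨(h.differentiable (by norm_num) t).hasDerivAt,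
    ((h.differentiable_deriv_two) t).hasDerivAt⟩

theorem isCb_opD (hb0 : 0 ≤ b) (hb1 : b < 1) {w : ℝ → ℝ} (hw : IsCb2 w) : IsCb (opD b τ c w) := by
  obtain ⟨hs, C, hC⟩ := hw
  have h1 : Continuous (deriv w) := hs.continuous_deriv (by norm_num)
  have h2 : Continuous (deriv (deriv w)) := by
    have := hs.iterate_deriv' 0 2
    simpa using this.continuous
  have h3 : Continuous (opL b τ c w) :=
    (continuous_opB hb0 hb1 (fun t => (hC t).1) hs.continuous).comp (continuous_sub_right _)
  refine ⟨by unfold opD; fun_prop, C + |c| * C + C / (1 - b), fun t => ?_⟩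
  have h4 : |c * deriv w t| ≤ |c| * C := by
    rw [abs_mul]; exact mul_le_mul_of_nonneg_left (hC t).2.1 (abs_nonneg _)
  exact (abs_sub _ _).trans (add_le_add ((abs_sub _ _).trans (add_le_add (hC t).2.2 h4))
    (abs_opB_le hb0 hb1 (fun t => (hC t).1) _))

namespace CharRoots

variable (R : CharRoots b τ c l m)
include R

/-- Off corners nothing is needed: a bounded `C²` function with bounded derivative and
`𝒟 y ≤ 0` is non-negative. -/
theorem nonneg_of_contDiff {y : ℝ → ℝ} (hy : IsCb2 y) (hD : ∀ t, opD b τ c y t ≤ 0) (t : ℝ) :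
    0 ≤ y t := by
  obtain ⟨hs, C, hC⟩ := hy
  have h1 : Continuous (deriv y) := hs.continuous_deriv (by norm_num)
  exact R.nonneg_of_opD_nonpos (t₁ := 0) hs.continuous (fun t => (hC t).1)
    (fun t _ => (hasDerivAt_deriv_of_contDiff_two hs t).1)
    (fun t _ => (hasDerivAt_deriv_of_contDiff_two hs t).2) (fun t _ => (hC t).2.1)
    ((h1.tendsto 0).mono_left nhdsWithin_le_nhds) ((h1.tendsto 0).mono_left nhdsWithin_le_nhds)
    le_rfl (fun t _ => hD t) t

end CharRoots

theorem IsCb2.sub {w v : ℝ → ℝ} (hw : IsCb2 w) (hv : IsCb2 v) : IsCb2 fun t => w t - v t := by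
  obtain ⟨hs, C, hC⟩ := hw
  obtain ⟨hs', C', hC'⟩ := hv
  have hc : Continuous (deriv (deriv w)) := by
    have := hs.iterate_deriv' 0 2
    simpa using this.continuous
  have hc' : Continuous (deriv (deriv v)) := by
    have := hs'.iterate_deriv' 0 2
    simpa using this.continuous
  refine isCb2_of_hasDerivAt (fun t => (abs_sub _ _).trans (add_le_add (hC t).1 (hC' t).1))
    (fun t => (abs_sub _ _).trans (add_le_add (hC t).2.1 (hC' t).2.1))
    (fun t => (abs_sub _ _).trans (add_le_add (hC t).2.2 (hC' t).2.2))
    (fun t => (hasDerivAt_deriv_of_contDiff_two hs t).1.sub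
      (hasDerivAt_deriv_of_contDiff_two hs' t).1)
    (fun t => (hasDerivAt_deriv_of_contDiff_two hs t).2.sub
      (hasDerivAt_deriv_of_contDiff_two hs' t).2) (hc.sub hc')

theorem opD_sub (hb0 : 0 ≤ b) (hb1 : b < 1) {w v : ℝ → ℝ} (hw : IsCb2 w) (hv : IsCb2 v) (t : ℝ) :
    opD b τ c (fun t => w t - v t) t = opD b τ c w t - opD b τ c v t := by
  obtain ⟨hs, C, hC⟩ := hw
  obtain ⟨hs', C', hC'⟩ := hv
  have e1 : deriv (fun t => w t - v t) = fun t => deriv w t - deriv v t := funext fun t =>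
    ((hasDerivAt_deriv_of_contDiff_two hs t).1.sub (hasDerivAt_deriv_of_contDiff_two hs' t).1).deriv
  have e2 : deriv (fun t => deriv w t - deriv v t) t = deriv (deriv w) t - deriv (deriv v) t :=
    ((hasDerivAt_deriv_of_contDiff_two hs t).2.sub (hasDerivAt_deriv_of_contDiff_two hs' t).2).deriv
  rw [opD, e1, e2, opL, opB_sub hb0 hb1 (fun t => (hC t).1) (fun t => (hC' t).1), opD, opD, opL, opL]
  ring

namespace CharRoots

variable (R : CharRoots b τ c l m)
include R

theorem le_of_opD_le {w v : ℝ → ℝ} (hw : IsCb2 w) (hv : IsCb2 v)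
    (h : ∀ t, opD b τ c w t ≤ opD b τ c v t) (t : ℝ) : v t ≤ w t := by
  have := R.nonneg_of_contDiff (hw.sub hv) (fun t => by
    rw [opD_sub R.b_nonneg R.b_lt_one hw hv]; linarith [h t]) t
  linarith

/-- The inverse kernel, with the extra facts used for the iteration: it is negative everywhere,
and `N *` maps bounded measurable functions to continuous ones. -/
theorem exists_inverseKernel :
    ∃ N : ℝ → ℝ, IsInverseKernel b τ c N ∧ (∀ t, N t < 0) ∧
      ∀ f : ℝ → ℝ, Measurable f → ∀ C : ℝ, (∀ t, |f t| ≤ C) → Continuous (opI N f) := by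
  obtain ⟨N, hNc, hNi, ⟨K, hK⟩, hle, hres⟩ := exists_resolvent_kernel R.integrable_gKernel
    R.gKernel_nonneg R.integral_gKernel_lt_one (integrable_greenKernel R.l_pos R.m_neg)
    (continuous_greenKernel R.l_pos R.m_neg) (abs_greenKernel_le R.l_pos R.m_neg)
    fun t => (greenKernel_neg R.l_pos R.m_neg t).le
  have hlm : l - m ≠ 0 := by linarith [R.l_pos, R.m_neg]
  have hneg : ∀ t, N t < 0 := fun t => (hle t).trans_lt (greenKernel_neg R.l_pos R.m_neg t)
  have hNf : ∀ f : ℝ → ℝ, Measurable f → ∀ C : ℝ, (∀ t, |f t| ≤ C) → ∀ t,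
      opI N f t = opI (greenKernel l m) f t + opI (gKernel b τ c l m) (opI N f) t := by
    intro f hf C hC t
    have e : N = fun s => greenKernel l m s + opI (gKernel b τ c l m) N s := funext hres
    conv_lhs => rw [e]
    rw [opI_add_kernel (integrable_greenKernel R.l_pos R.m_neg)
      (integrable_opI R.integrable_gKernel hNi) hf hC,
      opI_assoc R.integrable_gKernel hNi hNc.measurable hK hf hC]
  have hmeas : ∀ f : ℝ → ℝ, Measurable f → Measurable (opI N f) := by
    intro f hf
    have hm : StronglyMeasurable (fun p : ℝ × ℝ => N (p.1 - p.2) * f p.2) :=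
      ((hNc.measurable.comp (measurable_fst.sub measurable_snd)).mul
        (hf.comp measurable_snd)).stronglyMeasurable
    exact (hm.integral_prod_right' (ν := volume)).measurable
  -- Only measurability of `f` is assumed: the limit of the iterates is at first known only to be
  -- monotone.
  have hcont : ∀ f : ℝ → ℝ, Measurable f → ∀ C : ℝ, (∀ t, |f t| ≤ C) → Continuous (opI N f) := by
    intro f hf C hC
    have h1 := hmeas f hf
    have h2 := abs_opI_le hNi hC
    have e : opI N f = fun t => opI (greenKernel l m) f t + opI (gKernel b τ c l m) (opI N f) t :=
      funext (hNf f hf C hC)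
    rw [e]
    simp only [opI_greenKernel R.l_pos R.m_neg hf hC, R.opI_gKernel h1 h2]
    have c1 := continuous_opI_expPos R.m_neg hf hC
    have c2 := continuous_opI_expNeg R.l_pos hf hC
    have c3 := continuous_opI_expPos R.m_neg h1 h2
    have c4 := continuous_opI_expNeg R.l_pos h1 h2
    have c5 : Continuous (opL b τ c (opI (expPos m) (opI N f))) :=
      (continuous_opB R.b_nonneg R.b_lt_one (R.abs_opI_expPos_le h2) c3).comp
        (continuous_sub_right _)
    have c6 : Continuous (opL b τ c (opI (expNeg l) (opI N f))) :=
      (continuous_opB R.b_nonneg R.b_lt_one (R.abs_opI_expNeg_le h2) c4).comp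
        (continuous_sub_right _)
    fun_prop
  have hright : ∀ f, IsCb f → IsCb2 (opI N f) ∧ opD b τ c (opI N f) = f := by
    rintro f ⟨hf, C, hC⟩
    set y := opI N f with hy
    have cy : Continuous y := hcont f hf.measurable C hC
    have by' : ∀ t, |y t| ≤ (∫ s, |N s|) * C := abs_opI_le hNi hC
    set Cy := (∫ s, |N s|) * C
    have bE := R.abs_opI_expNeg_le by'
    have bLE := R.abs_opL_le bE
    have bEf := R.abs_opI_expNeg_le hC
    have bLy := R.abs_opL_le by'
    have dE := hasDerivAt_opI_expNeg R.l_pos cy by'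
    have dLE := R.hasDerivAt_opL bE by' dE
    have dEf := hasDerivAt_opI_expNeg R.l_pos hf hC
    have dPf := hasDerivAt_opI_expPos R.m_neg hf hC
    have dg := R.hasDerivAt_opI_gKernel cy by'
    have e : y = fun t => (opI (expNeg l) f t - opI (expPos m) f t) / (l - m)
        + opI (gKernel b τ c l m) y t := funext fun t => by
      rw [hy, hNf f hf.measurable C hC, opI_greenKernel R.l_pos R.m_neg hf.measurable hC]
    -- The derivative of y = G₀ * f + g * y. The same identity eliminates the `expPos` terms,
    -- leaving an expression that can be differentiated again although `f` is merely continuous.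
    let y' : ℝ → ℝ := fun t => opI (expNeg l) f t - (l - c) * y t
      - (l ^ 2 - c * l) * opI (expNeg l) y t + opL b τ c (opI (expNeg l) y) t
    have d1 : ∀ t, HasDerivAt y (y' t) t := by
      intro t
      have h := ((((dEf t).sub (dPf t)).div_const (l - m)).add (dg t))
      have h' : HasDerivAt y _ t := h.congr_of_eventuallyEq (Eventually.of_forall fun s => congrFun e s)
      refine h'.congr_deriv ?_
      have ht := congrFun e t
      have : opI (gKernel b τ c l m) y t
          = y t - (opI (expNeg l) f t - opI (expPos m) f t) / (l - m) := by linarith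
      simp only [y']
      rw [this]
      field_simp
      ring
    let y'' : ℝ → ℝ := fun t => f t + c * y' t + opL b τ c y t
    have d2 : ∀ t, HasDerivAt y' (y'' t) t := by
      intro t
      refine ((((dEf t).sub ((d1 t).const_mul (l - c))).sub ((dE t).const_mul (l ^ 2 - c * l))).add
        (dLE t)).congr_deriv ?_
      simp only [y'', y']
      ring
    have cy' : Continuous y' := continuous_iff_continuousAt.2 fun t => (d2 t).continuousAt
    have by1 : ∀ t, |y' t| ≤ (∫ s, |expNeg l s|) * C + |l - c| * Cy
        + |l ^ 2 - c * l| * ((∫ s, |expNeg l s|) * Cy) + (∫ s, |expNeg l s|) * Cy / (1 - b) := by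
      intro t
      have h1 : |(l - c) * y t| ≤ |l - c| * Cy := by
        rw [abs_mul]; exact mul_le_mul_of_nonneg_left (by' t) (abs_nonneg _)
      have h2 : |(l ^ 2 - c * l) * opI (expNeg l) y t|
          ≤ |l ^ 2 - c * l| * ((∫ s, |expNeg l s|) * Cy) := by
        rw [abs_mul]; exact mul_le_mul_of_nonneg_left (bE t) (abs_nonneg _)
      exact (abs_add_le _ _).trans (add_le_add ((abs_sub _ _).trans (add_le_add
        ((abs_sub _ _).trans (add_le_add (bEf t) h1)) h2)) (bLE t))
    set C1 := (∫ s, |expNeg l s|) * C + |l - c| * Cy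
        + |l ^ 2 - c * l| * ((∫ s, |expNeg l s|) * Cy) + (∫ s, |expNeg l s|) * Cy / (1 - b)
    have by2 : ∀ t, |y'' t| ≤ C + |c| * C1 + Cy / (1 - b) := by
      intro t
      have h1 : |c * y' t| ≤ |c| * C1 := by
        rw [abs_mul]; exact mul_le_mul_of_nonneg_left (by1 t) (abs_nonneg _)
      exact (abs_add_le _ _).trans (add_le_add ((abs_add_le _ _).trans (add_le_add (hC t) h1)) (bLy t))
    have cL : Continuous (opL b τ c y) :=
      (continuous_opB R.b_nonneg R.b_lt_one by' cy).comp (continuous_sub_right _)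
    refine ⟨isCb2_of_hasDerivAt by' by1 by2 d1 d2 (by fun_prop), ?_⟩
    have e1 : deriv y = y' := funext fun t => (d1 t).deriv
    funext t
    rw [opD, e1, (d2 t).deriv]
    simp only [y'']
    ring
  -- The left inverse follows from the right one: w and N * 𝒟w have the same image under 𝒟, and
  -- comparison in both directions identifies them.
  refine ⟨N, ⟨hNc, fun t => (hneg t).le, hNi, fun w hw => ?_, hright⟩, hneg, hcont⟩
  obtain ⟨h1, h2⟩ := hright _ (isCb_opD R.b_nonneg R.b_lt_one hw)
  funext t
  exact le_antisymm (R.le_of_opD_le hw h1 (fun s => by rw [h2]) t)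
    (R.le_of_opD_le h1 hw (fun s => by rw [h2]) t)

end CharRoots

end NeutralKPP

/-! ### The monotone iteration and its limit -/

namespace NeutralKPP

open MeasureTheory

variable {b τ c l m : ℝ}

noncomputable section

/-- The nonlinearity `F(w) + L w` of the iteration. -/
def opH (b τ c : ℝ) (w : ℝ → ℝ) (t : ℝ) : ℝ := opF b τ c w t + opL b τ c w t

/-- The product form shows monotonicity and the bounds 0 and 1/(1 - b) as soon as (1 - b)Bw takes
values in [0,1]. -/
theorem opH_eq (hb1 : b < 1) (w : ℝ → ℝ) (t : ℝ) :
    opH b τ c w t = (1 - (1 - (1 - b) * opB b τ c w t) *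
      (1 - (1 - b) * opB b τ c w (t - c * τ))) / (1 - b) := by
  have : 1 - b ≠ 0 := by linarith
  rw [opH, opF, opL]
  field_simp
  ring

theorem abs_le_one_of_mem {w : ℝ → ℝ} (hw : ∀ t, w t ∈ Set.Icc (0 : ℝ) 1) (t : ℝ) : |w t| ≤ 1 :=
  abs_le.2 ⟨by linarith [(hw t).1], (hw t).2⟩

theorem mul_opB_mem (hb0 : 0 ≤ b) (hb1 : b < 1) {w : ℝ → ℝ} (hw : ∀ t, w t ∈ Set.Icc (0 : ℝ) 1)
    (t : ℝ) : (1 - b) * opB b τ c w t ∈ Set.Icc (0 : ℝ) 1 := by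
  have h1 := abs_opB_le (τ := τ) (c := c) hb0 hb1 (abs_le_one_of_mem hw) t
  have hb : 0 < 1 - b := by linarith
  refine ⟨mul_nonneg hb.le (opB_nonneg hb0 (fun t => (hw t).1) t), ?_⟩
  rw [le_div_iff₀ hb] at h1
  nlinarith [le_abs_self (opB b τ c w t)]

/-- Two evaluation points are allowed so that the same estimate gives monotonicity in the function
and monotonicity in time. -/
theorem opH_le_opH (hb0 : 0 ≤ b) (hb1 : b < 1) {w v : ℝ → ℝ} (hw : ∀ t, w t ∈ Set.Icc (0 : ℝ) 1)
    (hv : ∀ t, v t ∈ Set.Icc (0 : ℝ) 1) {s t : ℝ} (h1 : opB b τ c w s ≤ opB b τ c v t)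
    (h2 : opB b τ c w (s - c * τ) ≤ opB b τ c v (t - c * τ)) :
    opH b τ c w s ≤ opH b τ c v t := by
  have hb : 0 < 1 - b := by linarith
  rw [opH_eq hb1, opH_eq hb1]
  refine div_le_div_of_nonneg_right ?_ hb.le
  have a1 := (mul_opB_mem (τ := τ) (c := c) hb0 hb1 hv t).2
  have a2 := (mul_opB_mem (τ := τ) (c := c) hb0 hb1 hw (s - c * τ)).2
  have a3 := mul_le_mul_of_nonneg_left h1 hb.le
  have a4 := mul_le_mul_of_nonneg_left h2 hb.le
  have := mul_le_mul (sub_le_sub_left a3 1) (sub_le_sub_left a4 1)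
    (by linarith [(mul_opB_mem (τ := τ) (c := c) hb0 hb1 hv (t - c * τ)).2]) (by linarith)
  linarith

theorem opH_mono (hb0 : 0 ≤ b) (hb1 : b < 1) {w v : ℝ → ℝ} (hw : ∀ t, w t ∈ Set.Icc (0 : ℝ) 1)
    (hv : ∀ t, v t ∈ Set.Icc (0 : ℝ) 1) (hle : ∀ t, w t ≤ v t) (t : ℝ) :
    opH b τ c w t ≤ opH b τ c v t :=
  have h := opB_mono hb0 hb1 (abs_le_one_of_mem hw) (abs_le_one_of_mem hv) hle
  opH_le_opH hb0 hb1 hw hv (h t) (h _)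

theorem monotone_opH (hb0 : 0 ≤ b) (hb1 : b < 1) {w : ℝ → ℝ} (hw : ∀ t, w t ∈ Set.Icc (0 : ℝ) 1)
    (hm : Monotone w) : Monotone (opH b τ c w) := fun s t hst =>
  have h := monotone_opB (τ := τ) (c := c) hb0 hb1 (abs_le_one_of_mem hw) hm
  opH_le_opH hb0 hb1 hw hw (h hst) (h (by linarith))

theorem opH_nonneg (hb0 : 0 ≤ b) (hb1 : b < 1) {w : ℝ → ℝ} (hw : ∀ t, w t ∈ Set.Icc (0 : ℝ) 1)
    (t : ℝ) : 0 ≤ opH b τ c w t := by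
  rw [opH_eq hb1]
  have h1 := mul_opB_mem (τ := τ) (c := c) hb0 hb1 hw t
  have h2 := mul_opB_mem (τ := τ) (c := c) hb0 hb1 hw (t - c * τ)
  refine div_nonneg ?_ (by linarith)
  nlinarith [h1.1, h1.2, h2.1, h2.2]

theorem abs_opH_le (hb0 : 0 ≤ b) (hb1 : b < 1) {w : ℝ → ℝ} (hw : ∀ t, w t ∈ Set.Icc (0 : ℝ) 1)
    (t : ℝ) : |opH b τ c w t| ≤ 1 / (1 - b) := by
  rw [abs_of_nonneg (opH_nonneg hb0 hb1 hw t), opH_eq hb1]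
  have h1 := mul_opB_mem (τ := τ) (c := c) hb0 hb1 hw t
  have h2 := mul_opB_mem (τ := τ) (c := c) hb0 hb1 hw (t - c * τ)
  refine div_le_div_of_nonneg_right ?_ (by linarith)
  nlinarith [h1.1, h1.2, h2.1, h2.2]

theorem continuous_opH (hb0 : 0 ≤ b) (hb1 : b < 1) {w : ℝ → ℝ} (hw : ∀ t, w t ∈ Set.Icc (0 : ℝ) 1)
    (hc : Continuous w) : Continuous (opH b τ c w) := by
  have h1 := continuous_opB (τ := τ) (c := c) hb0 hb1 (abs_le_one_of_mem hw) hc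
  have h2 : Continuous fun t => opB b τ c w (t - c * τ) := h1.comp (continuous_sub_right _)
  have e : opH b τ c w = fun t => _ := funext (opH_eq hb1 w)
  rw [e]
  fun_prop

theorem measurable_opH (hb1 : b < 1) {w : ℝ → ℝ} (hw : Measurable w) :
    Measurable (opH b τ c w) := by
  have h1 := measurable_opB (b := b) (τ := τ) (c := c) hw
  have h2 : Measurable fun t => opB b τ c w (t - c * τ) := h1.comp (measurable_id.sub_const _)
  have e : opH b τ c w = fun t => _ := funext (opH_eq hb1 w)
  rw [e]
  fun_prop

theorem opI_neg (N f : ℝ → ℝ) : opI N (fun s => -f s) = fun t => -opI N f t := by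
  funext t
  simp only [opI, mul_neg, integral_neg]

theorem opI_anti {N f f' : ℝ → ℝ} {C C' : ℝ} (hN : Integrable N) (h0 : ∀ t, N t ≤ 0)
    (hf : Measurable f) (hC : ∀ t, |f t| ≤ C) (hf' : Measurable f') (hC' : ∀ t, |f' t| ≤ C')
    {s t : ℝ} (hle : ∀ x, f (s - x) ≤ f' (t - x)) : opI N f' t ≤ opI N f s := by
  rw [opI_eq_integral, opI_eq_integral]
  exact integral_mono (integrable_mul_comp_sub hN hf' hC' t) (integrable_mul_comp_sub hN hf hC s)
    fun x => mul_le_mul_of_nonpos_left (hle x) (h0 x)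

/-- Dominated convergence with a moving evaluation point: a fixed point gives the limit equation,
and a point going to +∞ gives the equation for the value there. -/
theorem tendsto_opI {α : Type*} {F : Filter α} [F.IsCountablyGenerated] {N : ℝ → ℝ}
    (hN : Integrable N) {W : α → ℝ → ℝ} {C : ℝ} (hW : ∀ i, Measurable (W i))
    (hC : ∀ i t, |W i t| ≤ C) {p : α → ℝ} {k : ℝ → ℝ}
    (hl : ∀ s, Tendsto (fun i => W i (p i - s)) F (𝓝 (k s))) :
    Tendsto (fun i => opI N (W i) (p i)) F (𝓝 (∫ s, N s * k s)) := by
  simp only [opI_eq_integral]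
  refine tendsto_integral_filter_of_dominated_convergence (fun s => |N s| * C)
    (Eventually.of_forall fun i =>
      (integrable_mul_comp_sub hN (hW i) (hC i) (p i)).aestronglyMeasurable)
    (Eventually.of_forall fun i => Eventually.of_forall fun s => ?_) (hN.abs.mul_const C)
    (Eventually.of_forall fun s => (hl s).const_mul _)
  rw [norm_mul]
  exact mul_le_mul_of_nonneg_left (hC _ _) (abs_nonneg _)

theorem IsCb2Off.hasDerivAt {v : ℝ → ℝ} {t₁ : ℝ} (h : IsCb2Off t₁ v) {t : ℝ} (ht : t ≠ t₁) :
    HasDerivAt v (deriv v t) t ∧ HasDerivAt (deriv v) (deriv (deriv v) t) t := by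
  have h1 := h.1
  rw [show (2 : WithTop ℕ∞) = 1 + 1 from rfl, contDiffOn_succ_iff_deriv_of_isOpen
    isOpen_compl_singleton] at h1
  have hn : ({t₁}ᶜ : Set ℝ) ∈ 𝓝 t := isOpen_compl_singleton.mem_nhds ht
  exact ⟨(h1.1.differentiableAt hn).hasDerivAt,
    ((h1.2.2.differentiableOn one_ne_zero).differentiableAt hn).hasDerivAt⟩

theorem IsCb2.continuous_deriv {w : ℝ → ℝ} (h : IsCb2 w) : Continuous (deriv w) :=
  h.1.continuous_deriv (by norm_num)

namespace CharRoots

variable (R : CharRoots b τ c l m)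
include R

/-- Comparison of a function with a concave corner with a smooth one. -/
theorem le_of_corner {v w : ℝ → ℝ} {t₁ jl jr C : ℝ} (hv : Continuous v) (hvC : ∀ t, |v t| ≤ C)
    (hv2 : IsCb2Off t₁ v) (hw : IsCb2 w) (hjl : Tendsto (deriv v) (𝓝[<] t₁) (𝓝 jl))
    (hjr : Tendsto (deriv v) (𝓝[>] t₁) (𝓝 jr)) (hle : jr ≤ jl)
    (hD : ∀ t, t ≠ t₁ → opD b τ c v t ≤ opD b τ c w t) (t : ℝ) : w t ≤ v t := by
  obtain ⟨Cv, hCv⟩ := hv2.2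
  obtain ⟨Cw, hCw⟩ := hw.2
  have hdw := hasDerivAt_deriv_of_contDiff_two hw.1
  have hw' := (hw.continuous_deriv.tendsto t₁)
  have h := R.nonneg_of_opD_nonpos (y := fun t => v t - w t)
    (y' := fun t => deriv v t - deriv w t) (y'' := fun t => deriv (deriv v) t - deriv (deriv w) t)
    (hv.sub hw.1.continuous)
    (fun t => (abs_sub _ _).trans (add_le_add (hvC t) (hCw t).1))
    (fun t ht => (hv2.hasDerivAt ht).1.sub (hdw t).1)
    (fun t ht => (hv2.hasDerivAt ht).2.sub (hdw t).2)
    (fun t ht => (abs_sub _ _).trans (add_le_add (hCv t ht).2.1 (hCw t).2.1))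
    (hjl.sub (hw'.mono_left nhdsWithin_le_nhds)) (hjr.sub (hw'.mono_left nhdsWithin_le_nhds))
    (by linarith) (fun t ht => ?_) t
  · linarith
  · have := hD t ht
    rw [opL, opB_sub R.b_nonneg R.b_lt_one hvC (fun t => (hCw t).1)]
    simp only [opD, opL] at this
    linarith

/-- Comparison of a function with a convex corner with a smooth one. -/
theorem le_of_corner' {v w : ℝ → ℝ} {t₁ jl jr C : ℝ} (hv : Continuous v) (hvC : ∀ t, |v t| ≤ C)
    (hv2 : IsCb2Off t₁ v) (hw : IsCb2 w) (hjl : Tendsto (deriv v) (𝓝[<] t₁) (𝓝 jl))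
    (hjr : Tendsto (deriv v) (𝓝[>] t₁) (𝓝 jr)) (hle : jl ≤ jr)
    (hD : ∀ t, t ≠ t₁ → opD b τ c w t ≤ opD b τ c v t) (t : ℝ) : v t ≤ w t := by
  obtain ⟨Cv, hCv⟩ := hv2.2
  obtain ⟨Cw, hCw⟩ := hw.2
  have hdw := hasDerivAt_deriv_of_contDiff_two hw.1
  have hw' := (hw.continuous_deriv.tendsto t₁)
  have h := R.nonneg_of_opD_nonpos (y := fun t => w t - v t)
    (y' := fun t => deriv w t - deriv v t) (y'' := fun t => deriv (deriv w) t - deriv (deriv v) t)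
    (hw.1.continuous.sub hv)
    (fun t => (abs_sub _ _).trans (add_le_add (hCw t).1 (hvC t)))
    (fun t ht => (hdw t).1.sub (hv2.hasDerivAt ht).1)
    (fun t ht => (hdw t).2.sub (hv2.hasDerivAt ht).2)
    (fun t ht => (abs_sub _ _).trans (add_le_add (hCw t).2.1 (hCv t ht).2.1))
    ((hw'.mono_left nhdsWithin_le_nhds).sub hjl) ((hw'.mono_left nhdsWithin_le_nhds).sub hjr)
    (by linarith) (fun t ht => ?_) t
  · linarith
  · have := hD t ht
    rw [opL, opB_sub R.b_nonneg R.b_lt_one (fun t => (hCw t).1) hvC]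
    simp only [opD, opL] at this
    linarith

end CharRoots

theorem iter_succ (N wp : ℝ → ℝ) (n : ℕ) :
    iter b τ c N wp (n + 1) = fun t => -opI N (opH b τ c (iter b τ c N wp n)) t := rfl

/-- The kernel must invert 𝒟 on constants, and 𝒟1 = -1/(1 - b). -/
theorem IsInverseKernel.integral_eq {N : ℝ → ℝ} (hN : IsInverseKernel b τ c N) (hb0 : 0 ≤ b)
    (hb1 : b < 1) : ∫ s, N s = -(1 - b) := by
  have h := congrFun (hN.left_inv (fun _ => 1) ⟨contDiff_const, 1, fun t => by simp⟩) 0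
  have hb : 1 - b ≠ 0 := by linarith
  have e : opD b τ c (fun _ => 1) = fun _ => -(1 / (1 - b)) := by
    funext t
    rw [opD, opL, opB_const hb0 hb1]
    simp
  rw [e, opI_const] at h
  field_simp at h
  linarith

/-- A smooth fixed point of the iteration connecting `0` and `1` gives a front. -/
theorem isMonotoneFront_of_opD_eq (hb0 : 0 ≤ b) (hb1 : b < 1) {w : ℝ → ℝ} (hw : IsCb2 w)
    (hm : Monotone w) (h0 : Tendsto w atBot (𝓝 0)) (h1 : Tendsto w atTop (𝓝 1))
    (hD : ∀ t, opD b τ c w t = -opH b τ c w t) :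
    IsMonotoneFront b τ c (fun t => (1 - b) * opB b τ c w t) := by
  obtain ⟨C, hC⟩ := hw.2
  have hwC : ∀ t, |w t| ≤ C := fun t => (hC t).1
  have hb : 0 < 1 - b := by linarith
  have e : neutralDiff b τ c (fun t => (1 - b) * opB b τ c w t) = fun t => (1 - b) * w t :=
    neutralDiff_opB hb0 hb1 hwC _
  have hd := hasDerivAt_deriv_of_contDiff_two hw.1
  have e1 : deriv (fun t => (1 - b) * w t) = fun t => (1 - b) * deriv w t :=
    funext fun t => ((hd t).1.const_mul _).deriv
  refine ⟨fun s t hst => mul_le_mul_of_nonneg_left (monotone_opB hb0 hb1 hwC hm hst) hb.le, ?_, ?_,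
    ?_, fun t => ?_⟩
  · simpa using (tendsto_opB_atBot hb0 hb1 hwC h0).const_mul (1 - b)
  · have := (tendsto_opB_atTop (τ := τ) (c := c) hb0 hb1 hwC h1).const_mul (1 - b)
    rwa [mul_one_div_cancel hb.ne'] at this
  · rw [e]; exact contDiff_const.mul hw.1
  · rw [e, e1, ((hd t).2.const_mul _).deriv]
    have := hD t
    simp only [opD, opH, opF, opL] at this ⊢
    linear_combination (1 - b) * this

theorem IsSuperSolution.mem_Icc {w : ℝ → ℝ} (h : IsSuperSolution b τ c w) (t : ℝ) :
    w t ∈ Set.Icc (0 : ℝ) 1 :=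
  ⟨(h.2.1 t).le, h.2.2.1.ge_of_tendsto h.2.2.2.2.1 t⟩

namespace CharRoots

variable (R : CharRoots b τ c l m)
include R

/-- Order is preserved because `opH` is increasing and N ≤ 0. Corners matter only in two
comparisons: w₁ ≤ w₊, and w₋ against each new iterate. Every iterate after w₊ is C². -/
theorem iter_properties {N wm wp : ℝ → ℝ} (hN : IsInverseKernel b τ c N)
    (hm : IsSubSolution b τ c wm) (hp : IsSuperSolution b τ c wp) (hle : ∀ t, wm t ≤ wp t) (n : ℕ) :
    Continuous (iter b τ c N wp n) ∧ Monotone (iter b τ c N wp n) ∧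
      (∀ t, iter b τ c N wp n t ∈ Set.Icc (0 : ℝ) 1) ∧ (∀ t, wm t ≤ iter b τ c N wp n t) ∧
      ∀ t, iter b τ c N wp (n + 1) t ≤ iter b τ c N wp n t := by
  have hb0 := R.b_nonneg
  have hb1 := R.b_lt_one
  have smooth : ∀ w : ℝ → ℝ, Continuous w → (∀ t, w t ∈ Set.Icc (0 : ℝ) 1) →
      IsCb2 (fun t => -opI N (opH b τ c w) t) ∧
        opD b τ c (fun t => -opI N (opH b τ c w) t) = fun t => -opH b τ c w t := by
    intro w hc hw
    rw [← opI_neg]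
    exact hN.right_inv _ ⟨(continuous_opH hb0 hb1 hw hc).neg, 1 / (1 - b), fun t => by
      rw [abs_neg]; exact abs_opH_le hb0 hb1 hw t⟩
  induction n with
  | zero =>
    refine ⟨hp.1, hp.2.2.1, hp.mem_Icc, hle, fun t => ?_⟩
    obtain ⟨h1, h2⟩ := smooth wp hp.1 hp.mem_Icc
    obtain ⟨t₁, hoff, hineq, jl, jr, hjl, hjr, hj⟩ := hp.2.2.2.2.2
    refine R.le_of_corner hp.1 (abs_le_one_of_mem hp.mem_Icc) hoff h1 hjl hjr hj (fun s hs => ?_) t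
    rw [h2]
    have := hineq s hs
    simp only [opD, opH]
    linarith
  | succ n ih =>
    obtain ⟨h1, h2, h3, h4, h5⟩ := ih
    obtain ⟨s1, s2⟩ := smooth _ h1 h3
    have hcont : Continuous (iter b τ c N wp (n + 1)) := s1.1.continuous
    have hmemH : ∀ t, |opH b τ c (iter b τ c N wp n) t| ≤ 1 / (1 - b) := abs_opH_le hb0 hb1 h3
    have hmeasH : Measurable (opH b τ c (iter b τ c N wp n)) :=
      (continuous_opH hb0 hb1 h3 h1).measurable
    have hmem : ∀ t, iter b τ c N wp (n + 1) t ∈ Set.Icc (0 : ℝ) 1 := fun t => by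
      refine ⟨?_, (h5 t).trans (h3 t).2⟩
      rw [iter_succ]
      have := opI_anti (f := fun _ => 0) (C := 0) (s := t) (t := t) hN.integrable hN.nonpos
        measurable_const (by simp) hmeasH hmemH (fun x => opH_nonneg hb0 hb1 h3 _)
      rw [opI_const, mul_zero] at this
      linarith
    refine ⟨hcont, fun s t hst => ?_, hmem, fun t => ?_, fun t => ?_⟩
    · rw [iter_succ]
      exact neg_le_neg (opI_anti hN.integrable hN.nonpos hmeasH hmemH hmeasH hmemH
        fun x => monotone_opH hb0 hb1 h3 h2 (by linarith))
    · have hmm : ∀ t, wm t ∈ Set.Icc (0 : ℝ) 1 := fun t =>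
        ⟨hm.2.1 t, (hle t).trans (hp.mem_Icc t).2⟩
      obtain ⟨t₂, hoff, hineq, jl, jr, hjl, hjr, hj⟩ := hm.2.2.2.2
      refine R.le_of_corner' hm.1 (abs_le_one_of_mem hmm) hoff s1 hjl hjr hj (fun s hs => ?_) t
      rw [s2]
      have a1 := hineq s hs
      have a2 := opH_mono (τ := τ) (c := c) hb0 hb1 hmm h3 h4 s
      simp only [opD]
      have a3 : opH b τ c wm s = opF b τ c wm s + opL b τ c wm s := rfl
      linarith
    · rw [iter_succ, iter_succ (n := n)]
      refine neg_le_neg (opI_anti hN.integrable hN.nonpos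
        (continuous_opH hb0 hb1 hmem hcont).measurable (abs_opH_le hb0 hb1 hmem) hmeasH hmemH
        fun x => opH_mono hb0 hb1 hmem h3 h5 _)

/-- A bounded decreasing sequence converges pointwise, and dominated convergence makes the limit a
fixed point. Regularity is then bootstrapped: monotone, hence measurable, hence continuous, hence
C². The bound by w₊ gives the limit at -∞. -/
theorem exists_front_of_iteration {N wm wp : ℝ → ℝ} (hN : IsInverseKernel b τ c N)
    (hcN : ∀ f : ℝ → ℝ, Measurable f → ∀ C : ℝ, (∀ t, |f t| ≤ C) → Continuous (opI N f))
    (hm : IsSubSolution b τ c wm) (hp : IsSuperSolution b τ c wp) (hle : ∀ t, wm t ≤ wp t) :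
    ∃ φ : ℝ → ℝ, IsMonotoneFront b τ c φ ∧ IterationYields b τ c N wp φ := by
  have hb0 := R.b_nonneg
  have hb1 := R.b_lt_one
  have hb : 0 < 1 - b := by linarith
  have Q := R.iter_properties hN hm hp hle
  set w := iter b τ c N wp with hw
  have hanti : ∀ t, Antitone fun n => w n t := fun t => antitone_nat_of_succ_le fun n =>
    (Q n).2.2.2.2 t
  have hlim : ∀ t, ∃ k, Tendsto (fun n => w n t) atTop (𝓝 k) := fun t =>
    ⟨_, tendsto_atTop_ciInf (hanti t) ⟨0, by rintro _ ⟨n, rfl⟩; exact ((Q n).2.2.1 t).1⟩⟩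
  choose v hv using hlim
  have hvmem : ∀ t, v t ∈ Set.Icc (0 : ℝ) 1 := fun t =>
    isClosed_Icc.mem_of_tendsto (hv t) (Eventually.of_forall fun n => (Q n).2.2.1 t)
  have hvmono : Monotone v := fun s t hst =>
    le_of_tendsto_of_tendsto' (hv s) (hv t) fun n => (Q n).2.1 hst
  have hvle : ∀ t, v t ≤ wp t := fun t => (hanti t).le_of_tendsto (hv t) 0
  have hwmv : ∀ t, wm t ≤ v t := fun t => ge_of_tendsto' (hv t) fun n => (Q n).2.2.2.1 t
  have hvmeas : Measurable v := hvmono.measurable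
  have hBlim : ∀ t, Tendsto (fun n => opB b τ c (w n) t) atTop (𝓝 (opB b τ c v t)) := fun t =>
    tendsto_opB hb0 hb1 (s := fun _ => t) (fun n => abs_le_one_of_mem (Q n).2.2.1) fun j => hv _
  have hHlim : ∀ t, Tendsto (fun n => opH b τ c (w n) t) atTop (𝓝 (opH b τ c v t)) := fun t => by
    simp only [opH_eq hb1]
    exact (tendsto_const_nhds.sub ((tendsto_const_nhds.sub ((hBlim t).const_mul _)).mul
      (tendsto_const_nhds.sub ((hBlim _).const_mul _)))).div_const _
  have hfix : ∀ t, v t = -opI N (opH b τ c v) t := by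
    intro t
    have h1 := tendsto_opI hN.integrable (F := atTop) (W := fun n => opH b τ c (w n))
      (p := fun _ => t) (fun n => (continuous_opH hb0 hb1 (Q n).2.2.1 (Q n).1).measurable)
      (fun n => abs_opH_le hb0 hb1 (Q n).2.2.1) (fun s => hHlim (t - s))
    rw [← opI_eq_integral] at h1
    exact tendsto_nhds_unique ((hv t).comp (tendsto_add_atTop_nat 1)) h1.neg
  have hHv := abs_opH_le (τ := τ) (c := c) hb0 hb1 hvmem
  have hHm := measurable_opH (τ := τ) (c := c) hb1 hvmeas
  have hfix' : v = fun t => -opI N (opH b τ c v) t := funext hfix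
  have hvc : Continuous v := by
    rw [hfix']
    exact (hcN _ hHm _ hHv).neg
  have hsm : IsCb2 v ∧ opD b τ c v = fun t => -opH b τ c v t := by
    have := hN.right_inv (fun t => -opH b τ c v t) ⟨(continuous_opH hb0 hb1 hvmem hvc).neg,
      1 / (1 - b), fun t => by rw [abs_neg]; exact hHv t⟩
    rwa [opI_neg, ← hfix'] at this
  have hbot : Tendsto v atBot (𝓝 0) :=
    squeeze_zero (fun t => (hvmem t).1) hvle hp.2.2.2.1
  have htop : Tendsto v atTop (𝓝 1) := by
    have hk : Tendsto v atTop (𝓝 (⨆ t, v t)) :=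
      tendsto_atTop_ciSup hvmono ⟨1, by rintro _ ⟨t, rfl⟩; exact (hvmem t).2⟩
    set k := ⨆ t, v t
    have hB := tendsto_opB_atTop (τ := τ) (c := c) hb0 hb1 (abs_le_one_of_mem hvmem) hk
    have hB' : Tendsto (fun t => opB b τ c v (t - c * τ)) atTop (𝓝 (k / (1 - b))) :=
      hB.comp (tendsto_atTop_add_const_right atTop (-(c * τ)) tendsto_id)
    have hH : Tendsto (opH b τ c v) atTop (𝓝 ((1 - (1 - k) * (1 - k)) / (1 - b))) := by
      have e : opH b τ c v = fun t => _ := funext (opH_eq hb1 v)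
      rw [e]
      have := (tendsto_const_nhds (x := (1 : ℝ)).sub ((tendsto_const_nhds (x := (1 : ℝ)).sub
        (hB.const_mul (1 - b))).mul (tendsto_const_nhds (x := (1 : ℝ)).sub
        (hB'.const_mul (1 - b))))).div_const (1 - b)
      rwa [mul_div_cancel₀ _ hb.ne'] at this
    have h1 := tendsto_opI hN.integrable (F := atTop) (W := fun _ : ℝ => opH b τ c v)
      (p := id) (fun _ => hHm) (fun _ => hHv)
      (fun s => hH.comp (tendsto_atTop_add_const_right atTop (-s) tendsto_id))
    rw [integral_mul_const, hN.integral_eq hb0 hb1] at h1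
    have h2 : Tendsto v atTop (𝓝 (-(-(1 - b) * ((1 - (1 - k) * (1 - k)) / (1 - b))))) := by
      conv in v => rw [hfix']
      exact h1.neg
    have h3 := tendsto_nhds_unique hk h2
    -- Passing to the limit in the fixed point equation with ∫N = -(1 - b) leaves only k = 0 or k =
    -- 1. A non-negative non-constant w₋ below v forces k > 0.
    have h4 : k = 1 - (1 - k) * (1 - k) := by
      field_simp at h3
      linarith
    have hkpos : 0 < k := by
      obtain ⟨s, t, hst⟩ := hm.2.2.1
      have hge : ∀ t, v t ≤ k := fun t => hvmono.ge_of_tendsto hk t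
      rcases lt_or_gt_of_ne hst with h | h
      · linarith [hm.2.1 s, hwmv t, hge t]
      · linarith [hm.2.1 t, hwmv s, hge s]
    have h5 : k = 1 := by
      have : k * (k - 1) = 0 := by linear_combination h4
      rcases mul_eq_zero.1 this with h | h <;> linarith
    rwa [h5] at hk
  have hfront := isMonotoneFront_of_opD_eq hb0 hb1 hsm.1 hvmono hbot htop fun t => congrFun hsm.2 t
  refine ⟨_, hfront, fun n => (Q n).2.1, hanti, fun t => ?_, fun t => (hBlim t).const_mul _⟩
  rw [neutralDiff_opB hb0 hb1 (abs_le_one_of_mem hvmem), mul_div_cancel_left₀ _ hb.ne']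
  exact hv t

end CharRoots

end

end NeutralKPP

/-! ### A priori properties of a monotone front -/

namespace NeutralKPP

variable {b τ c : ℝ}

/-- If f converges, these points go to infinity and f' tends to 0 along them. The next three lemmas
use this to contradict one-sided bounds on f' without proving that f' itself converges. -/
theorem exists_mean_value_points {f f' : ℝ → ℝ} (hf : ∀ t, HasDerivAt f (f' t) t) :
    ∃ ξ : ℝ → ℝ, (∀ s, s - 1 < ξ s ∧ ξ s < s) ∧ ∀ s, f' (ξ s) = f s - f (s - 1) := by
  have h : ∀ s : ℝ, ∃ x, (s - 1 < x ∧ x < s) ∧ f' x = f s - f (s - 1) := by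
    intro s
    obtain ⟨x, hx, hx'⟩ := exists_hasDerivAt_eq_slope f f' (by linarith : s - 1 < s)
      (fun t _ => (hf t).continuousAt.continuousWithinAt) (fun t _ => hf t)
    exact ⟨x, hx, by rw [hx']; simp⟩
  choose ξ h1 h2 using h
  exact ⟨ξ, h1, h2⟩

theorem add_le_zero_of_le_deriv_atBot {f f' k : ℝ → ℝ} {ℓ κ x t₀ : ℝ}
    (hf : ∀ t, HasDerivAt f (f' t) t) (hl : Tendsto f atBot (𝓝 ℓ)) (hk : Tendsto k atBot (𝓝 κ))
    (h : ∀ s ≤ t₀, x + k s ≤ f' s) : x + κ ≤ 0 := by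
  obtain ⟨ξ, h1, h2⟩ := exists_mean_value_points hf
  have hξ : Tendsto ξ atBot atBot := tendsto_atBot_mono (fun s => (h1 s).2.le) tendsto_id
  have a1 : Tendsto (fun s => f s - f (s - 1)) atBot (𝓝 (ℓ - ℓ)) :=
    hl.sub (hl.comp (tendsto_atBot_add_const_right atBot (-1) tendsto_id))
  rw [sub_self] at a1
  refine le_of_tendsto_of_tendsto ((hk.comp hξ).const_add x) a1 ?_
  filter_upwards [eventually_le_atBot t₀] with s hs
  rw [← h2 s]
  exact h _ ((h1 s).2.le.trans hs)

theorem add_le_zero_of_le_deriv_atTop {f f' k : ℝ → ℝ} {ℓ κ x t₀ : ℝ}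
    (hf : ∀ t, HasDerivAt f (f' t) t) (hl : Tendsto f atTop (𝓝 ℓ)) (hk : Tendsto k atTop (𝓝 κ))
    (h : ∀ s, t₀ ≤ s → x + k s ≤ f' s) : x + κ ≤ 0 := by
  obtain ⟨ξ, h1, h2⟩ := exists_mean_value_points hf
  have hsub : Tendsto (fun s : ℝ => s - 1) atTop atTop :=
    tendsto_atTop_add_const_right atTop (-1) tendsto_id
  have hξ : Tendsto ξ atTop atTop := tendsto_atTop_mono (fun s => (h1 s).1.le) hsub
  have a1 : Tendsto (fun s => f s - f (s - 1)) atTop (𝓝 (ℓ - ℓ)) := hl.sub (hl.comp hsub)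
  rw [sub_self] at a1
  refine le_of_tendsto_of_tendsto ((hk.comp hξ).const_add x) a1 ?_
  filter_upwards [eventually_ge_atTop (t₀ + 1)] with s hs
  rw [← h2 s]
  exact h _ (by linarith [(h1 s).1])

theorem zero_le_add_of_deriv_le_atTop {f f' k : ℝ → ℝ} {ℓ κ x t₀ : ℝ}
    (hf : ∀ t, HasDerivAt f (f' t) t) (hl : Tendsto f atTop (𝓝 ℓ)) (hk : Tendsto k atTop (𝓝 κ))
    (h : ∀ s, t₀ ≤ s → f' s ≤ x + k s) : 0 ≤ x + κ := by
  have := add_le_zero_of_le_deriv_atTop (f := fun t => -f t) (f' := fun t => -f' t)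
    (k := fun t => -k t) (x := -x) (t₀ := t₀) (fun t => (hf t).neg) hl.neg hk.neg
    fun s hs => by linarith [h s hs]
  linarith

theorem antitone_of_hasDerivAt_nonpos {f f' : ℝ → ℝ} (hd : ∀ t, HasDerivAt f (f' t) t)
    (h0 : ∀ t, f' t ≤ 0) : Antitone f :=
  antitone_of_deriv_nonpos (fun t => (hd t).differentiableAt)
    fun t => by rw [(hd t).deriv]; exact h0 t

theorem antitoneOn_Iic_of_hasDerivAt_nonpos {f f' : ℝ → ℝ} {T : ℝ}
    (hd : ∀ t, HasDerivAt f (f' t) t) (h0 : ∀ t ≤ T, f' t ≤ 0) : AntitoneOn f (Set.Iic T) :=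
  antitoneOn_of_hasDerivAt_nonpos (convex_Iic T)
    (fun t _ => (hd t).continuousAt.continuousWithinAt) (fun t _ => hd t)
    fun t ht => h0 t (by rw [interior_Iic] at ht; exact le_of_lt ht)

theorem antitoneOn_Ici_of_hasDerivAt_nonpos {f f' : ℝ → ℝ} {T : ℝ}
    (hd : ∀ t, HasDerivAt f (f' t) t) (h0 : ∀ t, T ≤ t → f' t ≤ 0) : AntitoneOn f (Set.Ici T) :=
  antitoneOn_of_hasDerivAt_nonpos (convex_Ici T)
    (fun t _ => (hd t).continuousAt.continuousWithinAt) (fun t _ => hd t)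
    fun t ht => h0 t (by rw [interior_Ici] at ht; exact le_of_lt ht)

theorem monotoneOn_Ici_of_hasDerivAt_nonneg {f f' : ℝ → ℝ} {T : ℝ}
    (hd : ∀ t, HasDerivAt f (f' t) t) (h0 : ∀ t, T ≤ t → 0 ≤ f' t) : MonotoneOn f (Set.Ici T) :=
  monotoneOn_of_hasDerivAt_nonneg (convex_Ici T)
    (fun t _ => (hd t).continuousAt.continuousWithinAt) (fun t _ => hd t)
    fun t ht => h0 t (by rw [interior_Ici] at ht; exact le_of_lt ht)

namespace IsMonotoneFront

variable {φ : ℝ → ℝ} (F : IsMonotoneFront b τ c φ)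
include F

theorem mem_Icc (t : ℝ) : φ t ∈ Set.Icc (0 : ℝ) 1 :=
  ⟨F.mono.le_of_tendsto F.bot t, F.mono.ge_of_tendsto F.top t⟩

theorem tendsto_shift_atTop : Tendsto (fun t => φ (t - c * τ)) atTop (𝓝 1) :=
  F.top.comp (tendsto_atTop_add_const_right atTop (-(c * τ)) tendsto_id)

theorem tendsto_shift_atBot : Tendsto (fun t => φ (t - c * τ)) atBot (𝓝 0) :=
  F.bot.comp (tendsto_atBot_add_const_right atBot (-(c * τ)) tendsto_id)

theorem tendsto_neutralDiff_atTop : Tendsto (neutralDiff b τ c φ) atTop (𝓝 (1 - b)) := by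
  have h := F.top.sub (F.tendsto_shift_atTop.const_mul b)
  rwa [mul_one] at h

theorem tendsto_neutralDiff_atBot : Tendsto (neutralDiff b τ c φ) atBot (𝓝 0) := by
  have h := F.bot.sub (F.tendsto_shift_atBot.const_mul b)
  rwa [mul_zero, sub_zero] at h

theorem hasDerivAt (t : ℝ) :
    HasDerivAt (neutralDiff b τ c φ) (deriv (neutralDiff b τ c φ) t) t :=
  (hasDerivAt_deriv_of_contDiff_two F.smooth t).1

theorem hasDerivAt_deriv (t : ℝ) :
    HasDerivAt (deriv (neutralDiff b τ c φ))
      (c * deriv (neutralDiff b τ c φ) t + -(φ t * (1 - φ (t - c * τ)))) t :=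
  (hasDerivAt_deriv_of_contDiff_two F.smooth t).2.congr_deriv (by linarith [F.eq t])

theorem reaction_nonneg (t : ℝ) : 0 ≤ φ t * (1 - φ (t - c * τ)) :=
  mul_nonneg (F.mem_Icc t).1 (by linarith [(F.mem_Icc (t - c * τ)).2])

theorem antitone_flux :
    Antitone fun t => deriv (neutralDiff b τ c φ) t - c * neutralDiff b τ c φ t :=
  antitone_of_hasDerivAt_nonpos
    (fun t => (F.hasDerivAt_deriv t).sub ((F.hasDerivAt t).const_mul c))
    fun t => by linarith [F.reaction_nonneg t]

/-- The flux v' - cv is decreasing. A positive value at t would bound it below by that value on (-∞,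
t], making v' stay away from 0 while v → 0. -/
theorem deriv_le (t : ℝ) : deriv (neutralDiff b τ c φ) t ≤ c * neutralDiff b τ c φ t := by
  have := add_le_zero_of_le_deriv_atBot (k := fun s => c * neutralDiff b τ c φ s)
    (x := deriv (neutralDiff b τ c φ) t - c * neutralDiff b τ c φ t) (t₀ := t) F.hasDerivAt
    F.tendsto_neutralDiff_atBot (F.tendsto_neutralDiff_atBot.const_mul c)
    fun s hs => by linarith [F.antitone_flux hs]
  linarith

/-- The flux lies between -c(1 - b) and 0, its values suggested by the two ends. This excludes c <
0, and for c = 0 it makes v constant despite distinct limits. -/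
theorem speed_pos (hb1 : b < 1) : 0 < c := by
  have h1 : ∀ t, 0 ≤ deriv (neutralDiff b τ c φ) t - c * neutralDiff b τ c φ t + c * (1 - b) :=
    fun t => zero_le_add_of_deriv_le_atTop (k := fun s => c * neutralDiff b τ c φ s) (t₀ := t)
      F.hasDerivAt F.tendsto_neutralDiff_atTop (F.tendsto_neutralDiff_atTop.const_mul c)
      fun s hs => by linarith [F.antitone_flux hs]
  rcases lt_trichotomy c 0 with h | h | h
  · have := h1 0
    have := F.deriv_le 0
    nlinarith
  · have hd : ∀ t, HasDerivAt (neutralDiff b τ c φ) 0 t := fun t => by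
      have a1 := h1 t
      have a2 := F.deriv_le t
      have a3 := F.hasDerivAt t
      have e : deriv (neutralDiff b τ c φ) t = 0 := by
        have e1 : c * neutralDiff b τ c φ t = 0 := by rw [h, zero_mul]
        have e2 : c * (1 - b) = 0 := by rw [h, zero_mul]
        linarith
      rwa [e] at a3
    have hconst : ∀ t, neutralDiff b τ c φ t = neutralDiff b τ c φ 0 := fun t =>
      is_const_of_deriv_eq_zero (fun t => (hd t).differentiableAt) (fun t => (hd t).deriv) t 0
    have e : neutralDiff b τ c φ = fun _ => neutralDiff b τ c φ 0 := funext hconst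
    have l1 := F.tendsto_neutralDiff_atBot
    have l2 := F.tendsto_neutralDiff_atTop
    rw [e] at l1 l2
    have := tendsto_nhds_unique l1 tendsto_const_nhds
    have := tendsto_nhds_unique l2 tendsto_const_nhds
    linarith
  · exact h

theorem mul_le_neutralDiff (hb0 : 0 ≤ b) (hh : 0 ≤ c * τ) (t : ℝ) :
    (1 - b) * φ t ≤ neutralDiff b τ c φ t := by
  have : φ (t - c * τ) ≤ φ t := F.mono (by linarith)
  rw [neutralDiff]
  nlinarith

theorem antitone_exp_mul :
    Antitone fun t => Real.exp (-c * t) * neutralDiff b τ c φ t :=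
  antitone_of_hasDerivAt_nonpos
    (fun t => hasDerivAt_exp_mul_mul (r := deriv (neutralDiff b τ c φ) t - c * neutralDiff b τ c φ t)
      ((F.hasDerivAt t).congr_deriv (by ring)))
    fun t => mul_nonpos_of_nonneg_of_nonpos (Real.exp_pos _).le (by linarith [F.deriv_le t])

/-- A zero of φ makes φ vanish to its left, so v vanishes there. Since e^{-ct}v is decreasing, v
stays non-positive afterwards, against v → 1 - b. -/
theorem pos (hb1 : b < 1) (hh : 0 ≤ c * τ) (t : ℝ) : 0 < φ t := by
  by_contra hcon
  have h0 : ∀ s ≤ t, φ s = 0 := fun s hs =>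
    le_antisymm ((F.mono hs).trans (not_lt.1 hcon)) (F.mem_Icc s).1
  have hv : neutralDiff b τ c φ t = 0 := by
    rw [neutralDiff, h0 t le_rfl, h0 _ (by linarith)]; ring
  have h1 : ∀ s, t ≤ s → neutralDiff b τ c φ s ≤ 0 := fun s hs => by
    have := F.antitone_exp_mul hs
    simp only [hv, mul_zero] at this
    exact nonpos_of_mul_nonpos_right this (Real.exp_pos _)
  have := le_of_tendsto F.tendsto_neutralDiff_atTop ((eventually_ge_atTop t).mono h1)
  linarith

theorem neutralDiff_pos (hb0 : 0 ≤ b) (hb1 : b < 1) (hh : 0 ≤ c * τ) (t : ℝ) :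
    0 < neutralDiff b τ c φ t :=
  (mul_pos (by linarith) (F.pos hb1 hh t)).trans_le (F.mul_le_neutralDiff hb0 hh t)

/-- e^{-ct}v' is decreasing. For c ≥ 0, a negative value of v' would therefore persist with at least
the same size up to +∞, and v could not converge. -/
theorem deriv_nonneg (hc : 0 ≤ c) (t : ℝ) : 0 ≤ deriv (neutralDiff b τ c φ) t := by
  have hanti : Antitone fun t => Real.exp (-c * t) * deriv (neutralDiff b τ c φ) t :=
    antitone_of_hasDerivAt_nonpos (fun t => hasDerivAt_exp_mul_mul (F.hasDerivAt_deriv t))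
      fun t => mul_nonpos_of_nonneg_of_nonpos (Real.exp_pos _).le
        (by linarith [F.reaction_nonneg t])
  by_contra hcon
  rw [not_le] at hcon
  have := zero_le_add_of_deriv_le_atTop (k := fun _ => 0)
    (x := deriv (neutralDiff b τ c φ) t) (t₀ := t) F.hasDerivAt F.tendsto_neutralDiff_atTop
    tendsto_const_nhds fun s hs => by
      have h1 : Real.exp (-c * s) * deriv (neutralDiff b τ c φ) s
        ≤ Real.exp (-c * t) * deriv (neutralDiff b τ c φ) t := hanti hs
      have h2 : Real.exp (-c * s) ≤ Real.exp (-c * t) := Real.exp_le_exp.2 (by nlinarith)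
      have h3 : Real.exp (-c * t) * deriv (neutralDiff b τ c φ) t
        ≤ Real.exp (-c * s) * deriv (neutralDiff b τ c φ) t :=
        mul_le_mul_of_nonpos_right h2 hcon.le
      have := le_of_mul_le_mul_left (h1.trans h3) (Real.exp_pos _)
      linarith
  linarith

theorem monotone_neutralDiff (hc : 0 ≤ c) : Monotone (neutralDiff b τ c φ) :=
  monotone_of_deriv_nonneg (fun t => (F.hasDerivAt t).differentiableAt) (F.deriv_nonneg hc)

theorem neutralDiff_le (hc : 0 ≤ c) (t : ℝ) : neutralDiff b τ c φ t ≤ 1 - b :=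
  (F.monotone_neutralDiff hc).ge_of_tendsto F.tendsto_neutralDiff_atTop t

/-- If v reaches 1 - b at t, it is constant from t on. The equation then gives φ = 1 beyond t - cτ,
which makes v reach 1 - b already at t - cτ. Repetition contradicts v(-∞) = 0. -/
theorem neutralDiff_lt (hb0 : 0 ≤ b) (hb1 : b < 1) (hc : 0 ≤ c) (hh : 0 < c * τ) (t : ℝ) :
    neutralDiff b τ c φ t < 1 - b := by
  by_contra hcon
  rw [not_lt] at hcon
  have step : ∀ t, 1 - b ≤ neutralDiff b τ c φ t → 1 - b ≤ neutralDiff b τ c φ (t - c * τ) := by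
    intro t ht
    have hconst : ∀ s, t ≤ s → neutralDiff b τ c φ s = 1 - b := fun s hs =>
      le_antisymm (F.neutralDiff_le hc s) (ht.trans (F.monotone_neutralDiff hc hs))
    have hone : ∀ s, t < s → φ (s - c * τ) = 1 := by
      intro s hs
      have e0 : neutralDiff b τ c φ =ᶠ[𝓝 s] fun _ => 1 - b :=
        (eventually_gt_nhds hs).mono fun x hx => hconst x hx.le
      have e1 : deriv (neutralDiff b τ c φ) =ᶠ[𝓝 s] fun _ => 0 := by
        simpa using e0.deriv
      have e2 := e1.deriv_eq
      have := F.eq s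
      rw [e2, e1.eq_of_nhds] at this
      simp only [deriv_const, mul_zero, sub_zero, zero_add] at this
      rcases mul_eq_zero.1 this with h | h
      · exact absurd h (F.pos hb1 hh.le s).ne'
      · linarith
    have hge : ∀ s, t - c * τ < s → 1 - b ≤ neutralDiff b τ c φ s := fun s hs => by
      have h1 := hone (s + c * τ) (by linarith)
      rw [add_sub_cancel_right] at h1
      rw [neutralDiff, h1]
      nlinarith [(F.mem_Icc (s - c * τ)).2]
    have hcl : Tendsto (neutralDiff b τ c φ) (𝓝[>] (t - c * τ))
        (𝓝 (neutralDiff b τ c φ (t - c * τ))) :=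
      (F.hasDerivAt _).continuousAt.tendsto.mono_left nhdsWithin_le_nhds
    exact ge_of_tendsto hcl (eventually_nhdsWithin_of_forall hge)
  have hall : ∀ n : ℕ, 1 - b ≤ neutralDiff b τ c φ (t - n * (c * τ)) := by
    intro n
    induction n with
    | zero => simpa using hcon
    | succ n ih =>
      have := step _ ih
      have e : t - (n : ℝ) * (c * τ) - c * τ = t - ((n + 1 : ℕ) : ℝ) * (c * τ) := by
        push_cast; ring
      rwa [e] at this
  have hlim : Tendsto (fun n : ℕ => t - (n : ℝ) * (c * τ)) atTop atBot :=
    tendsto_atBot_add_const_left atTop t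
      (tendsto_neg_atTop_atBot.comp (tendsto_natCast_atTop_atTop.atTop_mul_const hh))
  have := ge_of_tendsto' (F.tendsto_neutralDiff_atBot.comp hlim) hall
  linarith

theorem abs_le (t : ℝ) : |φ t| ≤ 1 := abs_le_one_of_mem F.mem_Icc t

theorem opB_neutralDiff (hb0 : 0 ≤ b) (hb1 : b < 1) (t : ℝ) :
    opB b τ c (neutralDiff b τ c φ) t = φ t :=
  NeutralKPP.opB_neutralDiff hb0 hb1 F.abs_le t

theorem abs_neutralDiff_le (hb0 : 0 ≤ b) (hb1 : b < 1) (hc : 0 ≤ c) (hh : 0 ≤ c * τ) (t : ℝ) :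
    |neutralDiff b τ c φ t| ≤ 1 := by
  rw [abs_of_pos (F.neutralDiff_pos hb0 hb1 hh t)]
  linarith [F.neutralDiff_le hc t]

end IsMonotoneFront

end NeutralKPP

/-! ### Necessity: zeros of χ₀ and χ₁ from the tails of a front -/

namespace NeutralKPP

variable {b τ c : ℝ}

theorem mul_exp_neg_le (hb0 : 0 ≤ b) (hh : 0 ≤ c * τ) {z : ℝ} (hz : 0 ≤ z) :
    b * Real.exp (-(z * c * τ)) ≤ b := by
  have : Real.exp (-(z * c * τ)) ≤ 1 := Real.exp_le_one_iff.2 (by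
    rw [mul_assoc]; linarith [mul_nonneg hz hh])
  nlinarith

theorem continuousOn_chi0 (hb0 : 0 ≤ b) (hb1 : b < 1) (hh : 0 ≤ c * τ) :
    ContinuousOn (chi0 b τ c) (Set.Ici 0) := by
  unfold chi0
  refine ContinuousOn.add (by fun_prop) (ContinuousOn.div (by fun_prop) (by fun_prop) fun z hz => ?_)
  have := mul_exp_neg_le hb0 hh (z := z) hz
  linarith

theorem chi0_zero : chi0 b τ c 0 = 1 / (1 - b) := by simp [chi0]

theorem chi1_zero : chi1 b τ c 0 = -(1 / (1 - b)) := by simp [chi1]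

namespace IsMonotoneFront

variable {φ : ℝ → ℝ} (F : IsMonotoneFront b τ c φ)
include F

/-- The linearization at `0`, with its last coefficient lowered to `a < 1`, is non-positive at some
exponent in `(0, c]`: the infimum of all `k` with `v' ≤ k v` near `-∞`. -/
theorem exists_exponent (hb0 : 0 ≤ b) (hb1 : b < 1) (hh : 0 < c * τ) {a : ℝ} (ha0 : 0 < a)
    (ha1 : a < 1) :
    ∃ k, 0 < k ∧ k ≤ c ∧ k ^ 2 - c * k + a / (1 - b * Real.exp (-(k * c * τ))) ≤ 0 := by
  set v := neutralDiff b τ c φ with hv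
  have hc := (F.speed_pos hb1).le
  have hpos : ∀ t, 0 < v t := F.neutralDiff_pos hb0 hb1 hh.le
  have hd : ∀ t, HasDerivAt v (deriv v t) t := F.hasDerivAt
  -- To the left of T the reaction term is at least aφ, so the equation becomes a linear inequality.
  obtain ⟨T, hT⟩ : ∃ T, ∀ t ≤ T, φ (t - c * τ) ≤ 1 - a :=
    eventually_atBot.1 (F.tendsto_shift_atBot.eventually_le_const (by linarith : (0 : ℝ) < 1 - a))
  let S : Set ℝ := {k | ∀ t ≤ T, deriv v t ≤ k * v t}
  have hcS : c ∈ S := fun t _ => F.deriv_le t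
  have hSpos : ∀ k ∈ S, 0 < k := by
    intro k hk
    by_contra hcon
    have h0 : AntitoneOn v (Set.Iic T) := antitoneOn_Iic_of_hasDerivAt_nonpos hd fun t ht =>
      (hk t ht).trans (mul_nonpos_of_nonpos_of_nonneg (not_lt.1 hcon) (hpos t).le)
    have : v T ≤ 0 := ge_of_tendsto F.tendsto_neutralDiff_atBot
      ((eventually_le_atBot T).mono fun s hs => h0 hs (Set.mem_Iic.2 le_rfl) hs)
    linarith [hpos T]
  -- If v' ≤ kv, then e^{-kt}v decreases, so the series for φ = Bv gives φ ≥ v/D with D = 1 -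
  -- be^{-kcτ}. Inserting this into the equation improves the bound to v' ≤ (c - a/(kD))v. At the
  -- infimum, k ≤ c - a/(kD), which is the claim.
  have hstep : ∀ k ∈ S, c - a / (k * (1 - b * Real.exp (-(k * c * τ)))) ∈ S := by
    intro k hk
    have hk0 := hSpos k hk
    have hconv : b * Real.exp (-(k * c * τ)) < 1 := (mul_exp_neg_le hb0 hh.le hk0.le).trans_lt hb1
    set D := 1 - b * Real.exp (-(k * c * τ)) with hD
    have hD0 : 0 < D := by linarith
    set κ := a / (k * D) with hκ
    have hκ0 : 0 < κ := by positivity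
    have hexp : AntitoneOn (fun t => Real.exp (-k * t) * v t) (Set.Iic T) :=
      antitoneOn_Iic_of_hasDerivAt_nonpos
        (fun t => hasDerivAt_exp_mul_mul (r := deriv v t - k * v t)
          ((hd t).congr_deriv (by ring)))
        fun t ht => mul_nonpos_of_nonneg_of_nonpos (Real.exp_pos _).le (by linarith [hk t ht])
    have hφ : ∀ t ≤ T, v t / D ≤ φ t := by
      intro t ht
      rw [← F.opB_neutralDiff hb0 hb1 t]
      have h1 := (hasSum_opB_exp hb0 hconv t).mul_left (Real.exp (-k * t) * v t)
      have e : Real.exp (-k * t) * Real.exp (k * t) = 1 := by rw [← Real.exp_add]; simp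
      have e1 : Real.exp (-k * t) * v t * (Real.exp (k * t) / D) = v t / D := by
        linear_combination (v t / D) * e
      rw [e1] at h1
      refine hasSum_le (fun j => ?_) h1
        (summable_opB hb0 hb1 (F.abs_neutralDiff_le hb0 hb1 hc hh.le) t).hasSum
      rw [← mul_assoc, mul_comm _ (b ^ j), mul_assoc]
      refine mul_le_mul_of_nonneg_left ?_ (pow_nonneg hb0 j)
      set x := t - j * (c * τ)
      have hx : x ≤ t := by
        have : 0 ≤ (j : ℝ) * (c * τ) := by positivity
        simp only [x]; linarith
      have h2 : Real.exp (-k * t) * v t ≤ Real.exp (-k * x) * v x :=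
        hexp (Set.mem_Iic.2 (hx.trans ht)) (Set.mem_Iic.2 ht) hx
      have e2 : Real.exp (-k * x) * Real.exp (k * x) = 1 := by rw [← Real.exp_add]; simp
      calc Real.exp (-k * t) * v t * Real.exp (k * x)
          ≤ Real.exp (-k * x) * v x * Real.exp (k * x) :=
            mul_le_mul_of_nonneg_right h2 (Real.exp_pos _).le
        _ = v x := by linear_combination (v x) * e2
    have hX : AntitoneOn (fun t => deriv v t - (c - κ) * v t) (Set.Iic T) := by
      refine antitoneOn_Iic_of_hasDerivAt_nonpos
        (fun t => (F.hasDerivAt_deriv t).sub ((hd t).const_mul (c - κ))) fun t ht => ?_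
      have h1 : a * φ t ≤ φ t * (1 - φ (t - c * τ)) := by
        nlinarith [hT t ht, (F.mem_Icc t).1]
      have h2 : κ * deriv v t ≤ κ * (k * v t) := mul_le_mul_of_nonneg_left (hk t ht) hκ0.le
      have h3 : κ * (k * v t) = a * (v t / D) := by
        rw [hκ]; field_simp
      have h4 := mul_le_mul_of_nonneg_left (hφ t ht) ha0.le
      change c * deriv v t + -(φ t * (1 - φ (t - c * τ))) - (c - κ) * deriv v t ≤ 0
      linarith
    intro t ht
    have := add_le_zero_of_le_deriv_atBot (k := fun s => (c - κ) * v s)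
      (x := deriv v t - (c - κ) * v t) (t₀ := t) hd F.tendsto_neutralDiff_atBot
      (F.tendsto_neutralDiff_atBot.const_mul (c - κ)) fun s hs => by
        have : deriv v t - (c - κ) * v t ≤ deriv v s - (c - κ) * v s :=
          hX (Set.mem_Iic.2 (hs.trans ht)) (Set.mem_Iic.2 ht) hs
        linarith
    linarith
  have hbdd : BddBelow S := ⟨0, fun k hk => (hSpos k hk).le⟩
  have hmem : sInf S ∈ S := by
    intro t ht
    rw [← div_le_iff₀ (hpos t)]
    exact le_csInf ⟨c, hcS⟩ fun k hk => by
      rw [div_le_iff₀ (hpos t)]; exact hk t ht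
  set k := sInf S
  have hk0 := hSpos k hmem
  have hconv : b * Real.exp (-(k * c * τ)) < 1 := (mul_exp_neg_le hb0 hh.le hk0.le).trans_lt hb1
  have hD0 : 0 < 1 - b * Real.exp (-(k * c * τ)) := by linarith
  refine ⟨k, hk0, csInf_le hbdd hcS, ?_⟩
  have h1 := csInf_le hbdd (hstep k hmem)
  have h2 : k * (a / (k * (1 - b * Real.exp (-(k * c * τ)))))
      = a / (1 - b * Real.exp (-(k * c * τ))) := by field_simp
  have h3 := mul_le_mul_of_nonneg_left h1 hk0.le
  rw [mul_sub, h2] at h3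
  nlinarith

theorem exists_zero_chi0 (hb0 : 0 ≤ b) (hb1 : b < 1) (hh : 0 < c * τ) :
    ∃ z, 0 < z ∧ 1 - b * Real.exp (-(z * c * τ)) ≠ 0 ∧ chi0 b τ c z = 0 := by
  have hb : 0 < 1 - b := by linarith
  have hc := (F.speed_pos hb1).le
  have h00 : 0 < chi0 b τ c 0 := by rw [chi0_zero]; positivity
  suffices h : ∃ z, 0 ≤ z ∧ chi0 b τ c z ≤ 0 by
    obtain ⟨z, hz0, hz⟩ := h
    obtain ⟨x, hx, hx0⟩ := intermediate_value_Icc' hz0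
      ((continuousOn_chi0 hb0 hb1 hh.le).mono Set.Icc_subset_Ici_self) ⟨hz, h00.le⟩
    have hxp : 0 < x := lt_of_le_of_ne hx.1 fun h => by rw [← h] at hx0; linarith
    have := mul_exp_neg_le hb0 hh.le hxp.le
    exact ⟨x, hxp, by linarith, hx0⟩
  by_contra hcon
  push Not at hcon
  obtain ⟨x, hx, hmin⟩ := isCompact_Icc.exists_isMinOn (Set.nonempty_Icc.2 hc)
    ((continuousOn_chi0 hb0 hb1 hh.le).mono Set.Icc_subset_Ici_self)
  set δ := chi0 b τ c x with hδ
  have hδ0 : 0 < δ := hcon x hx.1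
  have hδ1 : δ * (1 - b) ≤ 1 := by
    have : δ ≤ chi0 b τ c 0 := hmin (Set.left_mem_Icc.2 hc)
    rw [chi0_zero, le_div_iff₀ hb] at this
    exact this
  -- This value of `a` makes the deficit (1 - a)/D at most δ/2, since D ≥ 1 - b, so χ₀(k) ≤ δ/2
  -- contradicts the minimum δ on [0, c].
  obtain ⟨k, hk0, hkc, hk⟩ := F.exists_exponent hb0 hb1 hh (a := 1 - δ * (1 - b) / 2)
    (by linarith) (by linarith [mul_pos hδ0 hb])
  have h1 : δ ≤ chi0 b τ c k := hmin ⟨hk0.le, hkc⟩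
  rw [chi0] at h1
  have h2 := mul_exp_neg_le hb0 hh.le hk0.le
  have hD : 1 - b ≤ 1 - b * Real.exp (-(k * c * τ)) := by linarith
  set D := 1 - b * Real.exp (-(k * c * τ))
  have h3 : δ * (1 - b) / 2 / D ≤ δ / 2 := by
    rw [div_le_iff₀ (by linarith)]
    nlinarith
  rw [sub_div] at hk
  linarith

/-- Turns the reaction near +∞ into a series with non-negative terms in y = 1 - b - v, so that lower
bounds may be read off termwise. -/
theorem opL_sub (hb0 : 0 ≤ b) (hb1 : b < 1) (hh : 0 ≤ c * τ) (t : ℝ) :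
    opL b τ c (fun s => 1 - b - neutralDiff b τ c φ s) t = 1 - φ (t - c * τ) := by
  rw [opL, opB_sub (C := |1 - b|) hb0 hb1 (fun _ => le_rfl)
    (F.abs_neutralDiff_le hb0 hb1 (F.speed_pos hb1).le hh), opB_const hb0 hb1,
    F.opB_neutralDiff hb0 hb1, div_self (by linarith)]

/-- The decay of `1 - b - v` at `+∞` is at most exponential. -/
theorem exists_le_shift (hb0 : 0 ≤ b) (hb1 : b < 1) (hh : 0 < c * τ) :
    ∃ κ T, 0 < κ ∧ ∀ t, T ≤ t → κ * (1 - b - neutralDiff b τ c φ (t - c * τ / 4))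
      ≤ 1 - b - neutralDiff b τ c φ t := by
  set v := neutralDiff b τ c φ with hv
  have hc := F.speed_pos hb1
  have hd : ∀ t, HasDerivAt v (deriv v t) t := F.hasDerivAt
  have hmono : Monotone v := F.monotone_neutralDiff hc.le
  have hle : ∀ t, v t ≤ 1 - b := F.neutralDiff_le hc.le
  set h := c * τ
  obtain ⟨T, hT⟩ : ∃ T, ∀ t, T ≤ t → 1 / 2 ≤ φ t :=
    eventually_atTop.1 (F.top.eventually_const_le (by norm_num : (1 : ℝ) / 2 < 1))
  have hψ : ∀ t, 1 - b - v (t - h) ≤ 1 - φ (t - h) := fun t => by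
    rw [← F.opL_sub hb0 hb1 hh.le t]
    exact self_le_opB (w := fun s => 1 - b - v s) (C := 1) hb0 hb1 (fun s => by
      rw [abs_of_nonneg (by linarith [hle s])]
      linarith [F.neutralDiff_pos hb0 hb1 hh.le s]) (fun s => by linarith [hle s]) (t - h)
  -- Over [t, t + h/2] the function e^{-cs}v' drops at a definite rate and remains non-negative; the
  -- drop bounds v'(t) below by an earlier value of 1 - b - v.
  have h1 : ∀ t, T ≤ t → h / 4 * Real.exp (-c * (h / 2)) * (1 - b - v (t - h / 2)) ≤ deriv v t := by
    intro t ht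
    have hg : ∀ s, HasDerivAt (fun s => Real.exp (-c * s) * deriv v s)
        (Real.exp (-c * s) * -(φ s * (1 - φ (s - h)))) s :=
      fun s => hasDerivAt_exp_mul_mul (F.hasDerivAt_deriv s)
    have h2 := (convex_Icc t (t + h / 2)).image_sub_le_mul_sub_of_deriv_le
      (f := fun s => Real.exp (-c * s) * deriv v s)
      (fun s _ => (hg s).continuousAt.continuousWithinAt)
      (fun s _ => (hg s).differentiableAt.differentiableWithinAt)
      (C := -(Real.exp (-c * (t + h / 2)) * (1 / 2 * (1 - b - v (t - h / 2))))) (fun s hs => by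
        rw [interior_Icc] at hs
        rw [(hg s).deriv, mul_neg]
        refine neg_le_neg (mul_le_mul (Real.exp_le_exp.2 (by nlinarith [hs.2])) ?_
          (by linarith [hle (t - h / 2)]) (Real.exp_pos _).le)
        refine mul_le_mul (hT s (ht.trans hs.1.le)) ?_ (by linarith [hle (t - h / 2)])
          (F.mem_Icc s).1
        have := hmono (by linarith [hs.2] : s - h ≤ t - h / 2)
        linarith [hψ s])
      t (Set.left_mem_Icc.2 (by linarith)) (t + h / 2) (Set.right_mem_Icc.2 (by linarith))
      (by linarith)
    have h3 : 0 ≤ Real.exp (-c * (t + h / 2)) * deriv v (t + h / 2) :=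
      mul_nonneg (Real.exp_pos _).le (F.deriv_nonneg hc.le _)
    have e : Real.exp (-c * (t + h / 2)) = Real.exp (-c * t) * Real.exp (-c * (h / 2)) := by
      rw [← Real.exp_add]; ring_nf
    have h4 : Real.exp (-c * t) * (h / 4 * Real.exp (-c * (h / 2)) * (1 - b - v (t - h / 2)))
        ≤ Real.exp (-c * t) * deriv v t := by
      simp only [e] at h2 h3
      nlinarith
    exact le_of_mul_le_mul_left h4 (Real.exp_pos _)
  -- The inner factor comes from `h1`; the outer h/4 comes from integrating v' over [t, t + h/4].
  refine ⟨h / 4 * (h / 4 * Real.exp (-c * (h / 2))), T, by positivity, fun t ht => ?_⟩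
  have h2 := (convex_Icc t (t + h / 4)).mul_sub_le_image_sub_of_le_deriv (f := v)
    (fun s _ => (hd s).continuousAt.continuousWithinAt)
    (fun s _ => (hd s).differentiableAt.differentiableWithinAt)
    (C := h / 4 * Real.exp (-c * (h / 2)) * (1 - b - v (t - h / 4))) (fun s hs => by
      rw [interior_Icc] at hs
      refine le_trans (mul_le_mul_of_nonneg_left ?_ (by positivity)) (h1 s (ht.trans hs.1.le))
      linarith [hmono (by linarith [hs.2] : s - h / 2 ≤ t - h / 4)])
    t (Set.left_mem_Icc.2 (by linarith)) (t + h / 4) (Set.right_mem_Icc.2 (by linarith))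
    (by linarith)
  linarith [hle (t + h / 4)]

/-- If y = 1 - b - v satisfies -y' ≥ ky, then y at earlier times is exponentially larger, so the
reaction is at least Gy. The sum is truncated at `J` terms because the rate bound is available only
after T₀. The new rate p is the one for which p² + cp = G. -/
theorem exists_rate_step (hb0 : 0 ≤ b) (hb1 : b < 1) (hh : 0 < c * τ) {k a G p : ℝ} {J : ℕ} {T₀ : ℝ}
    (hk : ∀ t, T₀ ≤ t → k * (1 - b - neutralDiff b τ c φ t) ≤ deriv (neutralDiff b τ c φ) t)
    (ha0 : 0 ≤ a) (ha1 : a < 1)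
    (hG : G = a * ∑ j ∈ Finset.range J, b ^ j * Real.exp (k * ((j + 1) * (c * τ))))
    (hp0 : 0 ≤ p) (hp : p ^ 2 + c * p = G) :
    ∃ T, ∀ t, T ≤ t → p * (1 - b - neutralDiff b τ c φ t) ≤ deriv (neutralDiff b τ c φ) t := by
  set v := neutralDiff b τ c φ with hv
  have hc := F.speed_pos hb1
  have hd : ∀ t, HasDerivAt v (deriv v t) t := F.hasDerivAt
  have hle : ∀ t, v t ≤ 1 - b := F.neutralDiff_le hc.le
  obtain ⟨T₁, hT₁⟩ : ∃ T, ∀ t, T ≤ t → a ≤ φ t :=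
    eventually_atTop.1 (F.top.eventually_const_le ha1)
  have hexp : AntitoneOn (fun t => Real.exp (-(-k) * t) * (1 - b - v t)) (Set.Ici T₀) :=
    antitoneOn_Ici_of_hasDerivAt_nonpos
      (fun t => hasDerivAt_exp_mul_mul (r := -deriv v t + k * (1 - b - v t))
        (((hd t).const_sub (1 - b)).congr_deriv (by ring)))
      fun t ht => mul_nonpos_of_nonneg_of_nonpos (Real.exp_pos _).le (by linarith [hk t ht])
  have hψ : ∀ t, T₀ + J * (c * τ) ≤ t →
      (∑ j ∈ Finset.range J, b ^ j * Real.exp (k * ((j + 1) * (c * τ)))) * (1 - b - v t)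
        ≤ 1 - φ (t - c * τ) := by
    intro t ht
    rw [← F.opL_sub hb0 hb1 hh.le t, opL, opB, Finset.sum_mul]
    have hsum := summable_opB (w := fun s => 1 - b - v s) (C := 1) (τ := τ) (c := c) hb0 hb1
      (fun s => by
        rw [abs_of_nonneg (by linarith [hle s])]
        linarith [F.neutralDiff_pos hb0 hb1 hh.le s]) (t - c * τ)
    refine le_trans (Finset.sum_le_sum fun j hj => ?_) (hsum.sum_le_tsum (Finset.range J)
      fun j _ => mul_nonneg (pow_nonneg hb0 j) (by linarith [hle (t - c * τ - j * (c * τ))]))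
    rw [mul_assoc]
    refine mul_le_mul_of_nonneg_left ?_ (pow_nonneg hb0 j)
    have hj' : (j : ℝ) + 1 ≤ J := by exact_mod_cast Finset.mem_range.1 hj
    have e1 : t - c * τ - j * (c * τ) = t - (j + 1) * (c * τ) := by ring
    rw [e1]
    set r := ((j : ℝ) + 1) * (c * τ)
    have hr0 : 0 ≤ r := by positivity
    have hr : r ≤ J * (c * τ) := mul_le_mul_of_nonneg_right hj' hh.le
    have h2 : Real.exp (-(-k) * t) * (1 - b - v t)
        ≤ Real.exp (-(-k) * (t - r)) * (1 - b - v (t - r)) :=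
      hexp (Set.mem_Ici.2 (by linarith)) (Set.mem_Ici.2 (by linarith)) (by linarith)
    have e2 : Real.exp (-(-k) * t) = Real.exp (-(-k) * (t - r)) * Real.exp (k * r) := by
      rw [← Real.exp_add]; ring_nf
    rw [e2, mul_assoc] at h2
    exact le_of_mul_le_mul_left h2 (Real.exp_pos _)
  have hG0 : 0 ≤ ∑ j ∈ Finset.range J, b ^ j * Real.exp (k * ((j + 1) * (c * τ))) :=
    Finset.sum_nonneg fun j _ => mul_nonneg (pow_nonneg hb0 j) (Real.exp_pos _).le
  set T := max T₁ (T₀ + J * (c * τ)) with hTdef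
  refine ⟨T, fun t ht => ?_⟩
  -- X' = (c + p)X plus a non-negative term for times beyond T. A positive value of X would persist
  -- and keep v' below a negative constant near +∞, contradicting convergence of v.
  let X : ℝ → ℝ := fun t => -deriv v t + p * (1 - b - v t)
  have hX : ∀ t, HasDerivAt X ((c + p) * X t
      + (φ t * (1 - φ (t - c * τ)) - G * (1 - b - v t))) t := by
    intro t
    refine ((F.hasDerivAt_deriv t).neg.add (((hd t).const_sub (1 - b)).const_mul p)).congr_deriv ?_
    simp only [X]
    rw [← hp]
    ring
  have hZ : MonotoneOn (fun t => Real.exp (-(c + p) * t) * X t) (Set.Ici T) :=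
    monotoneOn_Ici_of_hasDerivAt_nonneg (fun t => hasDerivAt_exp_mul_mul (hX t)) fun t ht => by
      refine mul_nonneg (Real.exp_pos _).le (sub_nonneg.2 ?_)
      have h1 := hψ t ((le_max_right _ _).trans ht)
      have h2 := hT₁ t ((le_max_left _ _).trans ht)
      have h3 : 0 ≤ 1 - b - v t := by linarith [hle t]
      rw [hG, mul_assoc]
      exact mul_le_mul h2 h1 (mul_nonneg hG0 h3) (ha0.trans h2)
  by_contra hcon
  rw [not_le] at hcon
  have hXt : 0 < X t := by simp only [X]; linarith
  have hlim : Tendsto (fun s => p * (1 - b - v s)) atTop (𝓝 0) := by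
    have := (F.tendsto_neutralDiff_atTop.const_sub (1 - b)).const_mul p
    simpa using this
  have := zero_le_add_of_deriv_le_atTop (f := v) (f' := deriv v)
    (k := fun s => p * (1 - b - v s)) (x := -X t) (t₀ := t) hd F.tendsto_neutralDiff_atTop hlim
    fun s hs => by
      have h1 : Real.exp (-(c + p) * t) * X t ≤ Real.exp (-(c + p) * s) * X s :=
        hZ (Set.mem_Ici.2 ht) (Set.mem_Ici.2 (ht.trans hs)) hs
      have h2 : Real.exp (-(c + p) * s) ≤ Real.exp (-(c + p) * t) :=
        Real.exp_le_exp.2 (by nlinarith)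
      have h3 : X t ≤ X s := by
        have h4 := (mul_le_mul_of_nonneg_right h2 hXt.le).trans h1
        exact le_of_mul_le_mul_left h4 (Real.exp_pos _)
      simp only [X] at h3 ⊢
      linarith
  linarith

theorem exists_zero_chi1 (hb0 : 0 ≤ b) (hb1 : b < 1) (hh : 0 < c * τ) :
    ∃ z, z < 0 ∧ 1 - b * Real.exp (-(z * c * τ)) ≠ 0 ∧ chi1 b τ c z = 0 := by
  set v := neutralDiff b τ c φ with hv
  have hb : 0 < 1 - b := by linarith
  have hc := F.speed_pos hb1
  have hlt : ∀ t, v t < 1 - b := F.neutralDiff_lt hb0 hb1 hc.le hh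
  have hd : ∀ t, HasDerivAt v (deriv v t) t := F.hasDerivAt
  let S : Set ℝ := {k | ∃ T, ∀ t, T ≤ t → k * (1 - b - v t) ≤ deriv v t}
  have h0S : (0 : ℝ) ∈ S := ⟨0, fun t _ => by rw [zero_mul]; exact F.deriv_nonneg hc.le t⟩
  have hdown : ∀ k ∈ S, ∀ k' ≤ k, k' ∈ S := by
    rintro k ⟨T, hT⟩ k' hk'
    exact ⟨T, fun t ht => (mul_le_mul_of_nonneg_right hk' (by linarith [hlt t])).trans (hT t ht)⟩
  -- A rate k shrinks 1 - b - v by e^{-kcτ/4} over a step cτ/4, while `exists_le_shift` allows at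
  -- most the factor κ. Strict positivity of 1 - b - v permits cancellation.
  have hbdd : BddAbove S := by
    obtain ⟨κ, T₁, hκ, hT₁⟩ := F.exists_le_shift hb0 hb1 hh
    refine ⟨-Real.log κ / (c * τ / 4), ?_⟩
    rintro k ⟨T, hT⟩
    have hexp : AntitoneOn (fun t => Real.exp (-(-k) * t) * (1 - b - v t)) (Set.Ici T) :=
      antitoneOn_Ici_of_hasDerivAt_nonpos
        (fun t => hasDerivAt_exp_mul_mul (r := -deriv v t + k * (1 - b - v t))
          (((hd t).const_sub (1 - b)).congr_deriv (by ring)))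
        fun t ht => mul_nonpos_of_nonneg_of_nonpos (Real.exp_pos _).le (by linarith [hT t ht])
    set t := max T₁ (T + c * τ / 4)
    have h1 := hT₁ t (le_max_left _ _)
    have h2t : T ≤ t - c * τ / 4 := by linarith [le_max_right T₁ (T + c * τ / 4)]
    have h2 : Real.exp (-(-k) * t) * (1 - b - v t)
        ≤ Real.exp (-(-k) * (t - c * τ / 4)) * (1 - b - v (t - c * τ / 4)) :=
      hexp (Set.mem_Ici.2 h2t) (Set.mem_Ici.2 (by linarith)) (by linarith)
    have e2 : Real.exp (-(-k) * t)
        = Real.exp (-(-k) * (t - c * τ / 4)) * Real.exp (k * (c * τ / 4)) := by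
      rw [← Real.exp_add]; ring_nf
    rw [e2, mul_assoc] at h2
    have h3 := le_of_mul_le_mul_left h2 (Real.exp_pos _)
    have h4 : κ * Real.exp (k * (c * τ / 4)) ≤ 1 := by
      have hy := hlt (t - c * τ / 4)
      have h5 := mul_le_mul_of_nonneg_left h1 (Real.exp_pos (k * (c * τ / 4))).le
      have h6 : (κ * Real.exp (k * (c * τ / 4))) * (1 - b - v (t - c * τ / 4))
          ≤ 1 * (1 - b - v (t - c * τ / 4)) := by linarith
      exact le_of_mul_le_mul_right h6 (by linarith)
    have h5 := Real.log_le_log (by positivity) h4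
    rw [Real.log_mul hκ.ne' (Real.exp_pos _).ne', Real.log_exp, Real.log_one] at h5
    rw [le_div_iff₀ (by positivity)]
    linarith
  set M := sSup S
  have hM0 : 0 ≤ M := le_csSup hbdd h0S
  -- Rates below M are admissible, so the improvement step gives an admissible p with p² + cp equal
  -- to the left side; then p ≤ M. The ε is removed afterwards by continuity in finite sums.
  have hpart : ∀ J : ℕ, ∀ ε : ℝ, 0 < ε → ε ≤ 1 →
      (1 - ε) * ∑ j ∈ Finset.range J, b ^ j * Real.exp ((M - ε) * ((j + 1) * (c * τ)))
        ≤ M ^ 2 + c * M := by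
    intro J ε hε hε1
    obtain ⟨k, hkS, hk⟩ := exists_lt_of_lt_csSup ⟨0, h0S⟩ (by linarith : M - ε < sSup S)
    obtain ⟨T, hT⟩ := hdown k hkS _ hk.le
    set G := (1 - ε) * ∑ j ∈ Finset.range J, b ^ j * Real.exp ((M - ε) * ((j + 1) * (c * τ)))
      with hG
    have hG0 : 0 ≤ G := mul_nonneg (by linarith) (Finset.sum_nonneg fun j _ =>
      mul_nonneg (pow_nonneg hb0 j) (Real.exp_pos _).le)
    have hs := Real.sq_sqrt (by positivity : 0 ≤ c ^ 2 + 4 * G)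
    have hsc : c ≤ √(c ^ 2 + 4 * G) := Real.le_sqrt_of_sq_le (by linarith)
    set p := (√(c ^ 2 + 4 * G) - c) / 2 with hp
    have hp0 : 0 ≤ p := by rw [hp]; linarith
    have hpG : p ^ 2 + c * p = G := by
      rw [hp]; linear_combination hs / 4
    have hpS : p ∈ S := F.exists_rate_step hb0 hb1 hh hT (by linarith) (by linarith) hG hp0 hpG
    have hpM : p ≤ M := le_csSup hbdd hpS
    rw [← hpG]
    nlinarith
  have hpart' : ∀ J : ℕ, ∑ j ∈ Finset.range J, b ^ j * Real.exp (M * ((j + 1) * (c * τ)))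
      ≤ M ^ 2 + c * M := by
    intro J
    have hcont : Continuous fun ε : ℝ =>
        (1 - ε) * ∑ j ∈ Finset.range J, b ^ j * Real.exp ((M - ε) * ((j + 1) * (c * τ))) := by
      fun_prop
    have hlim := (hcont.tendsto 0).mono_left (nhdsWithin_le_nhds (s := Set.Ioi 0))
    simp only [sub_zero, one_mul] at hlim
    refine le_of_tendsto hlim ?_
    filter_upwards [Ioo_mem_nhdsGT (zero_lt_one (α := ℝ))] with ε hε
    exact hpart J ε hε.1 hε.2.le
  set r := b * Real.exp (M * (c * τ)) with hr
  have hterm : ∀ j : ℕ, b ^ j * Real.exp (M * ((j + 1) * (c * τ)))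
      = Real.exp (M * (c * τ)) * r ^ j := by
    intro j
    have e : Real.exp (M * ((j + 1) * (c * τ)))
        = Real.exp (M * (c * τ)) * Real.exp (M * (c * τ)) ^ j := by
      rw [← Real.exp_nat_mul, ← Real.exp_add]
      ring_nf
    rw [e, hr, mul_pow]
    ring
  have hE1 : 1 ≤ Real.exp (M * (c * τ)) := Real.one_le_exp (by positivity)
  have hr0 : 0 ≤ r := by positivity
  -- Otherwise each term would be at least 1, contradicting the uniform bound on partial sums. Thus
  -- [-M, 0] lies in the region of convergence of χ₁.
  have hr1 : r < 1 := by
    by_contra hcon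
    rw [not_lt] at hcon
    obtain ⟨J, hJ⟩ := exists_nat_gt (M ^ 2 + c * M)
    have h1 := hpart' J
    have h2 : (J : ℝ) ≤ ∑ j ∈ Finset.range J, b ^ j * Real.exp (M * ((j + 1) * (c * τ))) := by
      have h3 := Finset.card_nsmul_le_sum (Finset.range J)
        (fun j : ℕ => b ^ j * Real.exp (M * ((j + 1) * (c * τ)))) 1 fun j _ => by
          rw [hterm]
          exact one_le_mul_of_one_le_of_one_le hE1 (one_le_pow₀ hcon)
      simpa using h3
    linarith
  have hG : Real.exp (M * (c * τ)) / (1 - r) ≤ M ^ 2 + c * M := by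
    have h1 := ((hasSum_geometric_of_lt_one hr0 hr1).mul_left
      (Real.exp (M * (c * τ)))).tendsto_sum_nat
    rw [div_eq_mul_inv]
    exact le_of_tendsto' h1 fun J => by
      have := hpart' J
      simpa only [hterm] using this
  have hden : ∀ z ∈ Set.Icc (-M) 0, 0 < 1 - b * Real.exp (-(z * c * τ)) := by
    intro z hz
    have : Real.exp (-(z * c * τ)) ≤ Real.exp (M * (c * τ)) :=
      Real.exp_le_exp.2 (by nlinarith [hz.1])
    have := mul_le_mul_of_nonneg_left this hb0
    linarith
  have hcont : ContinuousOn (chi1 b τ c) (Set.Icc (-M) 0) := by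
    unfold chi1
    exact ContinuousOn.sub (by fun_prop) (ContinuousOn.div (by fun_prop) (by fun_prop)
      fun z hz => (hden z hz).ne')
  have hz0 : chi1 b τ c 0 < 0 := by
    rw [chi1_zero]
    have : 0 < 1 / (1 - b) := by positivity
    linarith
  have hzM : 0 ≤ chi1 b τ c (-M) := by
    rw [chi1]
    have e : -(-M * c * τ) = M * (c * τ) := by ring
    rw [e]
    linarith
  obtain ⟨z, hz, hz'⟩ := intermediate_value_Icc' (by linarith : -M ≤ 0) hcont ⟨hz0.le, hzM⟩
  refine ⟨z, lt_of_le_of_ne hz.2 fun h => ?_, (hden z hz).ne', hz'⟩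
  rw [h] at hz'
  linarith

theorem mem_frakD (hb0 : 0 ≤ b) (hb1 : b < 1) (hτ : 0 < τ) : (τ, c) ∈ frakD b := by
  have hc := F.speed_pos hb1
  have hh := mul_pos hc hτ
  exact ⟨hτ.le, hc.le, F.exists_zero_chi0 hb0 hb1 hh, F.exists_zero_chi1 hb0 hb1 hh⟩

end IsMonotoneFront

end NeutralKPP

/-! ### Exponents at 0, exponential polynomials and gluing -/

namespace NeutralKPP

variable {b τ c : ℝ}

noncomputable section

/-- Derivative of `χ₀`. -/
def chi0Deriv (b τ c z : ℝ) : ℝ :=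
  2 * z - c - c * τ * (b * Real.exp (-(z * c * τ))) / (1 - b * Real.exp (-(z * c * τ))) ^ 2

theorem hasDerivAt_chi0 {z : ℝ} (hz : 1 - b * Real.exp (-(z * c * τ)) ≠ 0) :
    HasDerivAt (chi0 b τ c) (chi0Deriv b τ c z) z := by
  have h1 : HasDerivAt (fun z : ℝ => Real.exp (-(z * c * τ)))
      (Real.exp (-(z * c * τ)) * -(1 * c * τ)) z :=
    ((((hasDerivAt_id z).mul_const c).mul_const τ).neg).exp
  have h2 : HasDerivAt (fun z : ℝ => z ^ 2 - c * z) (2 * z - c) z := by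
    refine ((hasDerivAt_pow 2 z).sub ((hasDerivAt_id z).const_mul c)).congr_deriv ?_
    simp
  have h3 := h2.add (((h1.const_mul b).const_sub 1).inv hz)
  have e : chi0 b τ c = (fun z : ℝ => z ^ 2 - c * z) +
      (fun z => 1 - b * Real.exp (-(z * c * τ)))⁻¹ := by
    funext z
    simp [chi0]
  rw [e]
  refine h3.congr_deriv ?_
  rw [chi0Deriv]
  ring

/-- Convexity: e^{-zcτ} and y ↦ 1/(1 - y) lie above their tangents, so χ₀ minus its quadratic part
lies above its own tangent. At a double zero only the square (z - z₀)² remains. -/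
theorem sq_le_chi0 (hb0 : 0 ≤ b) (hb1 : b < 1) (hh : 0 ≤ c * τ) {z₀ z : ℝ} (h0 : 0 ≤ z₀) (hz : 0 ≤ z)
    (hχ : chi0 b τ c z₀ = 0) (hχ' : chi0Deriv b τ c z₀ = 0) : (z - z₀) ^ 2 ≤ chi0 b τ c z := by
  have h1 := mul_exp_neg_le hb0 hh h0
  have h2 := mul_exp_neg_le hb0 hh hz
  have h3 : b * Real.exp (-(z₀ * c * τ)) * (1 - (z - z₀) * (c * τ)) ≤ b * Real.exp (-(z * c * τ)) := by
    have e : Real.exp (-(z * c * τ))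
        = Real.exp (-(z₀ * c * τ)) * Real.exp (-((z - z₀) * (c * τ))) := by
      rw [← Real.exp_add]; ring_nf
    rw [e, ← mul_assoc b]
    refine mul_le_mul_of_nonneg_left ?_ (mul_nonneg hb0 (Real.exp_pos _).le)
    linarith [Real.add_one_le_exp (-((z - z₀) * (c * τ)))]
  rw [chi0] at hχ ⊢
  rw [chi0Deriv] at hχ'
  set y₀ := b * Real.exp (-(z₀ * c * τ))
  set y := b * Real.exp (-(z * c * τ))
  have hD0 : 0 < 1 - y₀ := by linarith
  have hD : 0 < 1 - y := by linarith
  have h4 : 1 / (1 - y₀) + (y - y₀) / (1 - y₀) ^ 2 ≤ 1 / (1 - y) := by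
    have e : 1 / (1 - y) - (1 / (1 - y₀) + (y - y₀) / (1 - y₀) ^ 2)
        = (y - y₀) ^ 2 / ((1 - y) * (1 - y₀) ^ 2) := by
      field_simp
      ring
    have : 0 ≤ (y - y₀) ^ 2 / ((1 - y) * (1 - y₀) ^ 2) := by positivity
    linarith
  have h5 : -((z - z₀) * (c * τ * y₀ / (1 - y₀) ^ 2)) ≤ (y - y₀) / (1 - y₀) ^ 2 := by
    rw [le_div_iff₀ (by positivity)]
    have e : -((z - z₀) * (c * τ * y₀ / (1 - y₀) ^ 2)) * (1 - y₀) ^ 2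
        = -((z - z₀) * (c * τ * y₀)) := by field_simp
    rw [e]
    linarith
  have h6 : c * τ * y₀ / (1 - y₀) ^ 2 = 2 * z₀ - c := by linarith
  rw [h6] at h5
  nlinarith

/-- Either `χ₀` becomes negative right after a zero `k`, or it has a double zero `k`. -/
theorem exists_tail_exponents (hb0 : 0 ≤ b) (hb1 : b < 1) (hh : 0 ≤ c * τ) {z₀ : ℝ} (hz₀ : 0 < z₀)
    (hχ : chi0 b τ c z₀ = 0) :
    ∃ k ν, 0 < k ∧ k < ν ∧ ν < 2 * k ∧ chi0 b τ c k = 0 ∧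
      (chi0 b τ c ν < 0 ∨ (chi0Deriv b τ c k = 0 ∧ 0 < chi0 b τ c ν)) := by
  have h00 : 0 < chi0 b τ c 0 := by
    rw [chi0_zero]
    exact one_div_pos.2 (by linarith)
  by_cases hneg : ∃ z, 0 < z ∧ chi0 b τ c z < 0
  · obtain ⟨z, hz0, hz⟩ := hneg
    have hcont := (continuousOn_chi0 hb0 hb1 hh).mono (Set.Icc_subset_Ici_self : Set.Icc 0 z ⊆ _)
    have hclosed : IsClosed (Set.Icc 0 z ∩ chi0 b τ c ⁻¹' Set.Ici 0) :=
      hcont.preimage_isClosed_of_isClosed isClosed_Icc isClosed_Ici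
    -- Taking the last point of [0, z] where χ₀ ≥ 0 makes χ₀ negative immediately to the right of k,
    -- so ν can also be kept below 2k.
    obtain ⟨k, ⟨hk, hk0⟩, hmax⟩ := (isCompact_Icc.of_isClosed_subset hclosed
      Set.inter_subset_left).exists_isGreatest ⟨0, Set.left_mem_Icc.2 hz0.le, h00.le⟩
    have hlt : ∀ x, k < x → x ≤ z → chi0 b τ c x < 0 := fun x hx hxz => by
      by_contra hcon
      exact absurd (hmax ⟨⟨hk.1.trans hx.le, hxz⟩, not_lt.1 hcon⟩) (not_le.2 hx)
    have hkz : k < z := lt_of_le_of_ne hk.2 fun h => by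
      rw [← h] at hz
      exact absurd hk0 (not_le.2 hz)
    have hzero : chi0 b τ c k = 0 := by
      refine le_antisymm ?_ hk0
      have h1 : Tendsto (chi0 b τ c) (𝓝[>] k) (𝓝 (chi0 b τ c k)) :=
        ((continuousOn_chi0 hb0 hb1 hh) k hk.1).mono_left
          (nhdsWithin_mono _ fun x hx => hk.1.trans (le_of_lt hx))
      refine le_of_tendsto h1 ?_
      filter_upwards [Ioo_mem_nhdsGT hkz] with x hx
      exact (hlt x hx.1 hx.2.le).le
    have hkpos : 0 < k := lt_of_le_of_ne hk.1 fun h => by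
      rw [← h] at hzero
      linarith
    refine ⟨k, min z (3 / 2 * k), hkpos, lt_min hkz (by linarith), ?_, hzero, Or.inl ?_⟩
    · exact (min_le_right _ _).trans_lt (by linarith)
    · exact hlt _ (lt_min hkz (by linarith)) (min_le_left _ _)
  · push Not at hneg
    have hmin : IsLocalMin (chi0 b τ c) z₀ := by
      filter_upwards [eventually_gt_nhds hz₀] with z hz
      rw [hχ]
      exact hneg z hz
    have hden : 1 - b * Real.exp (-(z₀ * c * τ)) ≠ 0 := by
      have := mul_exp_neg_le hb0 hh hz₀.le
      linarith
    have hder := hmin.hasDerivAt_eq_zero (hasDerivAt_chi0 hden)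
    refine ⟨z₀, 3 / 2 * z₀, hz₀, by linarith, by linarith, hχ, Or.inr ⟨hder, ?_⟩⟩
    have := sq_le_chi0 hb0 hb1 hh hz₀.le (by linarith : 0 ≤ 3 / 2 * z₀) hχ hder
    have h2 : 0 < (3 / 2 * z₀ - z₀) ^ 2 := by
      have : 0 < 3 / 2 * z₀ - z₀ := by linarith
      positivity
    linarith

/-- `(p + q t) e^{z t}`. -/
def expPoly (p q z t : ℝ) : ℝ := (p + q * t) * Real.exp (z * t)

theorem hasDerivAt_expPoly (p q z t : ℝ) :
    HasDerivAt (expPoly p q z) (expPoly (z * p + q) (z * q) z t) t := by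
  have h1 : HasDerivAt (fun t => Real.exp (z * t)) (Real.exp (z * t) * (z * 1)) t :=
    ((hasDerivAt_id t).const_mul z).exp
  have h2 : HasDerivAt (fun t => p + q * t) (q * 1) t := ((hasDerivAt_id t).const_mul q).const_add p
  refine (h2.mul h1).congr_deriv ?_
  rw [expPoly]
  ring

theorem deriv_expPoly (p q z : ℝ) : deriv (expPoly p q z) = expPoly (z * p + q) (z * q) z :=
  funext fun t => (hasDerivAt_expPoly p q z t).deriv

theorem contDiff_expPoly (p q z : ℝ) : ContDiff ℝ 2 (expPoly p q z) := by
  unfold expPoly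
  fun_prop

theorem continuous_expPoly (p q z : ℝ) : Continuous (expPoly p q z) := by
  unfold expPoly
  fun_prop

theorem abs_expPoly_le (p q : ℝ) {z : ℝ} (hz : 0 < z) {t : ℝ} (ht : t ≤ 0) :
    |expPoly p q z t| ≤ |p| + |q| / z := by
  have h1 : Real.exp (z * t) ≤ 1 := Real.exp_le_one_iff.2 (by nlinarith)
  have h2 : |t| * Real.exp (z * t) ≤ 1 / z := by
    rw [abs_of_nonpos ht, le_div_iff₀ hz]
    have h3 : -(z * t) ≤ Real.exp (-(z * t)) := by linarith [Real.add_one_le_exp (-(z * t))]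
    have h4 : Real.exp (-(z * t)) * Real.exp (z * t) = 1 := by rw [← Real.exp_add]; simp
    have h5 := mul_le_mul_of_nonneg_right h3 (Real.exp_pos (z * t)).le
    linarith
  rw [expPoly, add_mul]
  refine (abs_add_le _ _).trans (add_le_add ?_ ?_)
  · rw [abs_mul, Real.abs_exp]
    exact mul_le_of_le_one_right (abs_nonneg p) h1
  · rw [abs_mul, abs_mul, Real.abs_exp, mul_assoc, div_eq_mul_one_div]
    exact mul_le_mul_of_nonneg_left h2 (abs_nonneg q)

theorem tendsto_expPoly_atBot (p q : ℝ) {z : ℝ} (hz : 0 < z) :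
    Tendsto (expPoly p q z) atBot (𝓝 0) := by
  have e : expPoly p q z = fun t => Real.exp (z / 2 * t) * expPoly p q (z / 2) t := by
    funext t
    rw [expPoly, expPoly, mul_left_comm, ← Real.exp_add]
    ring_nf
  rw [e]
  exact tendsto_exp_mul_mul_zero (tendsto_exp_mul_atBot (by linarith))
    ((eventually_le_atBot 0).mono fun t ht => abs_expPoly_le p q (by linarith : 0 < z / 2) ht)

/-- The linearization at `0` acts on `(p + q t) e^{z t}`. -/
theorem hasSum_expPoly (hb0 : 0 ≤ b) {z : ℝ} (hz : b * Real.exp (-(z * c * τ)) < 1) (p q t : ℝ) :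
    HasSum (fun j : ℕ => b ^ j * expPoly p q z (t - j * (c * τ)))
      (expPoly (p * chi0 b τ c z + q * chi0Deriv b τ c z) (q * chi0 b τ c z) z t
        - deriv (deriv (expPoly p q z)) t + c * deriv (expPoly p q z) t) := by
  have h := ((hasSum_opB_exp hb0 hz t).mul_left p).add ((hasSum_opB_mul_exp hb0 hz t).mul_left q)
  rw [deriv_expPoly, deriv_expPoly]
  convert! h using 1
  · funext j
    rw [expPoly]
    ring
  · simp only [expPoly, chi0, chi0Deriv]
    ring

/-- Gluing of two functions at a point. -/
def glue (t₀ : ℝ) (f g : ℝ → ℝ) (t : ℝ) : ℝ := if t ≤ t₀ then f t else g t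

theorem glue_of_le {t₀ t : ℝ} (f g : ℝ → ℝ) (h : t ≤ t₀) : glue t₀ f g t = f t := if_pos h

theorem glue_of_lt {t₀ t : ℝ} (f g : ℝ → ℝ) (h : t₀ < t) : glue t₀ f g t = g t := if_neg (not_le.2 h)

section glue

variable {t₀ : ℝ} {f g : ℝ → ℝ}

theorem glue_eventuallyEq_left {t : ℝ} (h : t < t₀) : glue t₀ f g =ᶠ[𝓝 t] f :=
  (eventually_lt_nhds h).mono fun _ hs => glue_of_le f g hs.le

theorem glue_eventuallyEq_right {t : ℝ} (h : t₀ < t) : glue t₀ f g =ᶠ[𝓝 t] g :=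
  (eventually_gt_nhds h).mono fun _ hs => glue_of_lt f g hs

theorem continuous_glue (hf : Continuous f) (hg : Continuous g) (h : f t₀ = g t₀) :
    Continuous (glue t₀ f g) :=
  Continuous.if_le hf hg continuous_id continuous_const fun t ht => by
    rw [show t = t₀ from ht, h]

theorem contDiffOn_glue (hf : ContDiff ℝ 2 f) (hg : ContDiff ℝ 2 g) :
    ContDiffOn ℝ 2 (glue t₀ f g) {t₀}ᶜ := by
  intro t ht
  rcases lt_or_gt_of_ne ht with h | h
  · exact (hf.contDiffAt.congr_of_eventuallyEq (glue_eventuallyEq_left h)).contDiffWithinAt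
  · exact (hg.contDiffAt.congr_of_eventuallyEq (glue_eventuallyEq_right h)).contDiffWithinAt

theorem deriv_glue_left {t : ℝ} (h : t < t₀) : deriv (glue t₀ f g) t = deriv f t :=
  (glue_eventuallyEq_left h).deriv_eq

theorem deriv_glue_right {t : ℝ} (h : t₀ < t) : deriv (glue t₀ f g) t = deriv g t :=
  (glue_eventuallyEq_right h).deriv_eq

theorem deriv_deriv_glue_left {t : ℝ} (h : t < t₀) :
    deriv (deriv (glue t₀ f g)) t = deriv (deriv f) t :=
  (glue_eventuallyEq_left h).deriv.deriv_eq

theorem deriv_deriv_glue_right {t : ℝ} (h : t₀ < t) :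
    deriv (deriv (glue t₀ f g)) t = deriv (deriv g) t :=
  (glue_eventuallyEq_right h).deriv.deriv_eq

theorem isCb2Off_glue (hf : ContDiff ℝ 2 f) (hg : ContDiff ℝ 2 g) {C C' : ℝ}
    (hC : ∀ t ≤ t₀, |f t| ≤ C ∧ |deriv f t| ≤ C ∧ |deriv (deriv f) t| ≤ C)
    (hC' : ∀ t, t₀ ≤ t → |g t| ≤ C' ∧ |deriv g t| ≤ C' ∧ |deriv (deriv g) t| ≤ C') :
    IsCb2Off t₀ (glue t₀ f g) := by
  refine ⟨contDiffOn_glue hf hg, max C C', fun t ht => ?_⟩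
  rcases lt_or_gt_of_ne ht with h | h
  · rw [glue_of_le f g h.le, deriv_glue_left h, deriv_deriv_glue_left h]
    obtain ⟨h1, h2, h3⟩ := hC t h.le
    exact ⟨h1.trans (le_max_left _ _), h2.trans (le_max_left _ _), h3.trans (le_max_left _ _)⟩
  · rw [glue_of_lt f g h, deriv_glue_right h, deriv_deriv_glue_right h]
    obtain ⟨h1, h2, h3⟩ := hC' t h.le
    exact ⟨h1.trans (le_max_right _ _), h2.trans (le_max_right _ _), h3.trans (le_max_right _ _)⟩

theorem tendsto_deriv_glue_left (hf : ContDiff ℝ 2 f) :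
    Tendsto (deriv (glue t₀ f g)) (𝓝[<] t₀) (𝓝 (deriv f t₀)) :=
  (((hf.continuous_deriv (by norm_num)).tendsto t₀).mono_left nhdsWithin_le_nhds).congr'
    (eventually_nhdsWithin_of_forall fun _ hs => (deriv_glue_left hs).symm)

theorem tendsto_deriv_glue_right (hg : ContDiff ℝ 2 g) :
    Tendsto (deriv (glue t₀ f g)) (𝓝[>] t₀) (𝓝 (deriv g t₀)) :=
  (((hg.continuous_deriv (by norm_num)).tendsto t₀).mono_left nhdsWithin_le_nhds).congr'
    (eventually_nhdsWithin_of_forall fun _ hs => (deriv_glue_right hs).symm)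

theorem opB_glue_of_le (hh : 0 ≤ c * τ) {t : ℝ} (ht : t ≤ t₀) :
    opB b τ c (glue t₀ f g) t = opB b τ c f t := by
  refine tsum_congr fun j => ?_
  have : 0 ≤ (j : ℝ) * (c * τ) := by positivity
  rw [glue_of_le f g (by linarith)]

end glue

end

end NeutralKPP

/-! ### Construction of super- and sub-solutions -/

namespace NeutralKPP

variable {b τ c l m : ℝ}

noncomputable section

/-- For m < 0 < c the quantity m² - cm is positive, so a zero of χ₁ at m forces a positive
denominator, hence convergence of the series. The root l comes from χ₁(0) < 0 and a large argument.
-/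
theorem exists_charRoots (hb0 : 0 ≤ b) (hb1 : b < 1) (hc : 0 < c) (hτ : 0 < τ) (hm : m < 0)
    (hden : 1 - b * Real.exp (-(m * c * τ)) ≠ 0) (hχ : chi1 b τ c m = 0) :
    ∃ l, CharRoots b τ c l m := by
  have hh : 0 < c * τ := mul_pos hc hτ
  have hb : 0 < 1 - b := by linarith
  have hmconv : b * Real.exp (-(m * c * τ)) < 1 := by
    by_contra hcon
    have h1 : 1 - b * Real.exp (-(m * c * τ)) < 0 := lt_of_le_of_ne (by linarith) hden
    have h2 := div_neg_of_pos_of_neg (Real.exp_pos (-(m * c * τ))) h1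
    rw [chi1] at hχ
    nlinarith
  have hcont : ContinuousOn (chi1 b τ c) (Set.Ici 0) := by
    unfold chi1
    refine ContinuousOn.sub (by fun_prop) (ContinuousOn.div (by fun_prop) (by fun_prop)
      fun z hz => ?_)
    have := mul_exp_neg_le hb0 hh.le (z := z) hz
    linarith
  set B := c + 1 + 1 / (1 - b) with hB
  have hib : 0 < 1 / (1 - b) := by positivity
  have hB0 : 0 ≤ B := by linarith
  have h0 : chi1 b τ c 0 < 0 := by rw [chi1_zero]; linarith
  have h1 : 0 ≤ chi1 b τ c B := by
    rw [chi1]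
    have h2 := mul_exp_neg_le hb0 hh.le hB0
    have h3 : Real.exp (-(B * c * τ)) ≤ 1 := Real.exp_le_one_iff.2 (by
      rw [mul_assoc]; linarith [mul_nonneg hB0 hh.le])
    have h4 : Real.exp (-(B * c * τ)) / (1 - b * Real.exp (-(B * c * τ))) ≤ 1 / (1 - b) :=
      div_le_div₀ zero_le_one h3 hb (by linarith)
    have h5 : B ^ 2 - c * B = B * (1 + 1 / (1 - b)) := by rw [hB]; ring
    rw [h5]
    nlinarith
  obtain ⟨l, hl, hl0⟩ := intermediate_value_Icc hB0 (hcont.mono Set.Icc_subset_Ici_self) ⟨h0.le, h1⟩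
  have hlpos : 0 < l := lt_of_le_of_ne hl.1 fun h => by
    rw [← h] at hl0
    linarith
  refine ⟨l, hb0, hb1, hh, hlpos, hm, (mul_exp_neg_le hb0 hh.le hlpos.le).trans_lt hb1, hmconv, ?_, ?_⟩
  · rw [chi1] at hl0; linarith
  · rw [chi1] at hχ; linarith

theorem speed_pos_of_chi0_zero (hb1 : b < 1) (hc : 0 ≤ c) {z : ℝ} (hχ : chi0 b τ c z = 0) :
    0 < c := by
  refine lt_of_le_of_ne hc fun h => ?_
  rw [chi0, ← h] at hχ
  have : 0 < 1 / (1 - b) := one_div_pos.2 (by linarith)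
  simp only [zero_mul, mul_zero, neg_zero, Real.exp_zero, mul_one, sub_zero] at hχ
  nlinarith [sq_nonneg z]

theorem abs_expPoly_zero_le (a : ℝ) {z : ℝ} (hz : z < 0) {t : ℝ} (ht : 0 ≤ t) :
    |expPoly a 0 z t| ≤ |a| := by
  rw [expPoly, zero_mul, add_zero, abs_mul, Real.abs_exp]
  exact mul_le_of_le_one_right (abs_nonneg a) (Real.exp_le_one_iff.2 (by nlinarith))

/-- `p (1 - θ t) e^{k t}` on the left, glued at `0` to `1 - (1 - p) e^{m t}`. -/
def superSol (k θ m : ℝ) : ℝ → ℝ :=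
  glue 0 (expPoly (-m / (k - θ - m)) (-θ * (-m / (k - θ - m))) k)
    (fun t => 1 - expPoly (1 - -m / (k - θ - m)) 0 m t)

theorem contDiff_one_sub_expPoly (a : ℝ) : ContDiff ℝ 2 fun t => 1 - expPoly a 0 m t :=
  contDiff_const.sub (contDiff_expPoly a 0 m)

theorem deriv_one_sub_expPoly (a : ℝ) :
    deriv (fun t => 1 - expPoly a 0 m t) = fun t => -expPoly (m * a) 0 m t := by
  funext t
  simpa using ((hasDerivAt_expPoly a 0 m t).const_sub 1).deriv

theorem deriv_neg_expPoly (a : ℝ) :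
    deriv (fun t => -expPoly a 0 m t) = fun t => -expPoly (m * a) 0 m t := by
  funext t
  simpa using ((hasDerivAt_expPoly a 0 m t).neg).deriv

section superSol

variable {k θ : ℝ}

theorem superSol_of_le {t : ℝ} (ht : t ≤ 0) :
    superSol k θ m t = expPoly (-m / (k - θ - m)) (-θ * (-m / (k - θ - m))) k t :=
  glue_of_le _ _ ht

/-- A convex function lies above its tangent at `0`. -/
theorem tangent_le_expPoly {p : ℝ} (hk : 0 < k) (hθ0 : 0 ≤ θ) (hθ : θ ≤ k / 2) (hp : 0 ≤ p)
    {t : ℝ} (ht : t ≤ 0) : p + (k - θ) * p * t ≤ expPoly p (-θ * p) k t := by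
  have hmono : MonotoneOn (expPoly (k * p + -θ * p) (k * (-θ * p)) k) (Set.Iic 0) := by
    refine monotoneOn_of_hasDerivAt_nonneg (convex_Iic 0) (continuous_expPoly _ _ _).continuousOn
      (fun t _ => hasDerivAt_expPoly _ _ _ t) fun t ht => ?_
    rw [interior_Iic] at ht
    refine mul_nonneg ?_ (Real.exp_pos _).le
    have e : k * (k * p + -θ * p) + k * (-θ * p) + k * (k * (-θ * p)) * t
        = p * k * (k - 2 * θ) + p * k * k * θ * (-t) := by ring
    rw [e]
    have h1 : 0 ≤ k - 2 * θ := by linarith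
    have h2 : 0 ≤ -t := by linarith [Set.mem_Iio.1 ht]
    positivity
  have hanti : AntitoneOn (fun t => expPoly p (-θ * p) k t - (k - θ) * p * t) (Set.Iic 0) := by
    refine antitoneOn_Iic_of_hasDerivAt_nonpos
      (fun t => (hasDerivAt_expPoly _ _ _ t).sub ((hasDerivAt_id t).const_mul ((k - θ) * p)))
      fun t ht => ?_
    have h1 := hmono ht (Set.mem_Iic.2 le_rfl) ht
    have h2 : expPoly (k * p + -θ * p) (k * (-θ * p)) k 0 = (k - θ) * p := by
      simp [expPoly]; ring
    linarith
  have h1 := hanti (Set.mem_Iic.2 ht) (Set.mem_Iic.2 le_rfl) ht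
  have h2 : expPoly p (-θ * p) k 0 = p := by simp [expPoly]
  simp only [h2] at h1
  linarith

/-- The left piece solves the linearization at 0 exactly, where F(w) ≤ Bw. The right piece solves
the linearization at 1, where F(w) ≤ 1/(1 - b) - Lw. The parameter θ is 0 unless χ₀ has a double
zero at k. -/
theorem isSuperSolution_superSol (R : CharRoots b τ c l m) (hk : 0 < k) (hθ0 : 0 ≤ θ)
    (hθ : θ ≤ k / 2) (hχ : chi0 b τ c k = 0) (hχ' : θ * chi0Deriv b τ c k = 0) :
    IsSuperSolution b τ c (superSol k θ m) := by
  have hb0 := R.b_nonneg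
  have hb1 := R.b_lt_one
  have hh := R.delay_pos.le
  have hm := R.m_neg
  have hb : 0 < 1 - b := by linarith
  have hden : 0 < k - θ - m := by linarith
  have hconv : b * Real.exp (-(k * c * τ)) < 1 := (mul_exp_neg_le hb0 hh hk.le).trans_lt hb1
  unfold superSol
  set p := -m / (k - θ - m) with hp
  have hp0 : 0 < p := div_pos (by linarith) hden
  have hp1 : p < 1 := (div_lt_one hden).2 (by linarith)
  -- The value of p is chosen to make the one-sided slopes at 0 agree.
  have hslope : (k - θ) * p = -m * (1 - p) := by
    have : p * (k - θ - m) = -m := div_mul_cancel₀ _ hden.ne'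
    linarith
  set f := expPoly p (-θ * p) k with hf
  set g : ℝ → ℝ := fun t => 1 - expPoly (1 - p) 0 m t with hg
  set w := glue 0 f g with hw
  have cf : ContDiff ℝ 2 f := contDiff_expPoly _ _ _
  have cg : ContDiff ℝ 2 g := contDiff_one_sub_expPoly _
  have df : deriv f = expPoly (k * p + -θ * p) (k * (-θ * p)) k := deriv_expPoly _ _ _
  have ddf := deriv_expPoly (k * p + -θ * p) (k * (-θ * p)) k
  have dg : deriv g = fun t => -expPoly (m * (1 - p)) 0 m t := deriv_one_sub_expPoly _
  have ddg := deriv_neg_expPoly (m := m) (m * (1 - p))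
  have hfg : f 0 = g 0 := by simp [hf, hg, expPoly]
  have hcont : Continuous w := continuous_glue cf.continuous cg.continuous hfg
  have hoff : IsCb2Off 0 w := by
    refine isCb2Off_glue cf cg
      (C := (|p| + |(-θ * p)| / k) + ((|k * p + -θ * p| + |k * (-θ * p)| / k)
        + (|k * (k * p + -θ * p) + k * (-θ * p)| + |k * (k * (-θ * p))| / k)))
      (C' := 1 + |1 - p| + (|m * (1 - p)| + |m * (m * (1 - p))|)) (fun t ht => ?_) fun t ht => ?_
    · rw [df, ddf]
      have h1 := abs_expPoly_le p (-θ * p) hk ht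
      have h2 := abs_expPoly_le (k * p + -θ * p) (k * (-θ * p)) hk ht
      have h3 := abs_expPoly_le (k * (k * p + -θ * p) + k * (-θ * p)) (k * (k * (-θ * p))) hk ht
      have h1' := (abs_nonneg _).trans h1
      have h2' := (abs_nonneg _).trans h2
      have h3' := (abs_nonneg _).trans h3
      exact ⟨by linarith, by linarith, by linarith⟩
    · rw [dg, ddg]
      simp only [abs_neg]
      have h1 := abs_expPoly_zero_le (1 - p) hm ht
      have h2 := abs_expPoly_zero_le (m * (1 - p)) hm ht
      have h3 := abs_expPoly_zero_le (m * (m * (1 - p))) hm ht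
      have h1' := (abs_nonneg _).trans h1
      have h2' := (abs_nonneg _).trans h2
      have h3' := (abs_nonneg _).trans h3
      refine ⟨?_, by linarith, by linarith⟩
      have : |g t| ≤ |1| + |expPoly (1 - p) 0 m t| := abs_sub _ _
      rw [abs_one] at this
      linarith
  have hmono : Monotone w := by
    refine monotone_of_hasDerivAt_nonneg_off hcont (fun t ht => (hoff.hasDerivAt ht).1) fun t ht => ?_
    rcases lt_or_gt_of_ne ht with h | h
    · rw [hw, deriv_glue_left h, df]
      refine mul_nonneg ?_ (Real.exp_pos _).le
      have e : k * p + -θ * p + k * (-θ * p) * t = p * (k - θ) + k * θ * p * (-t) := by ring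
      rw [e]
      have h1 : 0 ≤ k - θ := by linarith
      have h2 : 0 ≤ -t := by linarith
      positivity
    · rw [hw, deriv_glue_right h, dg, neg_nonneg]
      refine mul_nonpos_of_nonpos_of_nonneg ?_ (Real.exp_pos _).le
      nlinarith
  have hbot : Tendsto w atBot (𝓝 0) :=
    (tendsto_expPoly_atBot p (-θ * p) hk).congr'
      ((eventually_le_atBot 0).mono fun t ht => (glue_of_le f g ht).symm)
  have htop : Tendsto w atTop (𝓝 1) := by
    have h1 : Tendsto g atTop (𝓝 (1 - (1 - p + 0) * 0)) := by
      simp only [hg, expPoly, zero_mul]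
      exact tendsto_const_nhds.sub (tendsto_const_nhds.mul (tendsto_exp_mul_atTop hm))
    rw [mul_zero, sub_zero] at h1
    exact h1.congr' ((eventually_gt_atTop 0).mono fun t ht => (glue_of_lt f g ht).symm)
  have hpos : ∀ t, 0 < w t := by
    have hneg : ∀ t ≤ 0, 0 < w t := fun t ht => by
      rw [hw, glue_of_le f g ht, hf, expPoly]
      have : 0 ≤ θ * p * (-t) := mul_nonneg (mul_nonneg hθ0 hp0.le) (by linarith)
      exact mul_pos (by linarith) (Real.exp_pos _)
    intro t
    rcases le_total t 0 with h | h
    · exact hneg t h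
    · exact (hneg 0 le_rfl).trans_le (hmono h)
  have hmem : ∀ t, w t ∈ Set.Icc (0 : ℝ) 1 := fun t => ⟨(hpos t).le, hmono.ge_of_tendsto htop t⟩
  -- For t ≤ 0 the two pieces share their tangent at 0; the left one is convex and lies above it,
  -- the continued right one is concave and lies below.
  have hge : ∀ t, 1 - (1 - p) * Real.exp (m * t) ≤ w t := by
    intro t
    rcases le_or_gt t 0 with h | h
    · rw [hw, glue_of_le f g h]
      have h1 := tangent_le_expPoly hk hθ0 hθ hp0.le h
      have h2 := mul_le_mul_of_nonneg_left (Real.add_one_le_exp (m * t))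
        (by linarith : 0 ≤ 1 - p)
      rw [hslope] at h1
      linarith
    · rw [hw, glue_of_lt f g h]
      simp [hg, expPoly]
  refine ⟨hcont, hpos, hmono, hbot, htop, 0, hoff, fun t ht => ?_, deriv f 0, deriv g 0,
    tendsto_deriv_glue_left cf, tendsto_deriv_glue_right cg, ?_⟩
  · have hB := opB_nonneg (τ := τ) (c := c) hb0 (fun t => (hpos t).le) t
    have hL := opB_nonneg (τ := τ) (c := c) hb0 (fun t => (hpos t).le) (t - c * τ)
    rw [opF, opL]
    rcases lt_or_gt_of_ne ht with h | h
    · have e : opB b τ c w t = -deriv (deriv f) t + c * deriv f t := by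
        rw [hw, opB_glue_of_le hh h.le]
        refine (hasSum_expPoly hb0 hconv p (-θ * p) t).tsum_eq.trans ?_
        rw [hχ]
        have : -θ * p * chi0Deriv b τ c k = 0 := by linear_combination (-p) * hχ'
        rw [this]
        simp [expPoly, hf]
      have h1 : 0 ≤ opB b τ c w t * ((1 - b) * opB b τ c w (t - c * τ)) := by positivity
      have h2 : deriv (deriv w) t - c * deriv w t + opB b τ c w t = 0 := by
        rw [e, hw, deriv_deriv_glue_left h, deriv_glue_left h]
        ring
      linarith
    · have h1 := mul_opB_mem (τ := τ) (c := c) hb0 hb1 hmem t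
      have h2 := mul_opB_mem (τ := τ) (c := c) hb0 hb1 hmem (t - c * τ)
      -- Delayed arguments may fall in the left piece, where only the global inequality `hge` is
      -- available; it suffices because L has non-negative coefficients.
      have h3 : 1 / (1 - b) - (1 - p) * ((m ^ 2 - c * m) * Real.exp (m * t))
          ≤ opB b τ c w (t - c * τ) := by
        have hgeo := hasSum_geometric_of_lt_one hb0 hb1
        have hs := hgeo.sub ((R.hasSum_exp_shift R.m_conv R.m_root t).mul_left (1 - p))
        rw [← one_div] at hs
        refine hasSum_le (fun j => ?_) hs
          (summable_opB hb0 hb1 (abs_le_one_of_mem hmem) (t - c * τ)).hasSum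
        have := mul_le_mul_of_nonneg_left (hge (t - c * τ - j * (c * τ))) (pow_nonneg hb0 j)
        linarith
      have h4 : opB b τ c w t * (1 - (1 - b) * opB b τ c w (t - c * τ))
          ≤ 1 / (1 - b) - opB b τ c w (t - c * τ) := by
        have h5 : opB b τ c w t ≤ 1 / (1 - b) := by
          rw [le_div_iff₀ hb]; linarith [h1.2]
        have h6 := mul_le_mul_of_nonneg_right h5
          (by linarith [h2.2] : 0 ≤ 1 - (1 - b) * opB b τ c w (t - c * τ))
        have h7 : 1 / (1 - b) * (1 - (1 - b) * opB b τ c w (t - c * τ))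
            = 1 / (1 - b) - opB b τ c w (t - c * τ) := by field_simp
        linarith
      rw [hw, deriv_deriv_glue_right h, deriv_glue_right h, dg, ddg, ← hw]
      have e1 : ∀ a, expPoly a 0 m t = a * Real.exp (m * t) := fun a => by simp [expPoly]
      simp only [e1]
      linarith
  · rw [dg, df]
    simp [expPoly]
    linarith

/-- The second derivative of `superSol` jumps at `0`, so it is not a fixed point of the
iteration. -/
theorem superSol_ne_of_contDiff (hk : 0 < k) (hθ : θ ≤ k / 2) (hm : m < 0) {v : ℝ → ℝ}
    (hv : ContDiff ℝ 2 v) : v ≠ superSol k θ m := by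
  intro h
  have hden : 0 < k - θ - m := by linarith
  set p := -m / (k - θ - m) with hp
  have hp0 : 0 < p := div_pos (by linarith) hden
  have hp1 : p < 1 := (div_lt_one hden).2 (by linarith)
  have hcont : Continuous (deriv (deriv v)) := by
    have := hv.iterate_deriv' 0 2
    simpa using this.continuous
  have h1 : Tendsto (deriv (deriv v)) (𝓝[<] 0) (𝓝 (deriv (deriv v) 0)) :=
    (hcont.tendsto 0).mono_left nhdsWithin_le_nhds
  have h2 : Tendsto (deriv (deriv v)) (𝓝[>] 0) (𝓝 (deriv (deriv v) 0)) :=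
    (hcont.tendsto 0).mono_left nhdsWithin_le_nhds
  have hv' : deriv (deriv v) = deriv (deriv (superSol k θ m)) := by rw [h]
  have h3 : Tendsto (deriv (deriv v)) (𝓝[<] 0)
      (𝓝 (expPoly (k * (k * p + -θ * p) + k * (-θ * p)) (k * (k * (-θ * p))) k 0)) := by
    refine (((continuous_expPoly _ _ _).tendsto 0).mono_left nhdsWithin_le_nhds).congr'
      (eventually_nhdsWithin_of_forall fun s hs => ?_)
    rw [hv', superSol, deriv_deriv_glue_left hs, deriv_expPoly, deriv_expPoly]
  have h4 : Tendsto (deriv (deriv v)) (𝓝[>] 0) (𝓝 (-expPoly (m * (m * (1 - p))) 0 m 0)) := by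
    refine (((continuous_expPoly _ _ _).neg.tendsto 0).mono_left nhdsWithin_le_nhds).congr'
      (eventually_nhdsWithin_of_forall fun s hs => ?_)
    rw [hv', superSol, deriv_deriv_glue_right hs, deriv_one_sub_expPoly, deriv_neg_expPoly]
    rfl
  have h5 := tendsto_nhds_unique h1 h3
  have h6 := tendsto_nhds_unique h2 h4
  rw [h5] at h6
  simp only [expPoly, mul_zero, add_zero, Real.exp_zero, mul_one] at h6
  -- The left second derivative at 0 is this non-negative quantity and the right one is -m²(1 - p) <
  -- 0, so no C² function matches.
  have h7 : 0 ≤ p * k * (k - 2 * θ) :=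
    mul_nonneg (mul_pos hp0 hk).le (by linarith)
  have h8 : 0 < m * (m * (1 - p)) := by
    rw [← mul_assoc]
    exact mul_pos (mul_pos_of_neg_of_neg hm hm) (by linarith)
  have e : k * (k * p + -θ * p) + k * (-θ * p) = p * k * (k - 2 * θ) := by ring
  linarith

end superSol

theorem exists_first_zero {Q : ℝ → ℝ} (hc : Continuous Q) (hpos : ∀ᶠ t in atBot, 0 < Q t)
    (h0 : Q 0 < 0) : ∃ t₀, t₀ < 0 ∧ Q t₀ = 0 ∧ ∀ t < t₀, 0 < Q t := by
  obtain ⟨T, hT⟩ := eventually_atBot.1 hpos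
  have hT0 : T ≤ 0 := by
    by_contra hcon
    linarith [hT 0 (not_le.1 hcon).le]
  obtain ⟨t₀, ⟨ht, hQ⟩, hmin⟩ := (isCompact_Icc.inter_right
    (isClosed_Iic.preimage hc : IsClosed (Q ⁻¹' Set.Iic 0))).exists_isLeast
    ⟨0, Set.right_mem_Icc.2 hT0, h0.le⟩
  have hlt : ∀ t < t₀, 0 < Q t := fun t h => by
    rcases le_or_gt t T with h1 | h1
    · exact hT t h1
    · by_contra hcon
      exact absurd (hmin ⟨⟨h1.le, h.le.trans ht.2⟩, not_lt.1 hcon⟩) (not_le.2 h)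
  have hzero : Q t₀ = 0 := le_antisymm hQ (ge_of_tendsto
    ((hc.tendsto t₀).mono_left (nhdsWithin_le_nhds (s := Set.Iio t₀)))
    (eventually_nhdsWithin_of_forall fun t h => (hlt t h).le))
  exact ⟨t₀, lt_of_le_of_ne ht.2 fun h => by rw [h] at hzero; linarith, hzero, hlt⟩

theorem deriv_nonpos_of_first_zero {Q : ℝ → ℝ} {d t₀ : ℝ} (hd : HasDerivAt Q d t₀) (h0 : Q t₀ = 0)
    (hlt : ∀ t < t₀, 0 < Q t) : d ≤ 0 := by
  have h1 := (hasDerivWithinAt_iff_tendsto_slope' (s := Set.Iio t₀) (by simp)).1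
    hd.hasDerivWithinAt
  refine le_of_tendsto h1 (eventually_nhdsWithin_of_forall fun t ht => ?_)
  rw [slope_def_field, h0, sub_zero]
  exact div_nonpos_of_nonneg_of_nonpos (hlt t ht).le (by linarith [Set.mem_Iio.1 ht])

/-- The candidate (p' + qt)e^{kt} + ne^{νt} is cut to 0 at its first zero, where its slope is
non-positive, so the corner is convex. Its linear part leaves nχ₀(ν)e^{νt}, and `hn` says that this
absorbs the quadratic term of F. -/
theorem exists_subSolution_le (hb0 : 0 ≤ b) (hb1 : b < 1) (hh : 0 ≤ c * τ) {k ν p p' q n : ℝ}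
    (hk : 0 < k) (hkν : k < ν) (hνk : ν < 2 * k) (hχ : chi0 b τ c k = 0)
    (hχ' : q * chi0Deriv b τ c k = 0)
    (hn : (|p| + |q| / (k - ν / 2)) ^ 2 / (1 - b) ≤ n * chi0 b τ c ν)
    (hle : ∀ t ≤ 0, expPoly p' q k t + expPoly n 0 ν t ≤ expPoly p q k t) (h0 : p' + n < 0)
    (hpos : ∀ᶠ t in atBot, 0 < p' + q * t + n * Real.exp ((ν - k) * t)) {wp : ℝ → ℝ}
    (hwp : ∀ t ≤ 0, wp t = expPoly p q k t) (hmem : ∀ t, wp t ∈ Set.Icc (0 : ℝ) 1)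
    (hbot : Tendsto wp atBot (𝓝 0)) :
    ∃ wm, IsSubSolution b τ c wm ∧ ∀ t, wm t ≤ wp t := by
  have hb : 0 < 1 - b := by linarith
  have hν : 0 < ν := hk.trans hkν
  have hconvk : b * Real.exp (-(k * c * τ)) < 1 := (mul_exp_neg_le hb0 hh hk.le).trans_lt hb1
  have hconvν : b * Real.exp (-(ν * c * τ)) < 1 := (mul_exp_neg_le hb0 hh hν.le).trans_lt hb1
  set P : ℝ → ℝ := fun t => expPoly p' q k t + expPoly n 0 ν t with hP
  have cP : ContDiff ℝ 2 P := (contDiff_expPoly _ _ _).add (contDiff_expPoly _ _ _)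
  have dP : deriv P = fun t => deriv (expPoly p' q k) t + deriv (expPoly n 0 ν) t := funext fun t => by
    rw [deriv_expPoly, deriv_expPoly]
    exact ((hasDerivAt_expPoly p' q k t).add (hasDerivAt_expPoly n 0 ν t)).deriv
  have ddP : deriv (deriv P)
      = fun t => deriv (deriv (expPoly p' q k)) t + deriv (deriv (expPoly n 0 ν)) t := by
    rw [dP]
    funext t
    simp only [deriv_expPoly]
    exact ((hasDerivAt_expPoly _ _ k t).add (hasDerivAt_expPoly _ _ ν t)).deriv
  have hPpos : ∀ᶠ t in atBot, 0 < P t := hpos.mono fun t ht => by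
    have e : P t = Real.exp (k * t) * (p' + q * t + n * Real.exp ((ν - k) * t)) := by
      have : Real.exp (ν * t) = Real.exp (k * t) * Real.exp ((ν - k) * t) := by
        rw [← Real.exp_add]; ring_nf
      simp only [hP, expPoly]
      rw [this]
      ring
    rw [e]
    exact mul_pos (Real.exp_pos _) ht
  obtain ⟨t₂, ht₂, hPt₂, hPlt⟩ := exists_first_zero cP.continuous hPpos (by simpa [hP, expPoly] using h0)
  have hdt₂ : deriv P t₂ ≤ 0 :=
    deriv_nonpos_of_first_zero (hasDerivAt_deriv_of_contDiff_two cP t₂).1 hPt₂ hPlt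
  set w := glue t₂ P (fun _ => 0) with hw
  have hcont : Continuous w := continuous_glue cP.continuous continuous_const hPt₂
  have hwnonneg : ∀ t, 0 ≤ w t := fun t => by
    rcases le_or_gt t t₂ with h | h
    · rw [hw, glue_of_le _ _ h]
      rcases h.eq_or_lt with h1 | h1
      · rw [h1, hPt₂]
      · exact (hPlt t h1).le
    · rw [hw, glue_of_lt _ _ h]
  have hwle : ∀ t, w t ≤ wp t := fun t => by
    rcases le_or_gt t t₂ with h | h
    · rw [hw, glue_of_le _ _ h, hwp t (h.trans ht₂.le)]
      exact hle t (h.trans ht₂.le)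
    · rw [hw, glue_of_lt _ _ h]
      exact (hmem t).1
  have hwmem : ∀ t, w t ∈ Set.Icc (0 : ℝ) 1 := fun t => ⟨hwnonneg t, (hwle t).trans (hmem t).2⟩
  refine ⟨w, ⟨hcont, hwnonneg, ⟨t₂ - 1, t₂ + 1, ?_⟩, squeeze_zero hwnonneg hwle hbot, t₂, ?_,
    fun t ht => ?_, deriv P t₂, deriv (fun _ => (0 : ℝ)) t₂, tendsto_deriv_glue_left cP,
    tendsto_deriv_glue_right contDiff_const, by simpa using hdt₂⟩, hwle⟩
  · rw [hw, glue_of_le _ _ (by linarith), glue_of_lt _ _ (by linarith)]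
    exact (hPlt _ (by linarith)).ne'
  · have bnd : ∀ p₁ q₁ n₁ q₂ t, t ≤ t₂ → |expPoly p₁ q₁ k t + expPoly n₁ q₂ ν t|
        ≤ (|p₁| + |q₁| / k) + (|n₁| + |q₂| / ν) := fun p₁ q₁ n₁ q₂ t ht =>
      (abs_add_le _ _).trans (add_le_add (abs_expPoly_le p₁ q₁ hk (ht.trans ht₂.le))
        (abs_expPoly_le n₁ q₂ hν (ht.trans ht₂.le)))
    have e1 : deriv P = fun t => expPoly (k * p' + q) (k * q) k t + expPoly (ν * n + 0) (ν * 0) ν t := by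
      rw [dP, deriv_expPoly, deriv_expPoly]
    have e2 : deriv (deriv P) = fun t => expPoly (k * (k * p' + q) + k * q) (k * (k * q)) k t
        + expPoly (ν * (ν * n + 0) + ν * 0) (ν * (ν * 0)) ν t := by
      rw [ddP]
      simp only [deriv_expPoly]
    refine isCb2Off_glue cP contDiff_const (C := ((|p'| + |q| / k) + (|n| + |(0 : ℝ)| / ν)) +
      (((|k * p' + q| + |k * q| / k) + (|ν * n + 0| + |ν * 0| / ν)) +
      ((|k * (k * p' + q) + k * q| + |k * (k * q)| / k) +
        (|ν * (ν * n + 0) + ν * 0| + |ν * (ν * 0)| / ν)))) (C' := 0) (fun t ht => ?_)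
      fun t _ => by simp
    rw [e2, e1]
    have h1 := bnd p' q n 0 t ht
    have h2 := bnd (k * p' + q) (k * q) (ν * n + 0) (ν * 0) t ht
    have h3 := bnd (k * (k * p' + q) + k * q) (k * (k * q)) (ν * (ν * n + 0) + ν * 0)
      (ν * (ν * 0)) t ht
    have h1' := (abs_nonneg _).trans h1
    have h2' := (abs_nonneg _).trans h2
    have h3' := (abs_nonneg _).trans h3
    exact ⟨by linarith, by linarith, by linarith⟩
  · have hB := opB_nonneg (τ := τ) (c := c) hb0 hwnonneg t
    have hL := opB_nonneg (τ := τ) (c := c) hb0 hwnonneg (t - c * τ)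
    rw [opF, opL]
    rcases lt_or_gt_of_ne ht with h | h
    -- Splitting off e^{νt/2}, possible since ν/2 < k, leaves a factor bounded by K on the left
    -- half-line, linear term included. The product of two such bounds has the order e^{νt}.
    · set K := |p| + |q| / (k - ν / 2) with hK
      have hkν2 : 0 < k - ν / 2 := by linarith
      have hK0 : 0 ≤ K := by positivity
      have hwK : ∀ s ≤ t, w s ≤ K * Real.exp (ν / 2 * t) := by
        intro s hs
        have hs0 : s ≤ 0 := hs.trans (h.le.trans ht₂.le)
        refine (hwle s).trans ?_
        rw [hwp s hs0]
        have e : expPoly p q k s = expPoly p q (k - ν / 2) s * Real.exp (ν / 2 * s) := by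
          rw [expPoly, expPoly, mul_assoc, ← Real.exp_add]
          ring_nf
        rw [e]
        exact mul_le_mul ((le_abs_self _).trans (abs_expPoly_le p q hkν2 hs0))
          (Real.exp_le_exp.2 (by nlinarith)) (Real.exp_pos _).le hK0
      have hBle : ∀ s ≤ t, opB b τ c w s ≤ K * Real.exp (ν / 2 * t) / (1 - b) := by
        intro s hs
        rw [← opB_const (τ := τ) (c := c) hb0 hb1 _ s]
        exact opB_le_of_le_Iic hb0 hh (summable_opB hb0 hb1 (abs_le_one_of_mem hwmem) s)
          (summable_opB (τ := τ) (c := c) (w := fun _ => K * Real.exp (ν / 2 * t)) hb0 hb1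
            (C := |K * Real.exp (ν / 2 * t)|) (fun _ => le_rfl) s)
          fun x hx => hwK x (hx.trans hs)
      have h1 := mul_le_mul (hBle t le_rfl) (hBle (t - c * τ) (by linarith)) hL (hB.trans (hBle t le_rfl))
      have h2 := mul_le_mul_of_nonneg_left h1 hb.le
      have e2 : (1 - b) * (K * Real.exp (ν / 2 * t) / (1 - b) * (K * Real.exp (ν / 2 * t) / (1 - b)))
          = K ^ 2 / (1 - b) * Real.exp (ν * t) := by
        have : Real.exp (ν * t) = Real.exp (ν / 2 * t) * Real.exp (ν / 2 * t) := by
          rw [← Real.exp_add]; ring_nf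
        rw [this]
        field_simp
      have h3 := mul_le_mul_of_nonneg_right hn (Real.exp_pos (ν * t)).le
      have e : opB b τ c w t
          = n * chi0 b τ c ν * Real.exp (ν * t) - deriv (deriv P) t + c * deriv P t := by
        rw [hw, opB_glue_of_le hh h.le, ddP, dP]
        have hs := (hasSum_expPoly hb0 hconvk p' q t).add (hasSum_expPoly hb0 hconvν n 0 t)
        simp only [← mul_add] at hs
        refine hs.tsum_eq.trans ?_
        rw [hχ, hχ']
        simp only [expPoly, mul_zero, zero_mul, add_zero]
        ring
      rw [hw, deriv_deriv_glue_left h, deriv_glue_left h, ← hw]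
      rw [e2] at h2
      linarith
    · rw [hw, deriv_deriv_glue_right h, deriv_glue_right h, ← hw]
      have h2 := mul_opB_mem (τ := τ) (c := c) hb0 hb1 hwmem (t - c * τ)
      have h3 : 0 ≤ opB b τ c w t * (1 - (1 - b) * opB b τ c w (t - c * τ)) :=
        mul_nonneg hB (by linarith [h2.2])
      simpa using h3

theorem CharRoots.exists_sub_super (R : CharRoots b τ c l m) {z₀ : ℝ} (hz₀ : 0 < z₀)
    (hχ₀ : chi0 b τ c z₀ = 0) :
    ∃ wm wp : ℝ → ℝ, IsSubSolution b τ c wm ∧ IsSuperSolution b τ c wp ∧ (∀ t, wm t ≤ wp t) ∧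
      ∀ v : ℝ → ℝ, ContDiff ℝ 2 v → v ≠ wp := by
  have hb0 := R.b_nonneg
  have hb1 := R.b_lt_one
  have hh := R.delay_pos.le
  have hb : 0 < 1 - b := by linarith
  obtain ⟨k, ν, hk, hkν, hνk, hχ, hcase⟩ := exists_tail_exponents hb0 hb1 hh hz₀ hχ₀
  rcases hcase with hneg | ⟨hder, hpos⟩
  · have hsup : IsSuperSolution b τ c (superSol k 0 m) :=
      isSuperSolution_superSol R hk le_rfl (by linarith) hχ (zero_mul _)
    set p := -m / (k - 0 - m) with hp
    have hp0 : 0 < p := div_pos (by linarith [R.m_neg]) (by linarith [R.m_neg])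
    set A := (|p| + |(0 : ℝ)| / (k - ν / 2)) ^ 2 / (1 - b) with hA
    have hA0 : 0 ≤ A := by positivity
    -- Negative because χ₀(ν) < 0: the last summand absorbs the quadratic error, and p + 1 makes the
    -- candidate negative at 0.
    set n := -(p + 1 + A / (-chi0 b τ c ν)) with hn
    have hdiv : 0 ≤ A / (-chi0 b τ c ν) := div_nonneg hA0 (by linarith)
    obtain ⟨wm, h1, h2⟩ := exists_subSolution_le (p := p) (p' := p) (q := 0) (n := n)
      hb0 hb1 hh hk hkν hνk hχ (zero_mul _) (by
        have e : A / (-chi0 b τ c ν) * (-chi0 b τ c ν) = A := div_mul_cancel₀ _ (by linarith)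
        change A ≤ _
        rw [hn]
        nlinarith) (fun t _ => by
        have : expPoly n 0 ν t ≤ 0 := by
          rw [expPoly, zero_mul, add_zero]
          exact mul_nonpos_of_nonpos_of_nonneg (by linarith) (Real.exp_pos _).le
        linarith) (by linarith) (by
        have h3 : Tendsto (fun t => p + 0 * t + n * Real.exp ((ν - k) * t)) atBot
            (𝓝 (p + 0 + n * 0)) := by
          simp only [zero_mul]
          exact tendsto_const_nhds.add ((tendsto_exp_mul_atBot (by linarith)).const_mul n)
        rw [mul_zero, add_zero, add_zero] at h3
        exact h3.eventually_const_lt hp0)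
      (fun t ht => by rw [superSol_of_le ht, ← hp]; simp) hsup.mem_Icc hsup.2.2.2.1
    exact ⟨wm, _, h1, hsup, h2, fun v hv => superSol_ne_of_contDiff hk (by linarith) R.m_neg hv⟩
  · have hsup : IsSuperSolution b τ c (superSol k (k / 2) m) :=
      isSuperSolution_superSol R hk (by linarith) le_rfl hχ (by rw [hder, mul_zero])
    set p := -m / (k - k / 2 - m) with hp
    have hp0 : 0 < p := div_pos (by linarith [R.m_neg]) (by linarith [R.m_neg])
    set q := -(k / 2) * p with hq
    have hq0 : q < 0 := by
      have := mul_pos hk hp0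
      linarith
    set A := (|p| + |q| / (k - ν / 2)) ^ 2 / (1 - b) with hA
    have hA0 : 0 ≤ A := by positivity
    -- Here χ₀(ν) > 0, so n ≥ 0. The constant -n - 1 makes the candidate equal to -1 at 0 and keeps
    -- it below the super-solution; qt with q < 0 makes it positive near -∞.
    set n := A / chi0 b τ c ν with hn
    have hn0 : 0 ≤ n := div_nonneg hA0 hpos.le
    obtain ⟨wm, h1, h2⟩ := exists_subSolution_le (p := p) (p' := -n - 1) (q := q) (n := n)
      hb0 hb1 hh hk hkν hνk hχ (by rw [hder, mul_zero]) (by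
        rw [hn, div_mul_cancel₀ _ hpos.ne']) (fun t ht => by
        have h3 : Real.exp (ν * t) ≤ Real.exp (k * t) := Real.exp_le_exp.2 (by nlinarith)
        have h4 := mul_le_mul_of_nonneg_left h3 hn0
        have h5 := mul_pos (by linarith : 0 < p + 1) (Real.exp_pos (k * t))
        simp only [expPoly]
        linarith) (by linarith) (by
        filter_upwards [eventually_lt_atBot ((n + 1) / q)] with t ht
        have h3 : n + 1 < t * q := by rwa [lt_div_iff_of_neg hq0] at ht
        have h4 : 0 ≤ n * Real.exp ((ν - k) * t) := mul_nonneg hn0 (Real.exp_pos _).le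
        linarith)
      (fun t ht => by rw [superSol_of_le ht]) hsup.mem_Icc hsup.2.2.2.1
    exact ⟨wm, _, h1, hsup, h2, fun v hv => superSol_ne_of_contDiff hk le_rfl R.m_neg hv⟩

end

end NeutralKPP

/-! ### Fronts as their own sub- and super-solutions, and the conclusion -/

namespace NeutralKPP

variable {b τ c l m : ℝ}

theorem IsCb2.isCb2Off {w : ℝ → ℝ} (h : IsCb2 w) (t₁ : ℝ) : IsCb2Off t₁ w :=
  ⟨h.1.contDiffOn, h.2.imp fun _ hC t _ => hC t⟩

namespace IsMonotoneFront

variable {φ : ℝ → ℝ} (F : IsMonotoneFront b τ c φ)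
include F

theorem isCb2_neutralDiff (hb0 : 0 ≤ b) (hb1 : b < 1) (hc : 0 ≤ c) (hh : 0 ≤ c * τ) :
    IsCb2 (neutralDiff b τ c φ) := by
  have h1 : ∀ t, |deriv (neutralDiff b τ c φ) t| ≤ c := fun t => by
    rw [abs_of_nonneg (F.deriv_nonneg hc t)]
    have := mul_le_mul_of_nonneg_left (F.neutralDiff_le hc t) hc
    nlinarith [F.deriv_le t, mul_nonneg hc hb0]
  have h2 : ∀ t, |c * deriv (neutralDiff b τ c φ) t + -(φ t * (1 - φ (t - c * τ)))|
      ≤ c * c + 1 := fun t => by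
    have a1 := _root_.abs_le.1 (h1 t)
    have a2 := F.mem_Icc t
    have a3 := F.mem_Icc (t - c * τ)
    have a4 := F.reaction_nonneg t
    have a5 : φ t * (1 - φ (t - c * τ)) ≤ 1 :=
      mul_le_one₀ a2.2 (by linarith [a3.2]) (by linarith [a3.1])
    have a6 := mul_le_mul_of_nonneg_left a1.2 hc
    have a7 := mul_nonneg hc (F.deriv_nonneg hc t)
    rw [_root_.abs_le]
    constructor <;> nlinarith
  have h3 : deriv (deriv (neutralDiff b τ c φ))
      = fun t => c * deriv (neutralDiff b τ c φ) t + -(φ t * (1 - φ (t - c * τ))) :=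
    funext fun t => (F.hasDerivAt_deriv t).deriv
  refine ⟨F.smooth, 1 + c + (c * c + 1), fun t => ?_⟩
  have := mul_nonneg hc hc
  refine ⟨?_, ?_, ?_⟩
  · linarith [F.abs_neutralDiff_le hb0 hb1 hc hh t]
  · linarith [h1 t]
  · rw [h3]; linarith [h2 t]

/-- The rescaled neutral difference of a front is a smooth solution of `w'' - c w' + F(w) = 0`. -/
theorem normalized (hb0 : 0 ≤ b) (hb1 : b < 1) (hc : 0 ≤ c) (hh : 0 ≤ c * τ) :
    IsCb2 (fun t => neutralDiff b τ c φ t / (1 - b)) ∧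
      (∀ t, opB b τ c (fun t => neutralDiff b τ c φ t / (1 - b)) t = φ t / (1 - b)) ∧
      ∀ t, deriv (deriv fun t => neutralDiff b τ c φ t / (1 - b)) t
        - c * deriv (fun t => neutralDiff b τ c φ t / (1 - b)) t
        + opF b τ c (fun t => neutralDiff b τ c φ t / (1 - b)) t = 0 := by
  have hb : 0 < 1 - b := by linarith
  obtain ⟨-, C, hC⟩ := F.isCb2_neutralDiff hb0 hb1 hc hh
  have e1 : deriv (fun t => neutralDiff b τ c φ t / (1 - b))
      = fun t => deriv (neutralDiff b τ c φ) t / (1 - b) :=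
    funext fun t => ((F.hasDerivAt t).div_const _).deriv
  have e2 : deriv (fun t => deriv (neutralDiff b τ c φ) t / (1 - b))
      = fun t => deriv (deriv (neutralDiff b τ c φ)) t / (1 - b) :=
    funext fun t => ((hasDerivAt_deriv_of_contDiff_two F.smooth t).2.div_const _).deriv
  have e3 : ∀ t, opB b τ c (fun t => neutralDiff b τ c φ t / (1 - b)) t = φ t / (1 - b) := by
    intro t
    rw [← F.opB_neutralDiff hb0 hb1 t, opB, opB, ← tsum_div_const]
    simp only [mul_div_assoc]
  refine ⟨⟨F.smooth.div_const _, C / (1 - b), fun t => ?_⟩, e3, fun t => ?_⟩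
  · rw [e1, e2]
    simp only [abs_div, abs_of_pos hb]
    exact ⟨div_le_div_of_nonneg_right (hC t).1 hb.le, div_le_div_of_nonneg_right (hC t).2.1 hb.le,
      div_le_div_of_nonneg_right (hC t).2.2 hb.le⟩
  · rw [e1, e2, opF, opL, e3, e3, mul_div_cancel₀ _ hb.ne']
    linear_combination (1 / (1 - b)) * F.eq t

/-- The rescaled neutral difference is C² and satisfies the equation with equality, so it serves as
both members of the pair. The iteration starting from it is stationary because N is a left inverse
of 𝒟. -/
theorem exists_iteration {N : ℝ → ℝ} (hN : IsInverseKernel b τ c N) (hb0 : 0 ≤ b) (hb1 : b < 1)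
    (hτ : 0 < τ) :
    ∃ wm wp : ℝ → ℝ, IsSubSolution b τ c wm ∧ IsSuperSolution b τ c wp ∧ (∀ t, wm t ≤ wp t) ∧
      IterationYields b τ c N wp φ := by
  have hc := (F.speed_pos hb1).le
  have hh := mul_nonneg hc hτ.le
  have hb : 0 < 1 - b := by linarith
  obtain ⟨h2, hB, heq⟩ := F.normalized hb0 hb1 hc hh
  set w : ℝ → ℝ := fun t => neutralDiff b τ c φ t / (1 - b) with hw
  have hcont : Continuous w := h2.1.continuous
  have hpos : ∀ t, 0 < w t := fun t => div_pos (F.neutralDiff_pos hb0 hb1 hh t) hb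
  have hmono : Monotone w := fun s t hst =>
    div_le_div_of_nonneg_right (F.monotone_neutralDiff hc hst) hb.le
  have hbot : Tendsto w atBot (𝓝 0) := by
    simpa using F.tendsto_neutralDiff_atBot.div_const (1 - b)
  have htop : Tendsto w atTop (𝓝 1) := by
    have := F.tendsto_neutralDiff_atTop.div_const (1 - b)
    rwa [div_self hb.ne'] at this
  have hd : ∀ s : Set ℝ, Tendsto (deriv w) (𝓝[s] 0) (𝓝 (deriv w 0)) := fun s =>
    (h2.continuous_deriv.tendsto 0).mono_left nhdsWithin_le_nhds
  have hiter : ∀ n, iter b τ c N w n = w := by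
    intro n
    induction n with
    | zero => rfl
    | succ n ih =>
      have e : (fun t => -opH b τ c w t) = opD b τ c w := by
        funext t
        rw [opH, opD]
        linarith [heq t]
      rw [iter_succ, ih, ← opI_neg, e, hN.left_inv w h2]
  have hne : ∃ s t, w s ≠ w t := by
    by_contra! hcon
    have e : w = fun _ => w 0 := funext fun t => hcon t 0
    rw [e] at hbot htop
    have := (tendsto_const_nhds_iff.1 hbot).symm.trans (tendsto_const_nhds_iff.1 htop)
    exact zero_ne_one this
  refine ⟨w, w, ⟨hcont, fun t => (hpos t).le, hne, hbot, 0, h2.isCb2Off 0,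
    fun t _ => (heq t).ge, _, _, hd _, hd _, le_rfl⟩,
    ⟨hcont, hpos, hmono, hbot, htop, 0, h2.isCb2Off 0, fun t _ => (heq t).le, _, _, hd _, hd _,
      le_rfl⟩, fun _ => le_rfl, ?_⟩
  constructor
  · intro n; rw [hiter]; exact hmono
  · intro t; simp only [hiter]; exact antitone_const
  · intro t; simp only [hiter]; exact tendsto_const_nhds
  · intro t
    simp only [hiter, hB]
    rw [mul_div_cancel₀ _ hb.ne']
    exact tendsto_const_nhds

end IsMonotoneFront

theorem contDiff_iter_succ (hb0 : 0 ≤ b) (hb1 : b < 1) {N wp : ℝ → ℝ}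
    (hN : IsInverseKernel b τ c N) {n : ℕ} (hc : Continuous (iter b τ c N wp n))
    (hmem : ∀ t, iter b τ c N wp n t ∈ Set.Icc (0 : ℝ) 1) :
    ContDiff ℝ 2 (iter b τ c N wp (n + 1)) := by
  rw [iter_succ, ← opI_neg]
  exact (hN.right_inv _ ⟨(continuous_opH hb0 hb1 hmem hc).neg, 1 / (1 - b), fun t => by
    rw [Pi.neg_apply, abs_neg]; exact abs_opH_le hb0 hb1 hmem t⟩).1.1

/-- Non-stationarity comes from regularity: the first iterate is C², and the constructed
super-solution is not. -/
theorem exists_kernel_and_pair (hb0 : 0 ≤ b) (hb1 : b < 1) (hτ : 0 < τ)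
    (h : (τ, c) ∈ frakD b) :
    ∃ N : ℝ → ℝ, IsInverseKernel b τ c N ∧
      (∃ wm wp : ℝ → ℝ, IsSubSolution b τ c wm ∧ IsSuperSolution b τ c wp ∧
        (∀ t, wm t ≤ wp t) ∧ iter b τ c N wp 1 ≠ wp) ∧
      ∀ wm wp : ℝ → ℝ, IsSubSolution b τ c wm → IsSuperSolution b τ c wp →
        (∀ t, wm t ≤ wp t) →
        ∃ φ : ℝ → ℝ, IsMonotoneFront b τ c φ ∧ IterationYields b τ c N wp φ := by
  obtain ⟨-, hc0, ⟨z₀, hz₀, -, hχ₀⟩, m, hm, hden, hχ₁⟩ := h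
  have hc : 0 < c := speed_pos_of_chi0_zero hb1 hc0 hχ₀
  obtain ⟨l, R⟩ := exists_charRoots hb0 hb1 hc hτ hm hden hχ₁
  obtain ⟨N, hN, hNneg, hcN⟩ := R.exists_inverseKernel
  obtain ⟨wm, wp, h1, h2, hle, hne⟩ := R.exists_sub_super hz₀ hχ₀
  exact ⟨N, hN, ⟨wm, wp, h1, h2, hle, hne _ (contDiff_iter_succ hb0 hb1 hN h2.1 h2.mem_Icc)⟩,
    fun wm wp hm hp hle => R.exists_front_of_iteration hN hcN hm hp hle⟩

end NeutralKPP

theorem theorem1p6 (b τ : ℝ) (hb0 : 0 ≤ b) (hb1 : b < 1) (hτ : 0 < τ) (c : ℝ) :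
    ((∃ φ : ℝ → ℝ, NeutralKPP.IsMonotoneFront b τ c φ) ↔ (τ, c) ∈ NeutralKPP.frakD b) ∧
    ((τ, c) ∈ NeutralKPP.frakD b →
      ∃ N : ℝ → ℝ, NeutralKPP.IsInverseKernel b τ c N ∧
        (∃ wm wp : ℝ → ℝ, NeutralKPP.IsSubSolution b τ c wm ∧
          NeutralKPP.IsSuperSolution b τ c wp ∧ (∀ t, wm t ≤ wp t) ∧
          NeutralKPP.iter b τ c N wp 1 ≠ wp) ∧
        (∀ φ : ℝ → ℝ, NeutralKPP.IsMonotoneFront b τ c φ →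
          ∃ wm wp : ℝ → ℝ, NeutralKPP.IsSubSolution b τ c wm ∧
            NeutralKPP.IsSuperSolution b τ c wp ∧ (∀ t, wm t ≤ wp t) ∧
            NeutralKPP.IterationYields b τ c N wp φ) ∧
        (∀ wm wp : ℝ → ℝ, NeutralKPP.IsSubSolution b τ c wm →
          NeutralKPP.IsSuperSolution b τ c wp → (∀ t, wm t ≤ wp t) →
          ∃ φ : ℝ → ℝ, NeutralKPP.IsMonotoneFront b τ c φ ∧
            NeutralKPP.IterationYields b τ c N wp φ)) := by
  refine ⟨⟨fun ⟨φ, F⟩ => F.mem_frakD hb0 hb1 hτ, fun h => ?_⟩, fun h => ?_⟩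
  · obtain ⟨N, -, ⟨wm, wp, h1, h2, hle, -⟩, H⟩ :=
      NeutralKPP.exists_kernel_and_pair hb0 hb1 hτ h
    obtain ⟨φ, F, -⟩ := H wm wp h1 h2 hle
    exact ⟨φ, F⟩
  · obtain ⟨N, hN, hpair, H⟩ := NeutralKPP.exists_kernel_and_pair hb0 hb1 hτ h
    exact ⟨N, hN, hpair, fun φ F => F.exists_iteration hN hb0 hb1 hτ, H⟩
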